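/- **Theorem (Hexagon).** Let $\mathbb{R}^{2,1}$ be $\mathbb{R}^3$ with $v\cdot w=v_1w_1+v_2w_2-v_3w_3$. For a unit spacelike vector $w$ let $w^{\pm}$ be the future-pointing null vectors (third coordinate $1$) orthogonal to $w$ such that $(w^-,w^+,w)$ is right-handed, and let $V(w)=\{a w^- - b w^+ : a,b>0\}$ be its stem quadrant. The crooked plane with direction vector $w$ and vertex $p$ is $$C(w,p)=(p+\mathbb{R}w^+ +\mathbb{R}_{\ge 0}w)\,\cup\,(p+\mathbb{R}w^- -\mathbb{R}_{\ge 0}w)\,\cup\,\{x : (x-p)\cdot w=0,\ (x-p)\cdot(x-p)\le 0\}.$$ A hyperideal triangle is a triple of unit spacelike vectors $v_1,v_2,v_3$ with $v_i\cdot v_j<-1$ and $v_i\cdot v_j^{\pm}\le 0$ for all $i\ne j$. For $w\cdot w\neq 0$ put $\operatorname{Spine}(w)(v)=-v+2\frac{v\cdot w}{w\cdot w}w$. Let $p_0=(0,0,1)$ and $w_0(\theta)=(\cos\theta,\sin\theta,0)$, and let $(w_1,w_2,w_0(\theta))$ be a hyperideal triangle $\kappa$. Put $R_X=\operatorname{Spine}(w_1)$,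 $R_Y=\operatorname{Spine}(w_2)$, $\iota_0=\operatorname{Spine}(p_0)$, $X=R_X\iota_0$, $Y=\iota_0R_Y$, $A=XY$, $B=Y^{-1}X$, $\Gamma_0=\langle X,Y\rangle$ (the holonomy group of a two-holed cross surface) and $\Gamma_0'=\langle R_X,R_Y,\iota_0\rangle$ (its Coxeter extension). For $[u]\in H^1(\Gamma_0,\mathbb{R}^{2,1})$ and $g\in\{X,Y,A,B\}$ let $\alpha_{[u]}(g)=u(g)\cdot g^0$ be the Margulis invariant, where $g^0$ is the unit spacelike fixed vector of $g$ such that $(x^-,x^+,g^0)$ is right-handed, with $x^-,x^+$ the future-pointing repelling and attracting null eigenvectors of $g$. A crooked fundamental domain for an affine deformation $u'$ of $\Gamma_0'$, linearizing to a hyperideal triangle $(v_1,v_2,v_3)$ with face involutions $r_1,r_2,r_3$ generating $\Gamma_0'$, is a triple of pairwise disjoint crooked planes $C(v_i,q_i)$ such that $q_i\in o+V(v_i)$ for a common point $o$ and such that the affine map $x\mapsto r_i x+u'(r_i)$ preserves $C(v_i,q_i)$, for each $i$. Let $\mathbf{P}_1\subset\mathbb{P}(H^1(\Gamma_0,\mathbb{R}^{2,1}))$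 be the set of projective classes of restrictions $[u'|_{\Gamma_0}]$ of those $u'$ that admit a crooked fundamental domain linearizing to $\kappa$, with face involutions $R_X,R_Y,\iota_0$. For $\theta'$ such that $\kappa'=(w_1,\iota_0w_2,w_0(\theta'))$ is a hyperideal triangle (a diagonal flip of $\kappa$), let $\mathbf{P}_2$ be the corresponding set for $\kappa'$, with face involutions $R_X,\iota_0R_Y\iota_0,\iota_0$. Let $\mathbf{Q}$ be the set of projective classes for which $\alpha(X),\alpha(Y),\alpha(A),\alpha(B)$ are all nonzero and of the same sign. Then $\dim H^1(\Gamma_0,\mathbb{R}^{2,1})=3$, so that $\mathbb{P}(H^1(\Gamma_0,\mathbb{R}^{2,1}))\cong\mathbb{R}P^2$, and such a $\theta'$ exists. For every such $\theta'$ (polygons being interiors of strictly convex polygons in the projective plane): 1. $\mathbf{Q}$ is a quadrilateral whose sides, in cyclic order, lie on the lines $\alpha(A)=0$, $\alpha(X)=0$, $\alpha(B)=0$, $\alpha(Y)=0$. 2. The space of crooked fundamental domains $\mathbf{H}=\mathbf{P}_1\cup\mathbf{P}_2$ is a hexagon with vertices $h_0,\dots,h_5$ in cyclic order, and it is inscribed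 in $\mathbf{Q}$: $h_0$ lies in the relative interior of the side on $\alpha(A)=0$, $h_1,h_2$ of the side on $\alpha(X)=0$, $h_3$ of the side on $\alpha(B)=0$, and $h_4,h_5$ of the side on $\alpha(Y)=0$. 3. $\mathbf{P}_1$ is the pentagon with vertices $h_0,h_1,h_2,h_4,h_5$, and $\mathbf{P}_2$ is the pentagon with vertices $h_1,h_2,h_3,h_4,h_5$. -/

import Mathlib

open CategoryTheory groupCohomology
open scoped LinearAlgebra.Projectivization

noncomputable section

namespace CrookedHexagon

/-! ### Minkowski space -/

/-- The vector space underlying Minkowski space `ℝ^{2,1}`; the last coordinate is time. -/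
abbrev Mink : Type := Fin 3 → ℝ

/-- The Lorentzian inner product of signature `(2,1)`. -/
def dot (v w : Mink) : ℝ := v 0 * w 0 + v 1 * w 1 - v 2 * w 2

/-- The determinant of three vectors, fixing the orientation of `ℝ^{2,1}`. -/
def det3 (a b c : Mink) : ℝ := Matrix.det (Matrix.of ![a, b, c])

lemma dot_add_left (u v w : Mink) : dot (u + v) w = dot u w + dot v w := by
  simp only [dot, Pi.add_apply]; ring

lemma dot_smul_left (a : ℝ) (v w : Mink) : dot (a • v) w = a * dot v w := by
  simp only [dot, Pi.smul_apply, smul_eq_mul]; ring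

lemma dot_comm (v w : Mink) : dot v w = dot w v := by
  simp only [dot]; ring

/-- The group `O(2,1)` of linear isometries of Minkowski space. -/
def O21 : Subgroup (Mink ≃ₗ[ℝ] Mink) where
  carrier := {g | ∀ v w, dot (g v) (g w) = dot v w}
  mul_mem' := by
    intro a b ha hb v w
    rw [LinearEquiv.mul_apply, LinearEquiv.mul_apply]
    exact (ha _ _).trans (hb _ _)
  one_mem' := by intro v w; rfl
  inv_mem' := by
    intro a ha v w
    have h := ha (a⁻¹ v) (a⁻¹ w)
    rw [← LinearEquiv.mul_apply, ← LinearEquiv.mul_apply, mul_inv_cancel] at h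
    exact h.symm

/-- The linear map `v ↦ -v + 2 (v·w)/(w·w) w`. -/
def spineMap (w : Mink) : Mink →ₗ[ℝ] Mink where
  toFun v := -v + (2 * (dot v w / dot w w)) • w
  map_add' u v := by
    rw [dot_add_left, add_div, mul_add, add_smul]; abel
  map_smul' a v := by
    rw [dot_smul_left, mul_div_assoc, smul_add, smul_neg, smul_smul, RingHom.id_apply]
    congr 2; ring

lemma spineMap_apply (w v : Mink) :
    spineMap w v = -v + (2 * (dot v w / dot w w)) • w := rfl

lemma dot_spineMap_self (w v : Mink) : dot (spineMap w v) w / dot w w = dot v w / dot w w := by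
  by_cases h : dot w w = 0
  · simp [h]
  · have h1 : dot (spineMap w v) w = dot v w := by
      rw [spineMap_apply, dot_add_left, dot_smul_left, ← neg_one_smul ℝ v, dot_smul_left]
      field_simp; ring
    rw [h1]

lemma spineMap_involutive (w : Mink) : Function.Involutive (spineMap w) := by
  intro v
  rw [spineMap_apply w (spineMap w v), dot_spineMap_self, spineMap_apply]
  abel

lemma dot_spineMap (w u v : Mink) : dot (spineMap w u) (spineMap w v) = dot u v := by
  by_cases h : dot w w = 0
  · simp only [spineMap_apply, h, div_zero, mul_zero, zero_smul, add_zero]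
    simp [dot]
  · have key : dot (spineMap w u) (spineMap w v) = dot u v
        - 2 * (dot u w / dot w w) * dot v w - 2 * (dot v w / dot w w) * dot u w
        + (2 * (dot u w / dot w w)) * (2 * (dot v w / dot w w)) * dot w w := by
      rw [spineMap_apply, spineMap_apply]
      generalize dot u w / dot w w = a
      generalize dot v w / dot w w = b
      simp only [dot, Pi.add_apply, Pi.neg_apply, Pi.smul_apply, smul_eq_mul]
      ring
    rw [key]; field_simp; ring

/-- The spine reflection in `w`, as an element of `O(2,1)`. For spacelike `w` it induces on the
hyperbolic plane the reflection in the geodesic `w^⊥`; for timelike `w` it induces the point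
symmetry in the point `[w]`. -/
def spine (w : Mink) : O21 :=
  ⟨LinearEquiv.ofInvolutive (spineMap w) (spineMap_involutive w), dot_spineMap w⟩

/-- The future-pointing null vector `w^-` (third coordinate `1`) orthogonal to the spacelike
vector `w`. -/
def nullMinus (w : Mink) : Mink :=
  ![(w 2 * w 0 - √(dot w w) * w 1) / (w 0 ^ 2 + w 1 ^ 2),
    (w 2 * w 1 + √(dot w w) * w 0) / (w 0 ^ 2 + w 1 ^ 2), 1]

/-- The future-pointing null vector `w^+` (third coordinate `1`) orthogonal to the spacelike
vector `w`. -/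
def nullPlus (w : Mink) : Mink :=
  ![(w 2 * w 0 + √(dot w w) * w 1) / (w 0 ^ 2 + w 1 ^ 2),
    (w 2 * w 1 - √(dot w w) * w 0) / (w 0 ^ 2 + w 1 ^ 2), 1]

/-- `w^-` and `w^+` are null, orthogonal to `w`, and `(w^-, w^+, w)` is right-handed. -/
lemma null_spec (w : Mink) (hw : 0 < dot w w) :
    dot (nullMinus w) (nullMinus w) = 0 ∧ dot (nullPlus w) (nullPlus w) = 0 ∧
    dot w (nullMinus w) = 0 ∧ dot w (nullPlus w) = 0 ∧
    0 < det3 (nullMinus w) (nullPlus w) w := by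
  have hs : √(dot w w) ^ 2 = w 0 ^ 2 + w 1 ^ 2 - w 2 ^ 2 := by
    rw [Real.sq_sqrt hw.le]; simp only [dot]; ring
  have hs0 : 0 < √(dot w w) := Real.sqrt_pos.2 hw
  have hr : 0 < w 0 ^ 2 + w 1 ^ 2 := by
    have : 0 < w 0 ^ 2 + w 1 ^ 2 - w 2 ^ 2 := by rw [← hs]; positivity
    nlinarith [sq_nonneg (w 2)]
  have hr' := hr.ne'
  simp only [nullMinus, nullPlus]
  generalize √(dot w w) = s at hs hs0
  refine ⟨?_, ?_, ?_, ?_, ?_⟩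
  · simp [dot]; field_simp; linear_combination (w 0 ^ 2 + w 1 ^ 2) * hs
  · simp [dot]; field_simp; linear_combination (w 0 ^ 2 + w 1 ^ 2) * hs
  · simp [dot]; field_simp; ring
  · simp [dot]; field_simp; ring
  · have : det3 ![(w 2 * w 0 - s * w 1) / (w 0 ^ 2 + w 1 ^ 2),
        (w 2 * w 1 + s * w 0) / (w 0 ^ 2 + w 1 ^ 2), 1]
        ![(w 2 * w 0 + s * w 1) / (w 0 ^ 2 + w 1 ^ 2),
        (w 2 * w 1 - s * w 0) / (w 0 ^ 2 + w 1 ^ 2), 1] w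
        = 2 * s ^ 3 / (w 0 ^ 2 + w 1 ^ 2) := by
      simp [det3, Matrix.det_fin_three]
      field_simp
      linear_combination (-2 * s * (w 0 ^ 2 + w 1 ^ 2)) * hs
    rw [this]; positivity

/-! ### Crooked planes -/

/-- The crooked plane with direction vector `w` and vertex `p`: two half-plane wings and a stem. -/
def crookedPlane (w p : Mink) : Set Mink :=
  {x | ∃ t s : ℝ, 0 ≤ s ∧ x = p + t • nullPlus w + s • w} ∪
  {x | ∃ t s : ℝ, 0 ≤ s ∧ x = p + t • nullMinus w - s • w} ∪
  {x | dot w (x - p) = 0 ∧ dot (x - p) (x - p) ≤ 0}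

/-- The (open) stem quadrant `V(w) = ℝ_{>0} w^- - ℝ_{>0} w^+`. -/
def stemQuadrant (w : Mink) : Set Mink :=
  {q | ∃ a b : ℝ, 0 < a ∧ 0 < b ∧ q = a • nullMinus w - b • nullPlus w}

/-- Three unit spacelike vectors that are consistently oriented and define pairwise ultraparallel
geodesics: the geodesics `(w i)^⊥` bound a hyperideal triangle. -/
structure IsHyperidealTriangle (w : Fin 3 → Mink) : Prop where
  unit : ∀ i, dot (w i) (w i) = 1
  oriented : ∀ i j, i ≠ j → dot (w i) (w j) < 0 ∧
    dot (w i) (nullMinus (w j)) ≤ 0 ∧ dot (w i) (nullPlus (w j)) ≤ 0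
  ultraparallel : ∀ i j, i ≠ j → 1 < dot (w i) (w j) ^ 2

/-! ### The linear groups -/

/-- The origin of the hyperbolic plane. -/
def p₀ : Mink := ![0, 0, 1]

/-- The unit spacelike vector whose orthogonal geodesic passes through the origin, at the angle
given by `θ`. -/
def w₀ (θ : ℝ) : Mink := ![Real.cos θ, Real.sin θ, 0]

/-- The point symmetry in the origin. -/
def iota₀ : O21 := spine p₀

/-- The Coxeter group `Γ₀' = ⟨R_X, R_Y, ι₀⟩`, with `R_X = spine w₁` and `R_Y = spine w₂`. -/
def coxeterGroup (w₁ w₂ : Mink) : Subgroup O21 :=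
  Subgroup.closure {spine w₁, spine w₂, iota₀}

/-- The glide reflection `X = R_X ι₀`. -/
def elX (w₁ : Mink) : O21 := spine w₁ * iota₀

/-- The glide reflection `Y = ι₀ R_Y`. -/
def elY (w₂ : Mink) : O21 := iota₀ * spine w₂

/-- The group `Γ₀ = ⟨X, Y⟩`. -/
def surfaceGroup (w₁ w₂ : Mink) : Subgroup O21 :=
  Subgroup.closure {elX w₁, elY w₂}

/-- `X` as an element of `Γ₀`. -/
def gX (w₁ w₂ : Mink) : surfaceGroup w₁ w₂ :=
  ⟨elX w₁, Subgroup.subset_closure (by simp)⟩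

/-- `Y` as an element of `Γ₀`. -/
def gY (w₁ w₂ : Mink) : surfaceGroup w₁ w₂ :=
  ⟨elY w₂, Subgroup.subset_closure (by simp)⟩

/-- The boundary component `A = X Y`. -/
def gA (w₁ w₂ : Mink) : surfaceGroup w₁ w₂ := gX w₁ w₂ * gY w₁ w₂

/-- The boundary component `B = Y⁻¹ X`. -/
def gB (w₁ w₂ : Mink) : surfaceGroup w₁ w₂ := (gY w₁ w₂)⁻¹ * gX w₁ w₂

/-! ### Affine deformations and Margulis invariants -/

/-- The linear action of a subgroup of `O(2,1)` on `ℝ^{2,1}`. -/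
def linRep (Γ : Subgroup O21) : Representation ℝ Γ Mink :=
  (LinearEquiv.automorphismGroup.toLinearMapMonoidHom (R := ℝ) (M := Mink)).comp
    (O21.subtype.comp Γ.subtype)

/-- The representation `ℝ^{2,1}` of a subgroup of `O(2,1)`. -/
abbrev minkRep (Γ : Subgroup O21) : Rep ℝ Γ := Rep.of (linRep Γ)

lemma linRep_apply (Γ : Subgroup O21) (g : Γ) (v : Mink) : linRep Γ g v = g.1.1 v := rfl

/-- The translational part `u(g)` of an affine deformation. -/
def transl {Γ : Subgroup O21} (u : cocycles₁ (minkRep Γ)) (g : Γ) : Mink := u g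

/-- The affine action `x ↦ g x + u(g)` of the affine deformation given by the cocycle `u`. -/
def affAct {Γ : Subgroup O21} (u : cocycles₁ (minkRep Γ)) (g : Γ) (x : Mink) : Mink :=
  g.1.1 x + transl u g

/-- `n = g⁰`: the unit spacelike fixed vector of the (possibly orientation-reversing) hyperbolic
isometry `g`, oriented so that `(x⁻, x⁺, n)` is right-handed, where `x⁺`, `x⁻` are
future-pointing null eigenvectors, attracting and repelling respectively. -/
def IsNeutral (g : O21) (n : Mink) : Prop :=
  g.1 n = n ∧ dot n n = 1 ∧ ∃ (xm xp : Mink) (l : ℝ), 1 < |l| ∧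
    dot xm xm = 0 ∧ 0 < xm 2 ∧ g.1 xm = l⁻¹ • xm ∧
    dot xp xp = 0 ∧ 0 < xp 2 ∧ g.1 xp = l • xp ∧ 0 < det3 xm xp n

open Classical in
/-- The neutral vector `g⁰` of `g` (zero if `g` has none). -/
def neutral (g : O21) : Mink := if h : ∃ n, IsNeutral g n then h.choose else 0

lemma apply_neutral (g : O21) : g.1 (neutral g) = neutral g := by
  unfold neutral
  split_ifs with h
  · exact h.choose_spec.1
  · simp

/-- `u ↦ u(g) · g⁰` on cocycles. -/
def margulisCocycle {Γ : Subgroup O21} (g : Γ) : cocycles₁ (minkRep Γ) →ₗ[ℝ] ℝ where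
  toFun u := dot (transl u g) (neutral g.1)
  map_add' _ _ := dot_add_left _ _ _
  map_smul' _ _ := dot_smul_left _ _ _

lemma H1π_surjective (Γ : Subgroup O21) : Function.Surjective (H1π (minkRep Γ)).hom :=
  (ModuleCat.epi_iff_surjective _).1 inferInstance

lemma margulis_ker {Γ : Subgroup O21} (g : Γ) :
    LinearMap.ker (H1π (minkRep Γ)).hom ≤ LinearMap.ker (margulisCocycle g) := by
  intro u hu
  have h := (H1π_eq_zero_iff (A := minkRep Γ) u).1 hu
  obtain ⟨x, hx⟩ := h
  have hx' : transl u g = g.1.1 x - x := (congrFun hx g).symm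
  have e : dot (g.1.1 x) (neutral g.1) = dot x (neutral g.1) := by
    conv_lhs => rw [← apply_neutral g.1]
    exact g.1.2 _ _
  change dot (transl u g) (neutral g.1) = 0
  rw [hx', sub_eq_add_neg, ← neg_one_smul ℝ x, dot_add_left, dot_smul_left, e]
  ring

/-- The Margulis invariant of `g`, a linear functional on `H¹(Γ, ℝ^{2,1})`. -/
def margulis {Γ : Subgroup O21} (g : Γ) : H1 (minkRep Γ) →ₗ[ℝ] ℝ :=
  (Submodule.liftQ _ (margulisCocycle g) (margulis_ker g)).comp
    (LinearMap.quotKerEquivOfSurjective _ (H1π_surjective Γ)).symm.toLinearMap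

lemma margulis_H1π {Γ : Subgroup O21} (g : Γ) (u : cocycles₁ (minkRep Γ)) :
    margulis g ((H1π (minkRep Γ)).hom u) = dot (transl u g) (neutral g.1) := by
  have h : (LinearMap.quotKerEquivOfSurjective _ (H1π_surjective Γ)).symm
      ((H1π (minkRep Γ)).hom u) = Submodule.Quotient.mk u := by
    rw [LinearEquiv.symm_apply_eq]; rfl
  simp only [margulis, LinearMap.comp_apply, LinearEquiv.coe_coe, h]
  rfl

/-! ### Crooked fundamental domains -/

/-- The crooked planes with direction vectors `w i` and vertices `q i` bound a crooked fundamental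
domain for the affine deformation `u` of the group `Γ` generated by the involutions `r i`:
relative to a common base point the vertices lie in the stem quadrants of the `w i`, the crooked
planes are pairwise disjoint, and each of them is preserved by the corresponding generator. -/
structure IsCrookedDomain {Γ : Subgroup O21} (u : cocycles₁ (minkRep Γ))
    (r : Fin 3 → O21) (w q : Fin 3 → Mink) : Prop where
  generates : Subgroup.closure (Set.range r) = Γ
  stem : ∃ o : Mink, ∀ i, q i - o ∈ stemQuadrant (w i)
  disjoint : ∀ i j, i ≠ j → Disjoint (crookedPlane (w i) (q i)) (crookedPlane (w j) (q j))
  preserved : ∀ (i : Fin 3) (g : Γ), g.1 = r i →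
    affAct u g '' crookedPlane (w i) (q i) = crookedPlane (w i) (q i)

/-- The classes in `H¹(Γ₀, ℝ^{2,1})` whose Coxeter extension admits a crooked fundamental domain
with generators `r` and direction vectors `w`. -/
def domainClasses (w₁ w₂ : Mink) (r : Fin 3 → O21) (w : Fin 3 → Mink) :
    Set (H1 (minkRep (surfaceGroup w₁ w₂))) :=
  {c | ∃ (u : cocycles₁ (minkRep (surfaceGroup w₁ w₂)))
      (u' : cocycles₁ (minkRep (coxeterGroup w₁ w₂))),
    (H1π (minkRep (surfaceGroup w₁ w₂))).hom u = c ∧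
    (∀ (g : surfaceGroup w₁ w₂) (g' : coxeterGroup w₁ w₂), g.1 = g'.1 →
      transl u g = transl u' g') ∧
    ∃ q : Fin 3 → Mink, IsCrookedDomain u' r w q}

/-! ### Polygons in a projective plane -/

/-- The image in projective space of a set of vectors. -/
def projImage {W : Type*} [AddCommGroup W] [Module ℝ W] (S : Set W) : Set (ℙ ℝ W) :=
  {p | ∃ (c : W) (hc : c ≠ 0), c ∈ S ∧ Projectivization.mk ℝ c hc = p}

/-- `S` is the (open) convex `n`-gon in the projective plane `ℙ(W)`, `dim W = 3`, whose vertices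
in cyclic order are the points `[v i]`: each line through consecutive vertices has all the other
vertices strictly on one side, and `S` consists of the positive combinations of the `v i`. -/
def IsConvexPolygon {W : Type*} [AddCommGroup W] [Module ℝ W] {n : ℕ} [NeZero n]
    (v : Fin n → W) (S : Set (ℙ ℝ W)) : Prop :=
  3 ≤ n ∧ Module.finrank ℝ W = 3 ∧
  (∀ i, ∃ f : W →ₗ[ℝ] ℝ, f (v i) = 0 ∧ f (v (i + 1)) = 0 ∧
    ∀ j, j ≠ i → j ≠ i + 1 → 0 < f (v j)) ∧
  S = projImage {c | ∃ a : Fin n → ℝ, (∀ i, 0 < a i) ∧ c = ∑ i, a i • v i}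

/-- The relative interior of the side from `[a]` to `[b]`, as a set of vectors. -/
def openSide {W : Type*} [AddCommGroup W] [Module ℝ W] (a b : W) : Set W :=
  {c | ∃ s t : ℝ, 0 < s ∧ 0 < t ∧ c = s • a + t • b}

/-! ### The regions of the theorem -/

/-- The direction vectors of the triangle bounded by `ℓ_X`, `ℓ_Y`, `ℓ₀`. -/
def dirI (w₁ w₂ : Mink) (θ : ℝ) : Fin 3 → Mink := ![w₁, w₂, w₀ θ]

/-- The direction vectors of the flipped triangle bounded by `ℓ_X`, `ι₀ ℓ_Y`, `ℓ₀'`. -/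
def dirII (w₁ w₂ : Mink) (θ' : ℝ) : Fin 3 → Mink := ![w₁, iota₀.1 w₂, w₀ θ']

/-- Crooked fundamental domains linearizing to the triangle of `ℓ_X`, `ℓ_Y`, `ℓ₀`, with
generators `R_X`, `R_Y`, `ι₀`. -/
def P₁ (w₁ w₂ : Mink) (θ : ℝ) : Set (ℙ ℝ (H1 (minkRep (surfaceGroup w₁ w₂)))) :=
  projImage (domainClasses w₁ w₂ ![spine w₁, spine w₂, iota₀] (dirI w₁ w₂ θ))

/-- Crooked fundamental domains linearizing to the flipped triangle, with generators
`R_X`, `ι₀ R_Y ι₀`, `ι₀`. -/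
def P₂ (w₁ w₂ : Mink) (θ' : ℝ) : Set (ℙ ℝ (H1 (minkRep (surfaceGroup w₁ w₂)))) :=
  projImage (domainClasses w₁ w₂ ![spine w₁, iota₀ * spine w₂ * iota₀, iota₀]
    (dirII w₁ w₂ θ'))

/-- The classes for which the Margulis invariants of `X`, `Y`, `A`, `B` are nonzero and have the
same sign. -/
def Q (w₁ w₂ : Mink) : Set (ℙ ℝ (H1 (minkRep (surfaceGroup w₁ w₂)))) :=
  projImage {c |
    (0 < margulis (gX w₁ w₂) c ∧ 0 < margulis (gY w₁ w₂) c ∧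
      0 < margulis (gA w₁ w₂) c ∧ 0 < margulis (gB w₁ w₂) c) ∨
    (margulis (gX w₁ w₂) c < 0 ∧ margulis (gY w₁ w₂) c < 0 ∧
      margulis (gA w₁ w₂) c < 0 ∧ margulis (gB w₁ w₂) c < 0)}

end CrookedHexagon

end

open CrookedHexagon

/-!
A deformation of `Γ₀` extends to the Coxeter group `Γ₀' = ⟨R_X, R_Y, ι₀⟩`, which is a free product
of three groups of order two (ping-pong with the half-planes of a hyperideal triangle). Hence an
affine deformation of `Γ₀'` is the same as a free choice of a point `q i` fixed by each of the
three affine involutions, up to moving `q i` along the fixed line of the `i`-th generator. This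
gives a linear surjection `vertexClass` from triples of points onto `H¹(Γ₀, ℝ^{2,1})`, which kills
the constant triples. An affine involution preserves a crooked plane exactly when it fixes the
vertex (`image_crookedPlane_eq_iff`), and crooked planes with vertices in the stem quadrants of a
hyperideal triangle are automatically disjoint (`Ultra.disjoint_crookedPlane`). So the classes
with a crooked fundamental domain are exactly the images of triples of points of the stem
quadrants.

The stem quadrants of `w₁` and `w₂` contribute four rays `x⁻, x⁺, y⁻, y⁺` (the images of `w₁^∓`,
`w₂^∓`, up to sign), with the single relation `x⁺ + y⁺ = x⁻ + y⁻`. The stem quadrant of `w₀ θ`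
contributes one further ray, because the time axis `p₀` is fixed by `ι₀`: `apexI`. For the flipped
triangle the first four rays are the same, and the fifth is `apexII`. Thus `P₁` and `P₂` are the
cones over five rays with four in common (`domainClasses_dirI`, `domainClasses_dirII`).

The coefficients of `apexI` and `apexII` in the four rays are the positions of the ends of the
geodesics `w₁^⊥`, `w₂^⊥` relative to the geodesic of `w₀ θ`. Since the geodesics are disjoint, all
four ends of `w₁^⊥` and `w₂^⊥` lie on one side of that geodesic, and those of `w₁` come all before
or all after those of `w₂` (`order_dichotomy`); the two possibilities are interchanged by the
flip. This places the two apexes beyond opposite sides of the quadrilateral of the four rays and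
inside the other two sides, which is the configuration `HexagonData`, and there the polygons are
found by elementary convexity (`union_eq`, `circumscribed`).

The Margulis invariant of a product of two of the involutions is a positive multiple of the triple
product of the axes with the displacement of the fixed points (`dot_transl_spine_mul`). Therefore
`α(X)` vanishes on `y⁻, y⁺`, `α(Y)` vanishes on `x⁻, x⁺`, `α(A)` vanishes on `apexI`, `α(B)`
vanishes on `apexII`, and the remaining values on the four rays are positive.
-/

noncomputable section

namespace CrookedHexagon

/-! ### Lorentzian vector algebra -/

/-- The Lorentzian cross product: `lcross u v` is the vector representing `det3 u v ·`. -/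
def lcross (u v : Mink) : Mink :=
  ![u 1 * v 2 - u 2 * v 1, u 2 * v 0 - u 0 * v 2, u 1 * v 0 - u 0 * v 1]

lemma dot_lcross (u v w : Mink) : dot (lcross u v) w = det3 u v w := by
  simp [dot, lcross, det3, Matrix.det_fin_three]; ring

lemma dot_lcross_left (u v : Mink) : dot (lcross u v) u = 0 := by
  simp [dot, lcross]; ring

lemma dot_lcross_right (u v : Mink) : dot (lcross u v) v = 0 := by
  simp [dot, lcross]; ring

lemma dot_lcross_swap (u v w : Mink) : dot (lcross u v) w = -dot (lcross u w) v := by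
  simp [dot, lcross]; ring

lemma dot_lcross_self (u v : Mink) :
    dot (lcross u v) (lcross u v) = dot u v ^ 2 - dot u u * dot v v := by
  simp [dot, lcross]; ring

lemma mink_ext {u v : Mink} (h0 : u 0 = v 0) (h1 : u 1 = v 1) (h2 : u 2 = v 2) : u = v := by
  ext i; fin_cases i <;> assumption

lemma dot_add_right (u v w : Mink) : dot u (v + w) = dot u v + dot u w := by
  simp only [dot, Pi.add_apply]; ring

lemma dot_smul_right (a : ℝ) (v w : Mink) : dot v (a • w) = a * dot v w := by
  simp only [dot, Pi.smul_apply, smul_eq_mul]; ring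

lemma dot_neg_left (u v : Mink) : dot (-u) v = -dot u v := by
  simp only [dot, Pi.neg_apply]; ring

lemma dot_neg_right (u v : Mink) : dot u (-v) = -dot u v := by
  simp only [dot, Pi.neg_apply]; ring

lemma dot_sub_left (u v w : Mink) : dot (u - v) w = dot u w - dot v w := by
  simp only [dot, Pi.sub_apply]; ring

lemma dot_sub_right (u v w : Mink) : dot u (v - w) = dot u v - dot u w := by
  simp only [dot, Pi.sub_apply]; ring

/-- Up to sign the null directions `a`, `b` orthogonal to `w₁`, `w₂` are the eigenvectors of
`lcross w₁`, `lcross w₂`; the unique linear relation between `w₁, w₂, a, b` is then explicit. -/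
lemma null_relation {w₁ w₂ a b : Mink} (ha : lcross w₁ a = a) (hb : lcross w₂ b = b) :
    dot a b • (w₁ + w₂) = dot b w₁ • a + dot a w₂ • b := by
  have a0 := congrFun ha 0
  have a1 := congrFun ha 1
  have a2 := congrFun ha 2
  have b0 := congrFun hb 0
  have b1 := congrFun hb 1
  have b2 := congrFun hb 2
  simp only [lcross, Matrix.cons_val_zero, Matrix.cons_val_one, Matrix.cons_val]
    at a0 a1 a2 b0 b1 b2
  -- both sides are read off from the double cross products in `lcross a b`
  apply mink_ext <;> simp only [dot, Pi.smul_apply, Pi.add_apply, smul_eq_mul]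
  · linear_combination (b 2) * a1 - (b 1) * a2 + (a 2) * b1 - (a 1) * b2
  · linear_combination (-b 2) * a0 + (b 0) * a2 - (a 2) * b0 + (a 0) * b2
  · linear_combination (-b 1) * a0 + (b 0) * a1 - (a 1) * b0 + (a 0) * b1

/-- The reverse Cauchy-Schwarz inequality: future-pointing causal vectors, one of them timelike,
have a negative product. -/
lemma dot_future_neg {t n : Mink} (ht : dot t t < 0) (ht2 : 0 < t 2) (hn : dot n n ≤ 0)
    (hn2 : 0 < n 2) : dot t n < 0 := by
  simp only [dot] at *
  have h1 : (t 0 * n 0 + t 1 * n 1) ^ 2 < (t 2 * n 2) ^ 2 := by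
    have h2 : 0 ≤ (t 0 ^ 2 + t 1 ^ 2) * (n 2 ^ 2 - n 0 ^ 2 - n 1 ^ 2) :=
      mul_nonneg (by positivity) (by linarith)
    have h3 : 0 < (t 2 ^ 2 - t 0 ^ 2 - t 1 ^ 2) * n 2 ^ 2 :=
      mul_pos (by linarith) (by positivity)
    nlinarith [sq_nonneg (t 0 * n 1 - t 1 * n 0)]
  have := abs_lt_of_sq_lt_sq h1 (by positivity)
  linarith [(abs_lt.1 this).2]

/-! ### The null vectors of a spacelike vector -/

@[simp] lemma nullMinus_two (w : Mink) : nullMinus w 2 = 1 := by simp [nullMinus]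

@[simp] lemma nullPlus_two (w : Mink) : nullPlus w 2 = 1 := by simp [nullPlus]

section Unit

variable {w : Mink}

lemma planar_sq (hw : dot w w = 1) : w 0 ^ 2 + w 1 ^ 2 = 1 + w 2 ^ 2 := by
  simp only [dot] at hw; linarith

lemma nullMinus_unit (hw : dot w w = 1) :
    nullMinus w = ![(w 2 * w 0 - w 1) / (1 + w 2 ^ 2), (w 2 * w 1 + w 0) / (1 + w 2 ^ 2), 1] := by
  simp [nullMinus, hw, planar_sq hw]

lemma nullPlus_unit (hw : dot w w = 1) :
    nullPlus w = ![(w 2 * w 0 + w 1) / (1 + w 2 ^ 2), (w 2 * w 1 - w 0) / (1 + w 2 ^ 2), 1] := by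
  simp [nullPlus, hw, planar_sq hw]

lemma dot_nullMinus_self (hw : dot w w = 1) : dot (nullMinus w) (nullMinus w) = 0 :=
  (null_spec w (by simp [hw])).1

lemma dot_nullPlus_self (hw : dot w w = 1) : dot (nullPlus w) (nullPlus w) = 0 :=
  (null_spec w (by simp [hw])).2.1

lemma dot_nullMinus (hw : dot w w = 1) : dot w (nullMinus w) = 0 :=
  (null_spec w (by simp [hw])).2.2.1

lemma dot_nullPlus (hw : dot w w = 1) : dot w (nullPlus w) = 0 :=
  (null_spec w (by simp [hw])).2.2.2.1

lemma dot_nullMinus_nullPlus (hw : dot w w = 1) :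
    dot (nullMinus w) (nullPlus w) = -(2 / (1 + w 2 ^ 2)) := by
  have h := planar_sq hw
  rw [nullMinus_unit hw, nullPlus_unit hw]
  have h' : 1 + w 2 ^ 2 ≠ 0 := by positivity
  simp [dot]; field_simp
  linear_combination (w 2 ^ 2 - 1) * h

lemma lcross_nullPlus (hw : dot w w = 1) : lcross w (nullPlus w) = nullPlus w := by
  have h := planar_sq hw
  have h' : 1 + w 2 ^ 2 ≠ 0 := by positivity
  rw [nullPlus_unit hw]
  apply mink_ext <;> simp [lcross] <;> field_simp
  · ring
  · ring
  · linear_combination h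

lemma lcross_nullMinus (hw : dot w w = 1) : lcross w (nullMinus w) = -nullMinus w := by
  have h := planar_sq hw
  have h' : 1 + w 2 ^ 2 ≠ 0 := by positivity
  rw [nullMinus_unit hw]
  apply mink_ext <;> simp [lcross] <;> field_simp
  · ring
  · ring
  · linear_combination -h

/-- Expansion of a vector in the frame `w⁻, w⁺, w`. -/
lemma null_expansion (hw : dot w w = 1) (x : Mink) :
    x = (-((1 + w 2 ^ 2) / 2) * dot x (nullPlus w)) • nullMinus w
      + (-((1 + w 2 ^ 2) / 2) * dot x (nullMinus w)) • nullPlus w + dot x w • w := by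
  have h := planar_sq hw
  have h' : 1 + w 2 ^ 2 ≠ 0 := by positivity
  rw [nullMinus_unit hw, nullPlus_unit hw]
  apply mink_ext <;> simp [dot] <;> field_simp
  · linear_combination (-2 * x 0) * h
  · linear_combination (-2 * x 1) * h
  · ring

end Unit

/-! ### Ultraparallel pairs -/

/-- Unit spacelike vectors with `v·w < -1` whose sum is future-pointing: the half-planes on which
they are positive are disjoint, with ultraparallel boundary geodesics. -/
structure Ultra (v w : Mink) : Prop where
  unit_left : dot v v = 1
  unit_right : dot w w = 1
  dot_lt : dot v w < -1
  future : 0 < v 2 + w 2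

namespace Ultra

variable {v w : Mink}

lemma symm (h : Ultra v w) : Ultra w v :=
  ⟨h.unit_right, h.unit_left, by rw [dot_comm]; exact h.dot_lt, by linarith [h.future]⟩

lemma sum_timelike (h : Ultra v w) : dot (v + w) (v + w) < 0 := by
  rw [dot_add_left, dot_add_right, dot_add_right, h.unit_left, h.unit_right, dot_comm w v]
  linarith [h.dot_lt]

lemma dot_nullPlus_neg (h : Ultra v w) : dot v (nullPlus w) < 0 := by
  have := dot_future_neg (t := v + w) (n := nullPlus w) h.sum_timelike (by simpa using h.future)
    (dot_nullPlus_self h.unit_right).le (by simp)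
  rwa [dot_add_left, dot_nullPlus h.unit_right, add_zero] at this

lemma dot_nullMinus_neg (h : Ultra v w) : dot v (nullMinus w) < 0 := by
  have := dot_future_neg (t := v + w) (n := nullMinus w) h.sum_timelike
    (by simpa using h.future) (dot_nullMinus_self h.unit_right).le (by simp)
  rwa [dot_add_left, dot_nullMinus h.unit_right, add_zero] at this

end Ultra

/-- One of the sign conditions on the ends of `w^⊥` suffices to make `v + w` future-pointing. -/
lemma ultra_of_dot_nullPlus {v w : Mink} (hv : dot v v = 1) (hw : dot w w = 1) (h1 : dot v w < 0)
    (h2 : 1 < dot v w ^ 2) (h3 : dot v (nullPlus w) ≤ 0) : Ultra v w := by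
  have hk : dot v w < -1 := by nlinarith
  refine ⟨hv, hw, hk, ?_⟩
  have ht : dot (v + w) (v + w) < 0 := by
    rw [dot_add_left, dot_add_right, dot_add_right, hv, hw, dot_comm w v]; linarith
  by_contra hc
  have hc' : v 2 + w 2 ≠ 0 := by
    intro h0
    simp only [dot, Pi.add_apply, h0] at ht
    nlinarith [sq_nonneg (v 0 + w 0), sq_nonneg (v 1 + w 1)]
  have := dot_future_neg (t := -(v + w)) (n := nullPlus w)
    (by rw [dot_neg_left, dot_neg_right]; linarith)
    (by
      have : v 2 + w 2 < 0 := lt_of_le_of_ne (not_lt.1 hc) hc'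
      simp only [Pi.neg_apply, Pi.add_apply]; linarith)
    (dot_nullPlus_self hw).le (by simp)
  rw [dot_neg_left, dot_add_left, dot_nullPlus hw] at this
  linarith

lemma isHyperidealTriangle_iff (w : Fin 3 → Mink) :
    IsHyperidealTriangle w ↔ ∀ i j, i ≠ j → Ultra (w i) (w j) := by
  constructor
  · intro h i j hij
    exact ultra_of_dot_nullPlus (h.unit i) (h.unit j) (h.oriented i j hij).1
      (h.ultraparallel i j hij) (h.oriented i j hij).2.2
  · intro h
    refine ⟨fun i => (h i (i + 1) (by fin_cases i <;> decide)).unit_left, fun i j hij => ?_,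
      fun i j hij => ?_⟩
    · have := h i j hij
      exact ⟨by linarith [this.dot_lt], this.dot_nullMinus_neg.le, this.dot_nullPlus_neg.le⟩
    · nlinarith [(h i j hij).dot_lt]

/-! ### Disjointness of crooked planes -/

/-- A union of two quadrants that contains every crooked plane of direction `w` whose vertex lies in
the stem quadrant of `w`. -/
def crookedRegion (w : Mink) : Set Mink :=
  {x | (0 ≤ dot x w ∧ dot x (nullPlus w) < 0) ∨ (dot x w ≤ 0 ∧ 0 < dot x (nullMinus w))}

lemma crookedPlane_subset_region {w q : Mink} (hw : dot w w = 1) (hq : q ∈ stemQuadrant w) :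
    crookedPlane w q ⊆ crookedRegion w := by
  obtain ⟨a, b, ha, hb, rfl⟩ := hq
  set k := dot (nullMinus w) (nullPlus w) with hk
  have hk0 : k < 0 := by
    rw [hk, dot_nullMinus_nullPlus hw, neg_lt_zero]; positivity
  have e1 : dot (nullMinus w) w = 0 := by rw [dot_comm, dot_nullMinus hw]
  have e2 : dot (nullPlus w) w = 0 := by rw [dot_comm, dot_nullPlus hw]
  have e3 : dot (nullPlus w) (nullMinus w) = k := by rw [dot_comm]
  rintro x ((⟨t, s, hs, rfl⟩ | ⟨t, s, hs, rfl⟩) | ⟨h1, h2⟩)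
  · left
    simp only [dot_add_left, dot_sub_left, dot_smul_left, e1, e2, hw, dot_nullPlus_self hw, ← hk,
      dot_nullPlus hw]
    constructor <;> nlinarith
  · right
    simp only [dot_add_left, dot_sub_left, dot_smul_left, e1, e2, hw, dot_nullMinus_self hw, e3,
      dot_nullMinus hw]
    constructor <;> nlinarith
  · have hx := null_expansion hw (x - (a • nullMinus w - b • nullPlus w))
    rw [dot_comm _ w, h1, zero_smul, add_zero] at hx
    set y := x - (a • nullMinus w - b • nullPlus w) with hy
    have hxy : x = y + (a • nullMinus w - b • nullPlus w) := by rw [hy]; abel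
    have hprod : 0 ≤ dot y (nullMinus w) * dot y (nullPlus w) := by
      have hyy : dot y y = -(1 + w 2 ^ 2) * (dot y (nullMinus w) * dot y (nullPlus w)) := by
        conv_lhs => rw [hx]
        simp only [dot_add_left, dot_add_right, dot_smul_left, dot_smul_right,
          dot_nullMinus_self hw, dot_nullPlus_self hw, dot_nullMinus_nullPlus hw, e3, hk]
        field_simp
        ring
      rw [hyy] at h2
      nlinarith [sq_nonneg (w 2), mul_nonneg (sq_nonneg (w 2)) (sq_nonneg (w 2))]
    have hxw : dot x w = 0 := by
      rw [hxy, dot_add_left, dot_comm y, h1]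
      simp [dot_sub_left, dot_smul_left, e1, e2]
    have hp : dot x (nullPlus w) = dot y (nullPlus w) + a * k := by
      rw [hxy]; simp [dot_add_left, dot_sub_left, dot_smul_left, dot_nullPlus_self hw, ← hk]
    have hm : dot x (nullMinus w) = dot y (nullMinus w) - b * k := by
      rw [hxy]
      simp only [dot_add_left, dot_sub_left, dot_smul_left, dot_nullMinus_self hw, e3]; ring
    by_cases hc : dot y (nullPlus w) ≤ 0
    · left; exact ⟨hxw.ge, by rw [hp]; nlinarith⟩
    · right
      push Not at hc
      have : 0 ≤ dot y (nullMinus w) := by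
        by_contra hneg
        push Not at hneg
        nlinarith
      exact ⟨hxw.le, by rw [hm]; nlinarith⟩

lemma null_dot_nonpos {a b : Mink} (ha : dot a a = 0) (hb : dot b b = 0) (ha2 : a 2 = 1)
    (hb2 : b 2 = 1) : dot a b ≤ 0 := by
  simp only [dot, ha2, hb2] at *
  nlinarith [sq_nonneg (a 0 - b 0), sq_nonneg (a 1 - b 1)]

/-- The crooked regions of an ultraparallel pair are disjoint: on a common point, the two sides of
the linear relation `null_relation` would have opposite signs. -/
lemma Ultra.disjoint_region {v w : Mink} (h : Ultra v w) :
    Disjoint (crookedRegion v) (crookedRegion w) := by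
  have hv := h.unit_left
  have hw := h.unit_right
  have pv := lcross_nullPlus hv
  have pw := lcross_nullPlus hw
  have neg_eig : ∀ {u n : Mink}, lcross u n = -n → lcross (-u) n = n := by
    intro u n hn
    have : lcross (-u) n = -lcross u n := by
      apply mink_ext <;> simp [lcross] <;> ring
    rw [this, hn, neg_neg]
  have mv := neg_eig (lcross_nullMinus hv)
  have mw := neg_eig (lcross_nullMinus hw)
  have k1 := h.dot_nullPlus_neg
  have k2 := h.dot_nullMinus_neg
  have k3 := h.symm.dot_nullPlus_neg
  have k4 := h.symm.dot_nullMinus_neg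
  rw [dot_comm] at k1 k2 k3 k4
  rw [Set.disjoint_left]
  rintro x (⟨a1, a2⟩ | ⟨a1, a2⟩) (⟨b1, b2⟩ | ⟨b1, b2⟩)
  · have e := congrArg (dot x) (null_relation pv pw)
    have n := null_dot_nonpos (dot_nullPlus_self hv) (dot_nullPlus_self hw) (by simp) (by simp)
    simp only [dot_smul_right, dot_add_right] at e
    nlinarith [mul_pos_of_neg_of_neg k1 a2, mul_pos_of_neg_of_neg k3 b2,
      mul_nonpos_of_nonpos_of_nonneg n (add_nonneg a1 b1)]
  · have e := congrArg (dot x) (null_relation pv mw)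
    have n := null_dot_nonpos (dot_nullPlus_self hv) (dot_nullMinus_self hw) (by simp) (by simp)
    simp only [dot_smul_right, dot_add_right, dot_neg_right] at e
    nlinarith [mul_pos_of_neg_of_neg k2 a2, mul_neg_of_neg_of_pos k3 b2,
      mul_nonpos_of_nonpos_of_nonneg n (sub_nonneg.2 (b1.trans a1))]
  · have e := congrArg (dot x) (null_relation mv pw)
    have n := null_dot_nonpos (dot_nullMinus_self hv) (dot_nullPlus_self hw) (by simp) (by simp)
    simp only [dot_smul_right, dot_add_right, dot_neg_right] at e
    nlinarith [mul_neg_of_neg_of_pos k1 a2, mul_pos_of_neg_of_neg k4 b2,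
      mul_nonpos_of_nonpos_of_nonneg n (sub_nonneg.2 (a1.trans b1))]
  · have e := congrArg (dot x) (null_relation mv mw)
    have n := null_dot_nonpos (dot_nullMinus_self hv) (dot_nullMinus_self hw) (by simp) (by simp)
    simp only [dot_smul_right, dot_add_right, dot_neg_right] at e
    nlinarith [mul_neg_of_neg_of_pos k2 a2, mul_neg_of_neg_of_pos k4 b2,
      mul_nonneg_of_nonpos_of_nonpos n (add_nonpos a1 b1)]

lemma Ultra.disjoint_crookedPlane {v w p q o : Mink} (h : Ultra v w) (hp : p - o ∈ stemQuadrant v)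
    (hq : q - o ∈ stemQuadrant w) : Disjoint (crookedPlane v p) (crookedPlane w q) := by
  have shift : ∀ {u r x : Mink}, x ∈ crookedPlane u r → x - o ∈ crookedPlane u (r - o) := by
    rintro u r x ((⟨t, s, hs, rfl⟩ | ⟨t, s, hs, rfl⟩) | ⟨h1, h2⟩)
    · exact Or.inl (Or.inl ⟨t, s, hs, by abel⟩)
    · exact Or.inl (Or.inr ⟨t, s, hs, by abel⟩)
    · exact Or.inr (by simpa using ⟨h1, h2⟩)
  rw [Set.disjoint_left]
  intro x hx hx'
  exact Set.disjoint_left.1 h.disjoint_region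
    (crookedPlane_subset_region h.unit_left hp (shift hx))
    (crookedPlane_subset_region h.unit_right hq (shift hx'))

/-! ### The vertex of a crooked plane -/

/-- A crooked plane determines its vertex. -/
lemma crookedPlane_injective {w p p' : Mink} (hw : dot w w = 1)
    (h : crookedPlane w p' ⊆ crookedPlane w p) : p' = p := by
  set k := dot (nullMinus w) (nullPlus w) with hk
  have hk0 : k < 0 := by
    rw [hk, dot_nullMinus_nullPlus hw, neg_lt_zero]; positivity
  have e1 : dot (nullMinus w) w = 0 := by rw [dot_comm, dot_nullMinus hw]
  have e2 : dot (nullPlus w) w = 0 := by rw [dot_comm, dot_nullPlus hw]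
  have e3 : dot (nullPlus w) (nullMinus w) = k := by rw [dot_comm]
  -- a point of a crooked plane, in the frame of null vectors
  have mem : ∀ x ∈ crookedPlane w p, (0 < dot (x - p) w → dot (x - p) (nullPlus w) = 0) ∧
      (dot (x - p) w < 0 → dot (x - p) (nullMinus w) = 0) ∧
      (dot (x - p) w ≠ 0 → dot (x - p) (nullPlus w) = 0 ∨ dot (x - p) (nullMinus w) = 0) := by
    rintro x ((⟨t, s, hs, rfl⟩ | ⟨t, s, hs, rfl⟩) | ⟨h1, h2⟩)
    · have hx : p + t • nullPlus w + s • w - p = t • nullPlus w + s • w := by abel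
      simp only [hx, dot_add_left, dot_smul_left, e2, hw, dot_nullPlus_self hw, dot_nullPlus hw,
        mul_zero, mul_one, zero_add, add_zero]
      exact ⟨fun _ => trivial, fun hs' => absurd hs' (not_lt.2 hs), fun _ => Or.inl trivial⟩
    · have hx : p + t • nullMinus w - s • w - p = t • nullMinus w - s • w := by abel
      simp only [hx, dot_sub_left, dot_smul_left, e1, hw, dot_nullMinus_self hw, dot_nullMinus hw,
        mul_zero, mul_one, zero_sub, sub_zero]
      exact ⟨fun hs' => absurd hs' (by linarith), fun _ => trivial, fun _ => Or.inr trivial⟩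
    · rw [dot_comm _ w, h1]; simp
  set d := p' - p with hd
  have hplus : dot d (nullPlus w) = 0 := by
    have h1 := (mem _ (h (Or.inl (Or.inl ⟨0, |dot d w| + 1, by positivity, rfl⟩)))).1
    have hx : p' + (0 : ℝ) • nullPlus w + (|dot d w| + 1) • w - p = d + (|dot d w| + 1) • w := by
      rw [hd, zero_smul]; abel
    rw [hx] at h1
    simp only [dot_add_left, dot_smul_left, hw, dot_nullPlus hw, mul_one, mul_zero, add_zero] at h1
    exact h1 (by linarith [neg_abs_le (dot d w)])
  have hminus : dot d (nullMinus w) = 0 := by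
    have h1 := (mem _ (h (Or.inl (Or.inr ⟨0, |dot d w| + 1, by positivity, rfl⟩)))).2.1
    have hx : p' + (0 : ℝ) • nullMinus w - (|dot d w| + 1) • w - p = d - (|dot d w| + 1) • w := by
      rw [hd, zero_smul]; abel
    rw [hx] at h1
    simp only [dot_sub_left, dot_smul_left, hw, dot_nullMinus hw, mul_one, mul_zero, sub_zero] at h1
    exact h1 (by linarith [le_abs_self (dot d w)])
  have hw' : dot d w = 0 := by
    by_contra hne
    have hmem : p' + (nullMinus w + nullPlus w) ∈ crookedPlane w p' := by
      right
      simp only [Set.mem_ofPred_eq, add_sub_cancel_left, dot_add_left, dot_add_right,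
        dot_nullMinus hw, dot_nullPlus hw, dot_nullMinus_self hw, dot_nullPlus_self hw, e3, ← hk]
      exact ⟨by ring, by linarith⟩
    have h1 := (mem _ (h hmem)).2.2
    have hx : p' + (nullMinus w + nullPlus w) - p = d + (nullMinus w + nullPlus w) := by
      rw [hd]; abel
    rw [hx] at h1
    simp only [dot_add_left, e1, e2, hplus, hminus, dot_nullMinus_self hw, dot_nullPlus_self hw,
      e3, ← hk, add_zero, zero_add] at h1
    rcases h1 hne with h1 | h1 <;> linarith
  have := null_expansion hw d
  rw [hplus, hminus, hw'] at this
  simp only [mul_zero, zero_smul, add_zero] at this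
  exact sub_eq_zero.1 this

/-- If the affine map `x ↦ g x + t` has a linear part that either fixes `w` and negates `w^±`, or
negates `w` and exchanges `w⁺` with `w⁻`, it carries crooked planes of direction `w` to crooked
planes of direction `w`. -/
lemma image_crookedPlane {g : O21} {w : Mink} (t p : Mink)
    (h : (g.1 w = w ∧ g.1 (nullPlus w) = -nullPlus w ∧ g.1 (nullMinus w) = -nullMinus w) ∨
      (g.1 w = -w ∧ g.1 (nullPlus w) = nullMinus w ∧ g.1 (nullMinus w) = nullPlus w)) :
    (fun x => g.1 x + t) '' crookedPlane w p ⊆ crookedPlane w (g.1 p + t) := by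
  rintro _ ⟨x, hx, rfl⟩
  rcases hx with (⟨a, s, hs, rfl⟩ | ⟨a, s, hs, rfl⟩) | ⟨h1, h2⟩
  · rcases h with ⟨hw, hp, -⟩ | ⟨hw, hp, -⟩
    · refine Or.inl (Or.inl ⟨-a, s, hs, ?_⟩)
      simp only [map_add, map_smul, hw, hp, smul_neg, neg_smul]; abel
    · refine Or.inl (Or.inr ⟨a, s, hs, ?_⟩)
      simp only [map_add, map_smul, hw, hp, smul_neg]; abel
  · rcases h with ⟨hw, -, hm⟩ | ⟨hw, -, hm⟩
    · refine Or.inl (Or.inr ⟨-a, s, hs, ?_⟩)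
      simp only [map_add, map_sub, map_smul, hw, hm, smul_neg, neg_smul]; abel
    · refine Or.inl (Or.inl ⟨a, s, hs, ?_⟩)
      simp only [map_add, map_sub, map_smul, hw, hm, smul_neg]; abel
  · right
    have hx : g.1 x + t - (g.1 p + t) = g.1 (x - p) := by rw [map_sub]; abel
    simp only [Set.mem_ofPred_eq, hx]
    refine ⟨?_, by rw [g.2]; exact h2⟩
    have h3 : dot (g.1 w) (g.1 (x - p)) = 0 := by rw [g.2]; exact h1
    rcases h with ⟨hw, -⟩ | ⟨hw, -⟩
    · rwa [hw] at h3
    · rw [hw, dot_neg_left] at h3; linarith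

/-- An affine involution with linear part as in `image_crookedPlane` preserves a crooked plane of
direction `w` exactly when it fixes the vertex. -/
lemma image_crookedPlane_eq_iff {g : O21} {w t p : Mink} (hw : dot w w = 1)
    (hg : ∀ x, g.1 (g.1 x) = x)
    (h : (g.1 w = w ∧ g.1 (nullPlus w) = -nullPlus w ∧ g.1 (nullMinus w) = -nullMinus w) ∨
      (g.1 w = -w ∧ g.1 (nullPlus w) = nullMinus w ∧ g.1 (nullMinus w) = nullPlus w)) :
    (fun x => g.1 x + t) '' crookedPlane w p = crookedPlane w p ↔ g.1 p + t = p := by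
  have hback : ∀ p, crookedPlane w (g.1 p + t) ⊆ (fun x => g.1 x + t) '' crookedPlane w p := by
    intro p y hy
    refine ⟨g.1 y - g.1 t, ?_, by simp [hg]⟩
    have := image_crookedPlane (-g.1 t) (g.1 p + t) h ⟨y, hy, rfl⟩
    simpa [hg, sub_eq_add_neg] using this
  constructor
  · intro he
    exact crookedPlane_injective hw ((hback p).trans he.le)
  · intro he
    refine Set.Subset.antisymm ?_ ?_
    · conv_rhs => rw [← he]
      exact image_crookedPlane t p h
    · conv_lhs => rw [← he]
      exact hback p

/-! ### Neutral vectors of products of two spine reflections -/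

lemma spine_apply (w v : Mink) : (spine w).1 v = -v + (2 * (dot v w / dot w w)) • w := rfl

lemma spine_spine (w v : Mink) : (spine w).1 ((spine w).1 v) = v := spineMap_involutive w v

/-- A spine reflection negates the orthogonal complement of its axis. -/
lemma spine_apply_of_dot_eq_zero {w v : Mink} (h : dot v w = 0) : (spine w).1 v = -v := by
  simp [spine_apply, h]

lemma spine_apply_self {w : Mink} (h : dot w w ≠ 0) : (spine w).1 w = w := by
  rw [spine_apply, div_self h]; module

/-- The neutral vector is determined by its defining property. -/
lemma IsNeutral.unique {g : O21} {n n' : Mink} (h : IsNeutral g n) (h' : IsNeutral g n') :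
    n' = n := by
  obtain ⟨gn, nn, xm, xp, l, hl, mm, m2, gm, pp, p2, gp, hdet⟩ := h
  obtain ⟨gn', nn', xm', xp', l', hl', mm', m2', gm', pp', p2', gp', hdet'⟩ := h'
  have hl0 : l ≠ 0 := by rintro rfl; norm_num at hl
  have hl0' : l' ≠ 0 := by rintro rfl; norm_num at hl'
  have hinv : |l⁻¹| < 1 := by rw [abs_inv]; exact inv_lt_one_of_one_lt₀ hl
  have hinv' : |l'⁻¹| < 1 := by rw [abs_inv]; exact inv_lt_one_of_one_lt₀ hl'
  have li : LinearIndependent ℝ ![xm, xp, n] := by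
    have : IsUnit (Matrix.of ![xm, xp, n]) := (Matrix.isUnit_iff_isUnit_det _).2
      (isUnit_iff_ne_zero.2 hdet.ne')
    exact Matrix.linearIndependent_rows_iff_isUnit.2 this
  have hli := Fintype.linearIndependent_iff.1 li
  have expand : ∀ x : Mink, ∃ a b c : ℝ, x = a • xm + b • xp + c • n := by
    intro x
    let β := basisOfLinearIndependentOfCardEqFinrank li (by simp)
    have hβ : ⇑β = ![xm, xp, n] := coe_basisOfLinearIndependentOfCardEqFinrank _ _
    have hx := (β.sum_repr x).symm
    rw [hβ, Fin.sum_univ_three] at hx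
    exact ⟨_, _, _, hx⟩
  -- eigenvectors of `g` in the eigenbasis `xm, xp, n`
  have eig : ∀ (x : Mink) (r a b c : ℝ), g.1 x = r • x → x = a • xm + b • xp + c • n →
      a * (l⁻¹ - r) = 0 ∧ b * (l - r) = 0 ∧ c * (1 - r) = 0 := by
    intro x r a b c hx e
    rw [e] at hx
    simp only [map_add, map_smul, gm, gp, gn] at hx
    have := hli ![a * (l⁻¹ - r), b * (l - r), c * (1 - r)] (by
      simp only [Fin.sum_univ_three, Matrix.cons_val_zero, Matrix.cons_val_one, Matrix.cons_val]
      rw [← sub_eq_zero] at hx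
      rw [← hx]; module)
    exact ⟨this 0, this 1, this 2⟩
  have h1 : l ≠ 1 := by rintro rfl; norm_num at hl
  have h1' : l' ≠ 1 := by rintro rfl; norm_num at hl'
  have h2 : l⁻¹ ≠ 1 := by intro h; rw [h] at hinv; norm_num at hinv
  have h2' : l'⁻¹ ≠ 1 := by intro h; rw [h] at hinv'; norm_num at hinv'
  have h3 : l⁻¹ ≠ l' := by intro h; rw [h] at hinv; linarith
  have h3' : l ≠ l'⁻¹ := by intro h; rw [h] at hl; linarith
  obtain ⟨a, b, c, e⟩ := expand xp'
  obtain ⟨ea, -, ec⟩ := eig xp' l' a b c gp' e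
  have a0 : a = 0 := (mul_eq_zero.1 ea).resolve_right (sub_ne_zero.2 h3)
  have c0 : c = 0 := (mul_eq_zero.1 ec).resolve_right (sub_ne_zero.2 h1'.symm)
  obtain ⟨a', b', c', e'⟩ := expand xm'
  obtain ⟨-, eb', ec'⟩ := eig xm' l'⁻¹ a' b' c' gm' e'
  have b0' : b' = 0 := (mul_eq_zero.1 eb').resolve_right (sub_ne_zero.2 h3')
  have c0' : c' = 0 := (mul_eq_zero.1 ec').resolve_right (sub_ne_zero.2 h2'.symm)
  obtain ⟨a'', b'', c'', e''⟩ := expand n'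
  obtain ⟨ea'', eb'', -⟩ := eig n' 1 a'' b'' c'' (by rw [gn', one_smul]) e''
  have a0'' : a'' = 0 := (mul_eq_zero.1 ea'').resolve_right (sub_ne_zero.2 h2)
  have b0'' : b'' = 0 := (mul_eq_zero.1 eb'').resolve_right (sub_ne_zero.2 h1)
  simp only [a0, c0, b0', c0', a0'', b0'', zero_smul, zero_add, add_zero] at e e' e''
  have hb : 0 < b := by
    have := congrFun e 2
    simp only [Pi.smul_apply, smul_eq_mul] at this
    rw [this] at p2'
    exact (pos_iff_pos_of_mul_pos p2').2 p2
  have ha' : 0 < a' := by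
    have := congrFun e' 2
    simp only [Pi.smul_apply, smul_eq_mul] at this
    rw [this] at m2'
    exact (pos_iff_pos_of_mul_pos m2').2 m2
  have hc : c'' ^ 2 = 1 := by
    rw [e'', dot_smul_left, dot_smul_right, nn] at nn'
    linarith
  have hc0 : 0 < c'' := by
    have : det3 xm' xp' n' = a' * b * c'' * det3 xm xp n := by
      rw [e, e', e'']
      simp [det3, Matrix.det_fin_three]; ring
    rw [this] at hdet'
    have h4 := (pos_iff_pos_of_mul_pos hdet').2 hdet
    exact (pos_iff_pos_of_mul_pos h4).1 (by positivity)
  have : c'' = 1 := by nlinarith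
  rw [e'', this, one_smul]

lemma neutral_eq {g : O21} {n : Mink} (h : IsNeutral g n) : neutral g = n := by
  unfold neutral
  have hex : ∃ n, IsNeutral g n := ⟨n, h⟩
  rw [dif_pos hex]
  exact h.unique hex.choose_spec

lemma null_time_ne_zero {y : Mink} (hy : dot y y = 0) (h0 : y ≠ 0) : y 2 ≠ 0 := by
  intro h
  apply h0
  simp only [dot, h] at hy
  have a0 : y 0 = 0 := by nlinarith [sq_nonneg (y 0), sq_nonneg (y 1)]
  have a1 : y 1 = 0 := by nlinarith [sq_nonneg (y 0), sq_nonneg (y 1)]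
  exact mink_ext a0 a1 h

/-- The time components of two null vectors have the sign opposite to that of their product. -/
lemma null_time_mul {y z : Mink} (hy : dot y y = 0) (hz : dot z z = 0) (h : dot y z ≠ 0) :
    dot y z * (y 2 * z 2) < 0 := by
  have hy0 : y 2 ≠ 0 := null_time_ne_zero hy (by rintro rfl; simp [dot] at h)
  have hz0 : z 2 ≠ 0 := null_time_ne_zero hz (by rintro rfl; simp [dot] at h)
  have h1 : 0 < (y 2 * z 2) ^ 2 := by positivity
  have h2 : (y 0 * z 0 + y 1 * z 1) ^ 2 ≤ (y 2 * z 2) ^ 2 := by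
    simp only [dot] at hy hz
    have e1 : y 2 ^ 2 = y 0 ^ 2 + y 1 ^ 2 := by linarith
    have e2 : z 2 ^ 2 = z 0 ^ 2 + z 1 ^ 2 := by linarith
    rw [mul_pow, e1, e2]
    nlinarith [sq_nonneg (y 0 * z 1 - y 1 * z 0)]
  have h3 : dot y z * (y 2 * z 2) ≤ 0 := by
    have h4 := abs_le_of_sq_le_sq' h2
    simp only [dot]
    nlinarith [sq_nonneg (y 0 * z 0 + y 1 * z 1 - y 2 * z 2)]
  exact lt_of_le_of_ne h3 (mul_ne_zero h (mul_ne_zero hy0 hz0))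

/-- The neutral vector of the product of the spine reflections in `u` and `v`, when these span a
plane of signature `(1,1)`. The null eigenvectors are the isotropic directions of that plane; the
sign condition on `dot u v` selects the attracting one. -/
lemma isNeutral_spine_mul {u v : Mink} (hu : dot u u ≠ 0) (hv : dot v v ≠ 0) (hk : dot u v < 0)
    (hD : 0 < dot u v ^ 2 - dot u u * dot v v) :
    IsNeutral (spine u * spine v)
      ((-(√(dot u v ^ 2 - dot u u * dot v v))⁻¹) • lcross u v) := by
  set k := dot u v with hkdef
  have hvu : dot v u = k := dot_comm _ _
  obtain ⟨D, hDs, hD0⟩ : ∃ D, D ^ 2 = k ^ 2 - dot u u * dot v v ∧ 0 < D :=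
    ⟨_, Real.sq_sqrt hD.le, Real.sqrt_pos.2 hD⟩
  rw [← hDs, Real.sqrt_sq hD0.le]
  have hkm : k - D < 0 := by linarith
  have hkp : k + D ≠ 0 := by
    intro h
    have : (k + D) * (k - D) = dot u u * dot v v := by linear_combination -hDs
    rw [h, zero_mul] at this
    exact mul_ne_zero hu hv this.symm
  set a := dot u u with ha
  set b := dot v v with hb
  -- `yp` is repelling, `ym` attracting
  set yp := b • u - (k - D) • v with hyp
  set ym := b • u - (k + D) • v with hym
  have yp0 : dot yp yp = 0 := by
    simp only [hyp, dot_sub_left, dot_sub_right, dot_smul_left, dot_smul_right, ← ha, ← hb,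
      ← hkdef, hvu]
    linear_combination b * hDs
  have ym0 : dot ym ym = 0 := by
    simp only [hym, dot_sub_left, dot_sub_right, dot_smul_left, dot_smul_right, ← ha, ← hb,
      ← hkdef, hvu]
    linear_combination b * hDs
  have hpm : dot yp ym = -2 * D ^ 2 * b := by
    simp only [hyp, hym, dot_sub_left, dot_sub_right, dot_smul_left, dot_smul_right, ← ha, ← hb,
      ← hkdef, hvu]
    linear_combination b * hDs
  have hpm0 : dot yp ym ≠ 0 := by rw [hpm]; exact mul_ne_zero (by simp [hD0.ne']) hv
  have ypt : yp 2 ≠ 0 := null_time_ne_zero yp0 (by rintro h; rw [h] at hpm0; simp [dot] at hpm0)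
  have ymt : ym 2 ≠ 0 := null_time_ne_zero ym0 (by rintro h; rw [h] at hpm0; simp [dot] at hpm0)
  have htime := null_time_mul yp0 ym0 hpm0
  have hs : ∀ x y : ℝ, (spine u * spine v).1 (x • u + y • v)
      = (x * (4 * k ^ 2 / (a * b) - 1) + 2 * y * k / a) • u
        + (-(2 * x * k / b) - y) • v := by
    intro x y
    change (spine u).1 ((spine v).1 (x • u + y • v)) = _
    simp only [spine_apply, dot_add_left, dot_smul_left, dot_neg_left, ← ha, ← hb, ← hkdef, hvu]
    match_scalars <;> field_simp <;> ring
  have gp : (spine u * spine v).1 yp = ((k - D) / (k + D))⁻¹ • yp := by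
    have e : yp = b • u + (-(k - D)) • v := by rw [hyp]; module
    rw [e, hs]
    have hkm' : k - D ≠ 0 := hkm.ne
    match_scalars
    · field_simp
      linear_combination (-2 * k) * hDs
    · field_simp
      ring
  have gm : (spine u * spine v).1 ym = ((k - D) / (k + D)) • ym := by
    have e : ym = b • u + (-(k + D)) • v := by rw [hym]; module
    rw [e, hs]
    match_scalars
    · field_simp
      linear_combination (-2 * k) * hDs
    · field_simp
      ring
  have hl : 1 < |(k - D) / (k + D)| := by
    rw [abs_div, one_lt_div (abs_pos.2 hkp)]
    apply sq_lt_sq.1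
    nlinarith
  refine ⟨?_, ?_, (yp 2)⁻¹ • yp, (ym 2)⁻¹ • ym, (k - D) / (k + D), hl, ?_, ?_, ?_, ?_, ?_, ?_, ?_⟩
  · rw [map_smul]
    congr 1
    change (spine u).1 ((spine v).1 _) = _
    rw [spine_apply_of_dot_eq_zero (dot_lcross_right u v), map_neg,
      spine_apply_of_dot_eq_zero (dot_lcross_left u v), neg_neg]
  · rw [dot_smul_left, dot_smul_right, dot_lcross_self, ← ha, ← hb, ← hkdef, ← hDs]
    field_simp
  · rw [dot_smul_left, dot_smul_right, yp0]; ring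
  · simp [ypt]
  · rw [map_smul, gp, smul_comm]
  · rw [dot_smul_left, dot_smul_right, ym0]; ring
  · simp [ymt]
  · rw [map_smul, gm, smul_comm]
  · have hcr : lcross yp ym = (-2 * b * D) • lcross u v := by
      rw [hyp, hym]
      apply mink_ext <;> simp [lcross] <;> ring
    have hsm : ∀ (r s : ℝ) (x y : Mink), lcross (r • x) (s • y) = (r * s) • lcross x y := by
      intro r s x y
      apply mink_ext <;> simp [lcross] <;> ring
    rw [← dot_lcross, hsm, hcr, smul_smul, dot_smul_left, dot_smul_right, dot_lcross_self, ← ha,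
      ← hb, ← hkdef, ← hDs]
    rw [hpm] at htime
    have h4 : 0 < b * (yp 2 * ym 2) := by nlinarith [sq_nonneg D, pow_pos hD0 2]
    have h5 : (yp 2)⁻¹ * (ym 2)⁻¹ * (-2 * b * D) * (-D⁻¹ * D ^ 2)
        = 2 * D ^ 2 * (b * (yp 2 * ym 2)) * ((yp 2 * ym 2)⁻¹) ^ 2 := by
      field_simp
    rw [h5]
    positivity

/-! ### The order of the ends of the geodesics -/

/-- The horizontal unit vector orthogonal to `w₀ θ`; its product with a null vector of height one
measures the position of an ideal point along the geodesic `w₀ θ`. -/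
def j₀ (θ : ℝ) : Mink := ![-Real.sin θ, Real.cos θ, 0]

lemma unit_w₀ (θ : ℝ) : dot (w₀ θ) (w₀ θ) = 1 := by
  simp [dot, w₀]; linarith [Real.cos_sq_add_sin_sq θ]

/-- The signed planar area of the horizontal parts of two vectors. -/
def cross (v w : Mink) : ℝ := v 0 * w 1 - v 1 * w 0

/-- On the upper unit semicircle, an arc lies above its chord. -/
lemma chord_le {g g₁ g₂ h h₁ h₂ A B c : ℝ} (e : g ^ 2 + h ^ 2 = 1) (e₁ : g₁ ^ 2 + h₁ ^ 2 = 1)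
    (e₂ : g₂ ^ 2 + h₂ ^ 2 = 1) (ph : 0 < h) (hB : 0 < B)
    (c₁ : A * g₁ + B * h₁ = c) (c₂ : A * g₂ + B * h₂ = c) (l₁ : g₁ ≤ g) (l₂ : g ≤ g₂)
    (hl : g₁ < g₂) : c ≤ A * g + B * h := by
  have d : 0 < g₂ - g₁ := sub_pos.2 hl
  have hcs : h₁ * h₂ ≤ 1 - g₁ * g₂ := by
    nlinarith [sq_nonneg (h₁ - h₂), sq_nonneg (g₁ - g₂)]
  have key : (g₂ - g) * h₁ + (g - g₁) * h₂ ≤ (g₂ - g₁) * h := by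
    apply le_of_sq_le_sq _ (by positivity)
    have := mul_le_mul_of_nonneg_left hcs
      (mul_nonneg (sub_nonneg.2 l₁) (sub_nonneg.2 l₂))
    have h1 : h₁ ^ 2 = 1 - g₁ ^ 2 := by linarith
    have h2 : h₂ ^ 2 = 1 - g₂ ^ 2 := by linarith
    have h3 : h ^ 2 = 1 - g ^ 2 := by linarith
    have e4 : ((g₂ - g) * h₁ + (g - g₁) * h₂) ^ 2
      = (g₂ - g) ^ 2 * h₁ ^ 2 + (g - g₁) ^ 2 * h₂ ^ 2
        + 2 * ((g - g₁) * (g₂ - g) * (h₁ * h₂)) := by ring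
    rw [e4, mul_pow, h1, h2, h3]
    linarith
  have e3 : (g₂ - g₁) * (A * g + B * h - c)
      = B * ((g₂ - g₁) * h - ((g₂ - g) * h₁ + (g - g₁) * h₂)) := by
    linear_combination (g₂ - g) * c₁ + (g - g₁) * c₂
  have : 0 ≤ (g₂ - g₁) * (A * g + B * h - c) := by
    rw [e3]; exact mul_nonneg hB.le (sub_nonneg.2 key)
  linarith [nonneg_of_mul_nonneg_right this d]

/-- On the upper unit semicircle, points further to the right precede those to the left. -/
lemma semicircle_cross_pos {g g' h h' : ℝ} (e : g ^ 2 + h ^ 2 = 1) (e' : g' ^ 2 + h' ^ 2 = 1)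
    (ph : 0 < h) (ph' : 0 < h') (hg : g' < g) : 0 < g * h' - h * g' := by
  rcases lt_or_ge g' 0 with n | n
  · rcases le_or_gt 0 g with m | m
    · nlinarith [mul_nonneg m ph'.le, mul_pos ph (neg_pos.2 n)]
    · have : h' < h := lt_of_pow_lt_pow_left₀ 2 ph.le (by nlinarith)
      nlinarith
  · have : h < h' := lt_of_pow_lt_pow_left₀ 2 ph'.le (by nlinarith)
    nlinarith

section Order

variable {v w : Mink} {θ : ℝ}

lemma dot_frame (x y : Mink) (θ : ℝ) :
    dot x y = dot x (j₀ θ) * dot y (j₀ θ) + dot x (w₀ θ) * dot y (w₀ θ) - x 2 * y 2 := by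
  simp [dot, j₀, w₀]
  linear_combination (-(x 0 * y 0 + x 1 * y 1)) * Real.cos_sq_add_sin_sq θ

lemma cross_frame (x y : Mink) (θ : ℝ) :
    cross x y = dot x (j₀ θ) * (-dot y (w₀ θ)) - (-dot x (w₀ θ)) * dot y (j₀ θ) := by
  simp [dot, j₀, w₀, cross]
  linear_combination (-(x 0 * y 1 - x 1 * y 0)) * Real.cos_sq_add_sin_sq θ

/-- Along the geodesic `w₀ θ`, the end `v⁻` comes before `v⁺`. -/
lemma dot_j₀_nullPlus_sub (hv : dot v v = 1) (θ : ℝ) :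
    dot (nullPlus v) (j₀ θ) - dot (nullMinus v) (j₀ θ)
      = -(2 / (1 + v 2 ^ 2)) * dot v (w₀ θ) := by
  rw [nullMinus_unit hv, nullPlus_unit hv]
  have h' : 1 + v 2 ^ 2 ≠ 0 := by positivity
  simp [dot, j₀, w₀]; field_simp; ring

lemma null_circle {n : Mink} (hn : dot n n = 0) (hn2 : n 2 = 1) (θ : ℝ) :
    dot n (j₀ θ) ^ 2 + (-dot n (w₀ θ)) ^ 2 = 1 := by
  rw [dot_frame n n θ, hn2] at hn
  linarith

lemma dot_j₀_lt (h : Ultra v (w₀ θ)) : dot (nullMinus v) (j₀ θ) < dot (nullPlus v) (j₀ θ) := by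
  have h1 := dot_j₀_nullPlus_sub h.unit_left θ
  have h2 : 0 < -(2 / (1 + v 2 ^ 2)) * dot v (w₀ θ) := by
    have : 0 < 2 / (1 + v 2 ^ 2) := by positivity
    nlinarith [h.dot_lt]
  linarith

/-- A null vector on which `v` is negative does not end between `v⁻` and `v⁺`. -/
lemma not_between (h : Ultra v (w₀ θ)) {n : Mink} (hn : dot n n = 0) (hn2 : n 2 = 1)
    (hn0 : dot n (w₀ θ) < 0) (hvn : dot v n < 0) (h1 : dot (nullMinus v) (j₀ θ) ≤ dot n (j₀ θ))
    (h2 : dot n (j₀ θ) ≤ dot (nullPlus v) (j₀ θ)) : False := by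
  have hv := h.unit_left
  have f1 := dot_nullMinus hv
  have f2 := dot_nullPlus hv
  rw [dot_frame v _ θ, nullMinus_two] at f1
  rw [dot_frame v _ θ, nullPlus_two] at f2
  rw [dot_frame v n θ, hn2] at hvn
  have := chord_le (null_circle hn hn2 θ)
    (null_circle (dot_nullMinus_self hv) (nullMinus_two v) θ)
    (null_circle (dot_nullPlus_self hv) (nullPlus_two v) θ) (neg_pos.2 hn0)
    (A := dot v (j₀ θ)) (B := -dot v (w₀ θ)) (c := v 2) (by linarith [h.dot_lt]) (by linarith)
    (by linarith) h1 h2 (dot_j₀_lt h)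
  linarith

lemma cross_pos_of_lt (hv : Ultra v (w₀ θ)) (hw : Ultra w (w₀ θ))
    (h : dot (nullPlus w) (j₀ θ) < dot (nullMinus v) (j₀ θ)) : 0 < cross v w := by
  have lv := dot_j₀_lt hv
  have lw := dot_j₀_lt hw
  have pos : ∀ {a b : Mink}, dot a a = 0 → a 2 = 1 → dot a (w₀ θ) < 0 → dot b b = 0 → b 2 = 1 →
      dot b (w₀ θ) < 0 → dot b (j₀ θ) < dot a (j₀ θ) → 0 < cross a b := by
    intro a b a0 a2 an b0 b2 bn hab
    rw [cross_frame a b θ]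
    exact semicircle_cross_pos (null_circle a0 a2 θ) (null_circle b0 b2 θ) (neg_pos.2 an)
      (neg_pos.2 bn) hab
  have v1 := hv.symm.dot_nullMinus_neg
  have v2 := hv.symm.dot_nullPlus_neg
  have w1 := hw.symm.dot_nullMinus_neg
  have w2 := hw.symm.dot_nullPlus_neg
  rw [dot_comm] at v1 v2 w1 w2
  have uv := hv.unit_left
  have uw := hw.unit_left
  have c1 := pos (dot_nullMinus_self uv) (by simp) v1 (dot_nullMinus_self uw) (by simp) w1
    (by linarith)
  have c2 := pos (dot_nullMinus_self uv) (by simp) v1 (dot_nullPlus_self uw) (by simp) w2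
    (by linarith)
  have c3 := pos (dot_nullPlus_self uv) (by simp) v2 (dot_nullMinus_self uw) (by simp) w1
    (by linarith)
  have c4 := pos (dot_nullPlus_self uv) (by simp) v2 (dot_nullPlus_self uw) (by simp) w2
    (by linarith)
  -- the horizontal part of `v` is the midpoint direction of the arc between its two ends
  have hsum : cross (nullMinus v) (nullMinus w) + cross (nullMinus v) (nullPlus w)
      + cross (nullPlus v) (nullMinus w) + cross (nullPlus v) (nullPlus w)
      = (2 * v 2 / (1 + v 2 ^ 2)) * (2 * w 2 / (1 + w 2 ^ 2)) * cross v w := by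
    rw [nullMinus_unit uv, nullPlus_unit uv, nullMinus_unit uw, nullPlus_unit uw]
    have h' : 1 + v 2 ^ 2 ≠ 0 := by positivity
    have h'' : 1 + w 2 ^ 2 ≠ 0 := by positivity
    simp [cross]; field_simp; ring
  have v2pos : 0 < v 2 := by simpa [w₀] using hv.future
  have w2pos : 0 < w 2 := by simpa [w₀] using hw.future
  have hp : 0 < (2 * v 2 / (1 + v 2 ^ 2)) * (2 * w 2 / (1 + w 2 ^ 2)) := by positivity
  have : 0 < (2 * v 2 / (1 + v 2 ^ 2)) * (2 * w 2 / (1 + w 2 ^ 2)) * cross v w := by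
    rw [← hsum]; positivity
  exact (pos_iff_pos_of_mul_pos this).1 hp

/-- In a hyperideal triangle with a side through the origin, the intervals cut off by the other two
sides are disjoint, and their order is detected by the sign of `cross`. -/
lemma order_dichotomy (hvw : Ultra v w) (hv : Ultra v (w₀ θ)) (hw : Ultra w (w₀ θ)) :
    (0 < cross v w ∧ dot (nullPlus w) (j₀ θ) < dot (nullMinus v) (j₀ θ)) ∨
    (cross v w < 0 ∧ dot (nullPlus v) (j₀ θ) < dot (nullMinus w) (j₀ θ)) := by
  have v1 := hv.symm.dot_nullMinus_neg
  have w1 := hw.symm.dot_nullMinus_neg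
  have w2 := hw.symm.dot_nullPlus_neg
  rw [dot_comm] at v1 w1 w2
  have uv := hv.unit_left
  have uw := hw.unit_left
  by_cases h1 : dot (nullPlus w) (j₀ θ) < dot (nullMinus v) (j₀ θ)
  · exact Or.inl ⟨cross_pos_of_lt hv hw h1, h1⟩
  by_cases h2 : dot (nullPlus v) (j₀ θ) < dot (nullMinus w) (j₀ θ)
  · have := cross_pos_of_lt hw hv h2
    exact Or.inr ⟨by simp only [cross] at *; linarith, h2⟩
  exfalso
  push Not at h1 h2
  have n1 : ¬ dot (nullPlus w) (j₀ θ) ≤ dot (nullPlus v) (j₀ θ) := fun h =>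
    not_between hv (dot_nullPlus_self uw) (by simp) w2 hvw.dot_nullPlus_neg h1 h
  have n2 : ¬ dot (nullMinus v) (j₀ θ) ≤ dot (nullMinus w) (j₀ θ) := fun h =>
    not_between hv (dot_nullMinus_self uw) (by simp) w1 hvw.dot_nullMinus_neg h h2
  push Not at n1 n2
  exact not_between hw (dot_nullMinus_self uv) (by simp) v1 hvw.symm.dot_nullMinus_neg n2.le h1

end Order

/-! ### The diagonal flip -/

lemma iota₀_apply (v : Mink) : iota₀.1 v = ![-v 0, -v 1, v 2] := by
  apply mink_ext <;> simp [iota₀, spine_apply, p₀, dot]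
  ring

lemma dot_iota₀ (u v : Mink) : dot (iota₀.1 u) (iota₀.1 v) = dot u v := iota₀.2 u v

lemma iota₀_iota₀ (v : Mink) : iota₀.1 (iota₀.1 v) = v := spine_spine _ _

lemma nullPlus_iota₀ (w : Mink) : nullPlus (iota₀.1 w) = iota₀.1 (nullPlus w) := by
  have h : dot (iota₀.1 w) (iota₀.1 w) = dot w w := dot_iota₀ w w
  unfold nullPlus
  rw [h, iota₀_apply, iota₀_apply]
  apply mink_ext <;> simp <;> ring

lemma nullMinus_iota₀ (w : Mink) : nullMinus (iota₀.1 w) = iota₀.1 (nullMinus w) := by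
  have h : dot (iota₀.1 w) (iota₀.1 w) = dot w w := dot_iota₀ w w
  unfold nullMinus
  rw [h, iota₀_apply, iota₀_apply]
  apply mink_ext <;> simp <;> ring

/-- If two half-planes are disjoint from a half-plane bounded by a geodesic through the origin, then
the first is disjoint from the image of the second under the point symmetry in the origin. -/
lemma Ultra.flip {v w : Mink} {θ : ℝ} (hv : Ultra v (w₀ θ))
    (hw : Ultra w (w₀ θ)) : Ultra v (iota₀.1 w) := by
  have v2 : 0 < v 2 := by simpa [w₀] using hv.future
  have w2 : 0 < w 2 := by simpa [w₀] using hw.future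
  refine ⟨hv.unit_left, by rw [dot_iota₀]; exact hw.unit_left, ?_, by
    rw [iota₀_apply]; simpa using add_pos v2 w2⟩
  have ev := hv.unit_left
  have ew := hw.unit_left
  rw [dot_frame v v θ] at ev
  rw [dot_frame w w θ] at ew
  have e : dot v (iota₀.1 w) = -(dot v (j₀ θ) * dot w (j₀ θ) + dot v (w₀ θ) * dot w (w₀ θ))
      - v 2 * w 2 := by
    rw [dot_frame v _ θ, iota₀_apply]
    simp [dot, j₀, w₀]; ring
  rw [e]
  have a1 := hv.dot_lt
  have a2 := hw.dot_lt
  generalize dot v (j₀ θ) = g₁ at *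
  generalize dot w (j₀ θ) = g₂ at *
  generalize dot v (w₀ θ) = k₁ at *
  generalize dot w (w₀ θ) = k₂ at *
  -- `|g₁| < v 2` and `|g₂| < w 2`
  have b1 : |g₁| < v 2 := abs_lt_of_sq_lt_sq (by nlinarith) v2.le
  have b2 : |g₂| < w 2 := abs_lt_of_sq_lt_sq (by nlinarith) w2.le
  have b3 : |g₁ * g₂| ≤ v 2 * w 2 := by
    rw [abs_mul]; exact mul_le_mul b1.le b2.le (abs_nonneg _) v2.le
  have := neg_abs_le (g₁ * g₂)
  nlinarith

/-- A geodesic through the origin that completes an ultraparallel pair to a hyperideal triangle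
after the flip: its direction is the combination of `v` and `w` of height zero. -/
lemma exists_flip_side {v w : Mink} (h : Ultra v w) (hv : 0 < v 2) (hw : 0 < w 2) :
    ∃ θ, Ultra v (w₀ θ) ∧ Ultra (iota₀.1 w) (w₀ θ) := by
  set k := dot v w with hk
  have hk1 : k < -1 := h.dot_lt
  have hvw := mul_pos hv hw
  have hN : 0 < v 2 ^ 2 + w 2 ^ 2 - 2 * v 2 * w 2 * k := by
    nlinarith [sq_nonneg (v 2), sq_nonneg (w 2)]
  obtain ⟨r, hr, hr0⟩ : ∃ r, r ^ 2 = v 2 ^ 2 + w 2 ^ 2 - 2 * v 2 * w 2 * k ∧ 0 < r :=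
    ⟨_, Real.sq_sqrt hN.le, Real.sqrt_pos.2 hN⟩
  set m : Mink := v 2 • w - w 2 • v with hm
  have m2 : m 2 = 0 := by simp [hm]; ring
  have mm : m 0 ^ 2 + m 1 ^ 2 = r ^ 2 := by
    have : dot m m = r ^ 2 := by
      rw [hr, hm]
      simp only [dot_sub_left, dot_sub_right, dot_smul_left, dot_smul_right, h.unit_left,
        h.unit_right, dot_comm w v, ← hk]
      ring
    simp only [dot, m2] at this
    linarith
  have hz : ‖(⟨m 0, m 1⟩ : ℂ)‖ = r := by
    rw [Complex.norm_def, Complex.normSq_mk, ← pow_two, ← pow_two, mm, Real.sqrt_sq hr0.le]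
  set θ := Complex.arg ⟨m 0, m 1⟩
  have hc : m 0 = r * Real.cos θ := by
    have := Complex.norm_mul_cos_arg ⟨m 0, m 1⟩
    rw [hz] at this; exact this.symm
  have hs : m 1 = r * Real.sin θ := by
    have := Complex.norm_mul_sin_arg ⟨m 0, m 1⟩
    rw [hz] at this; exact this.symm
  have hmw : m = r • w₀ θ := by
    apply mink_ext <;> simp [w₀, hc, hs, m2]
  have e1 : r * dot v (w₀ θ) = v 2 * k - w 2 := by
    rw [← dot_smul_right, ← hmw, hm, dot_sub_right, dot_smul_right, dot_smul_right, ← hk,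
      h.unit_left]
    ring
  have e2 : r * dot w (w₀ θ) = v 2 - w 2 * k := by
    rw [← dot_smul_right, ← hmw, hm, dot_sub_right, dot_smul_right, dot_smul_right,
      dot_comm w v, ← hk, h.unit_right]
    ring
  have e3 : dot (iota₀.1 w) (w₀ θ) = -dot w (w₀ θ) := by
    rw [iota₀_apply]; simp [dot, w₀]; ring
  have hk2 : 0 < k ^ 2 - 1 := by nlinarith
  refine ⟨θ, ⟨h.unit_left, unit_w₀ θ, ?_, by simpa [w₀] using hv⟩,
    ⟨by rw [dot_iota₀]; exact h.unit_right, unit_w₀ θ, ?_, by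
      rw [iota₀_apply]; simpa [w₀] using hw⟩⟩
  · have h1 : r < w 2 - v 2 * k := by
      apply lt_of_pow_lt_pow_left₀ 2 (by nlinarith)
      rw [hr]
      nlinarith [mul_pos (pow_pos hv 2) hk2]
    by_contra hc
    push Not at hc
    nlinarith
  · rw [e3]
    have h1 : r < v 2 - w 2 * k := by
      apply lt_of_pow_lt_pow_left₀ 2 (by nlinarith)
      rw [hr]
      nlinarith [mul_pos (pow_pos hw 2) hk2]
    by_contra hc
    push Not at hc
    nlinarith

/-! ### Cocycles of subgroups of `O(2,1)` -/

section Cocycles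

variable {Γ : Subgroup O21}

lemma transl_mul (u : cocycles₁ (minkRep Γ)) (g h : Γ) :
    transl u (g * h) = g.1.1 (transl u h) + transl u g :=
  (mem_cocycles₁_iff (A := minkRep Γ) u).1 u.2 g h

lemma transl_one (u : cocycles₁ (minkRep Γ)) : transl u 1 = 0 := cocycles₁_map_one u

lemma transl_add (u u' : cocycles₁ (minkRep Γ)) (g : Γ) :
    transl (u + u') g = transl u g + transl u' g := rfl

lemma transl_smul (a : ℝ) (u : cocycles₁ (minkRep Γ)) (g : Γ) :
    transl (a • u) g = a • transl u g := rfl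

lemma transl_inv (u : cocycles₁ (minkRep Γ)) (g : Γ) :
    transl u g⁻¹ = -(g⁻¹).1.1 (transl u g) := by
  have h := transl_mul u g⁻¹ g
  rw [inv_mul_cancel, transl_one] at h
  exact eq_neg_of_add_eq_zero_right h.symm

lemma transl_ext {u u' : cocycles₁ (minkRep Γ)} (h : ∀ g, transl u g = transl u' g) : u = u' :=
  cocycles₁_ext h

/-- A cocycle is determined by its values on a generating set. -/
lemma cocycle_ext {S : Set O21} (hΓ : Subgroup.closure S = Γ) {u u' : cocycles₁ (minkRep Γ)}
    (h : ∀ g : Γ, g.1 ∈ S → transl u g = transl u' g) : u = u' := by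
  subst hΓ
  have key : ∀ (g : O21) (hg : g ∈ Subgroup.closure S), transl u ⟨g, hg⟩ = transl u' ⟨g, hg⟩ := by
    intro g hg
    induction hg using Subgroup.closure_induction with
    | mem x hx => exact h _ hx
    | one => exact (transl_one u).trans (transl_one u').symm
    | mul x y hx hy ex ey =>
      have e1 := transl_mul u ⟨x, hx⟩ ⟨y, hy⟩
      have e2 := transl_mul u' ⟨x, hx⟩ ⟨y, hy⟩
      rw [ex, ey] at e1
      exact e1.trans e2.symm
    | inv x hx ex =>
      have e1 := transl_inv u ⟨x, hx⟩
      have e2 := transl_inv u' ⟨x, hx⟩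
      rw [ex] at e1
      exact e1.trans e2.symm
  exact transl_ext fun g => key g.1 g.2

/-- Restriction of cocycles to a subgroup. -/
def resCocycle {Γ Γ' : Subgroup O21} (h : Γ ≤ Γ') :
    cocycles₁ (minkRep Γ') →ₗ[ℝ] cocycles₁ (minkRep Γ) where
  toFun u := ⟨fun g => transl u ⟨g.1, h g.2⟩, (mem_cocycles₁_iff (A := minkRep Γ) _).2
    fun g k => transl_mul u ⟨g.1, h g.2⟩ ⟨k.1, h k.2⟩⟩
  map_add' _ _ := rfl
  map_smul' _ _ := rfl

lemma transl_resCocycle {Γ Γ' : Subgroup O21} (h : Γ ≤ Γ') (u : cocycles₁ (minkRep Γ')) (g : Γ) :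
    transl (resCocycle h u) g = transl u ⟨g.1, h g.2⟩ := rfl

lemma H1π_eq_zero_of_transl {u : cocycles₁ (minkRep Γ)} {x : Mink}
    (h : ∀ g : Γ, transl u g = x - g.1.1 x) : (H1π (minkRep Γ)).hom u = 0 := by
  refine (H1π_eq_zero_iff (A := minkRep Γ) u).2 ⟨-x, funext fun g => ?_⟩
  refine Eq.trans ?_ (h g).symm
  change g.1.1 (-x) - -x = x - g.1.1 x
  rw [map_neg]; abel

/-- The cocycle `g ↦ x - g x`, whose affine action fixes the point `x`. -/
lemma exists_fixing_cocycle (Γ : Subgroup O21) (x : Mink) :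
    ∃ u : cocycles₁ (minkRep Γ), ∀ g : Γ, transl u g = x - g.1.1 x := by
  refine ⟨⟨fun g => x - g.1.1 x, (mem_cocycles₁_iff (A := minkRep Γ) _).2 fun g k => ?_⟩,
    fun g => rfl⟩
  change x - g.1.1 (k.1.1 x) = g.1.1 (x - k.1.1 x) + (x - g.1.1 x)
  rw [map_sub]; abel

end Cocycles

/-! ### The Coxeter group as a free product -/

/-- The homomorphism from the group of order two determined by an involution. -/
def involutionHom {G : Type*} [Group G] (g : G) (hg : g * g = 1) :
    Multiplicative (ZMod 2) →* G where
  toFun x := if x = 1 then 1 else g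
  map_one' := by simp
  map_mul' x y := by
    have h : ∀ x : Multiplicative (ZMod 2), x = 1 ∨ x = Multiplicative.ofAdd 1 := by decide
    have h1 : Multiplicative.ofAdd (1 : ZMod 2) ≠ 1 := by decide
    have h2 : Multiplicative.ofAdd (1 : ZMod 2) * Multiplicative.ofAdd 1 = 1 := by decide
    rcases h x with rfl | rfl <;> rcases h y with rfl | rfl
    · simp
    · simp
    · simp
    · rw [if_pos h2, if_neg h1, hg]

lemma involutionHom_ofAdd_one {G : Type*} [Group G] (g : G) (hg : g * g = 1) :
    involutionHom g hg (Multiplicative.ofAdd 1) = g := by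
  change (if Multiplicative.ofAdd (1 : ZMod 2) = 1 then 1 else g) = g
  exact if_neg (by decide)

/-- The action of `O(2,1)` on Minkowski space. -/
instance : MulAction O21 Mink where
  smul g v := g.1 v
  one_smul _ := rfl
  mul_smul _ _ _ := rfl

/-- The cone over the open half-plane bounded by `w^⊥` on which `w` is positive. -/
def halfCone (w : Mink) : Set Mink := {v | dot v v < 0 ∧ 0 < dot v w * v 2}

lemma timelike_time_ne_zero {v : Mink} (h : dot v v < 0) : v 2 ≠ 0 := by
  intro h0
  simp only [dot, h0] at h
  nlinarith [sq_nonneg (v 0), sq_nonneg (v 1)]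

lemma halfCone_nonempty {w : Mink} (hw : dot w w = 1) : (halfCone w).Nonempty := by
  refine ⟨![w 2 * w 0 + w 0 / 2, w 2 * w 1 + w 1 / 2, 1 + w 2 ^ 2 + w 2 / 2], ?_⟩
  have h := planar_sq hw
  constructor
  · simp [dot]
    nlinarith [sq_nonneg (w 2)]
  · have e : dot ![w 2 * w 0 + w 0 / 2, w 2 * w 1 + w 1 / 2, 1 + w 2 ^ 2 + w 2 / 2] w = 1 / 2 := by
      simp [dot]; linear_combination (w 2 + 1 / 2) * h
    rw [e]
    simp
    nlinarith [sq_nonneg (w 2 + 1 / 4)]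

/-- A timelike vector in the half-plane of `w` is in the complement of the half-plane of `v`. -/
lemma Ultra.halfCone {v w x : Mink} (h : Ultra v w) (hx : x ∈ halfCone w) : dot x v * x 2 < 0 := by
  obtain ⟨hx1, hx2⟩ := hx
  have key : ∀ y : Mink, dot y y < 0 → 0 < y 2 → 0 < dot y w → dot y v < 0 := by
    intro y y1 y2 y3
    have := dot_future_neg h.sum_timelike (by simpa using h.future) y1.le y2
    rw [dot_add_left, dot_comm v, dot_comm w] at this
    linarith
  rcases lt_or_gt_of_ne (timelike_time_ne_zero hx1) with h2 | h2
  · have h3 := key (-x) (by rw [dot_neg_left, dot_neg_right]; linarith) (by simpa using h2)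
      (by rw [dot_neg_left]; nlinarith)
    rw [dot_neg_left] at h3
    nlinarith
  · have h3 := key x hx1 h2 (by nlinarith)
    nlinarith

/-- Involutions that interchange the sides of three disjoint half-planes generate their free
product, by the ping-pong lemma; so an affine deformation of the group generated may be prescribed
on the generators. -/
lemma exists_cocycle {r : Fin 3 → O21} {d : Fin 3 → Mink} (hr : ∀ i, r i * r i = 1)
    (hd : ∀ i j, i ≠ j → Ultra (d i) (d j))
    (hping : ∀ i v, dot v v < 0 → dot v (d i) * v 2 < 0 →
      0 < dot ((r i).1 v) (d i) * (r i).1 v 2)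
    {t : Fin 3 → Mink} (ht : ∀ i, (r i).1 (t i) = -t i) :
    ∃ u : cocycles₁ (minkRep (Subgroup.closure (Set.range r))),
      ∀ i (g : Subgroup.closure (Set.range r)), g.1 = r i → transl u g = t i := by
  classical
  have hr' : ∀ i x, (r i).1 ((r i).1 x) = x := fun i x => by
    change ((r i * r i : O21)).1 x = x
    rw [hr]; rfl
  have hinv : ∀ i, Function.Involutive fun x => (r i).1 x + t i := fun i x => by
    simp only [map_add, hr', ht]; abel
  let T : Fin 3 → Equiv.Perm Mink := fun i => (hinv i).toPerm
  have hT : ∀ i, T i * T i = 1 := fun i => Equiv.ext (hinv i)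
  let H : Fin 3 → Type := fun _ => Multiplicative (ZMod 2)
  let F : Monoid.CoprodI H →* O21 := Monoid.CoprodI.lift fun i => involutionHom (r i) (hr i)
  let F' : Monoid.CoprodI H →* Equiv.Perm Mink :=
    Monoid.CoprodI.lift fun i => involutionHom (T i) (hT i)
  let s : ∀ i : Fin 3, Monoid.CoprodI H := fun i =>
    Monoid.CoprodI.of (i := i) (Multiplicative.ofAdd (1 : ZMod 2))
  have hFs : ∀ i, F (s i) = r i := fun i => by
    simp only [F, s]
    rw [Monoid.CoprodI.lift_of, involutionHom_ofAdd_one]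
  have hFs' : ∀ i, F' (s i) = T i := fun i => by
    simp only [F', s]
    rw [Monoid.CoprodI.lift_of, involutionHom_ofAdd_one]
  have cases2 : ∀ x : Multiplicative (ZMod 2), x = 1 ∨ x = Multiplicative.ofAdd 1 := by decide
  have hinj : Function.Injective F := by
    refine Monoid.CoprodI.lift_injective_of_ping_pong _ (Or.inl (by simp))
      (fun i => halfCone (d i)) (fun i => halfCone_nonempty
        (hd i (i + 1) (by fin_cases i <;> decide)).unit_left) ?_ ?_
    · intro i j hij
      refine Set.disjoint_left.2 fun x hx hx' => ?_
      have := (hd i j hij).halfCone hx'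
      linarith [hx.2]
    · intro i j hij h hh
      rcases cases2 h with rfl | rfl
      · exact absurd rfl hh
      · rw [involutionHom_ofAdd_one]
        rintro _ ⟨x, hx, rfl⟩
        have e : dot ((r i).1 x) ((r i).1 x) = dot x x := (r i).2 x x
        refine ⟨e.trans_lt hx.1, hping i x hx.1 ((hd i j hij).halfCone hx)⟩
  -- `F' w` is an affine map with linear part `F w`
  have hlin : ∀ w x, F' w x = (F w).1 x + F' w 0 := by
    intro w
    induction w using Monoid.CoprodI.induction_on with
    | one => intro x; simp
    | of i m =>
      rcases cases2 m with rfl | rfl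
      · intro x; simp
      · intro x
        change F' (s i) x = (F (s i)).1 x + F' (s i) 0
        rw [hFs, hFs']
        change (r i).1 x + t i = (r i).1 x + ((r i).1 0 + t i)
        simp
    | mul a b ha hb =>
      intro x
      rw [map_mul, map_mul, Equiv.Perm.mul_apply, Equiv.Perm.mul_apply, ha (F' b x), hb x,
        ha (F' b 0), map_add]
      change (F a).1 ((F b).1 x) + _ + _ = (F a).1 ((F b).1 x) + _
      abel
  have hle : Subgroup.closure (Set.range r) ≤ F.range := by
    rw [Subgroup.closure_le]
    rintro _ ⟨i, rfl⟩
    exact ⟨s i, hFs i⟩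
  choose w hw using fun g : Subgroup.closure (Set.range r) => hle g.2
  refine ⟨⟨fun g => F' (w g) 0, (mem_cocycles₁_iff
    (A := minkRep (Subgroup.closure (Set.range r))) _).2 fun g k => ?_⟩, fun i g hg => ?_⟩
  · have e : w (g * k) = w g * w k := hinj (by rw [map_mul, hw, hw, hw]; rfl)
    change F' (w (g * k)) 0 = g.1.1 (F' (w k) 0) + F' (w g) 0
    rw [e, map_mul, Equiv.Perm.mul_apply, hlin (w g), hw]
  · have e : w g = s i := hinj (by rw [hw, hFs, hg])
    change F' (w g) 0 = t i
    rw [e, hFs']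
    change (r i).1 0 + t i = t i
    simp

/-! ### Deformations given by the vertices of crooked planes -/

section Vertex

variable {w₁ w₂ : Mink} {θ : ℝ}

lemma p₀_self : dot p₀ p₀ = -1 := by simp [dot, p₀]

lemma dot_p₀ (x : Mink) : dot x p₀ = -x 2 := by simp [dot, p₀]

lemma iota₀_p₀ : iota₀.1 p₀ = p₀ := spine_apply_self (by simp [p₀_self])

lemma iota₀_w₀ (θ : ℝ) : iota₀.1 (w₀ θ) = -w₀ θ :=
  spine_apply_of_dot_eq_zero (by simp [dot_p₀, w₀])

lemma iota₀_j₀ (θ : ℝ) : iota₀.1 (j₀ θ) = -j₀ θ :=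
  spine_apply_of_dot_eq_zero (by simp [dot_p₀, j₀])

lemma nullMinus_w₀ (θ : ℝ) : nullMinus (w₀ θ) = p₀ + j₀ θ := by
  rw [nullMinus_unit (unit_w₀ θ)]
  apply mink_ext <;> simp [w₀, p₀, j₀]

lemma nullPlus_w₀ (θ : ℝ) : nullPlus (w₀ θ) = p₀ - j₀ θ := by
  rw [nullPlus_unit (unit_w₀ θ)]
  apply mink_ext <;> simp [w₀, p₀, j₀]

/-- The spine reflection in `w` preserves the crooked planes of direction `w`. -/
lemma spine_linear_part {w : Mink} (hw : dot w w = 1) :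
    (spine w).1 w = w ∧ (spine w).1 (nullPlus w) = -nullPlus w ∧
      (spine w).1 (nullMinus w) = -nullMinus w :=
  ⟨spine_apply_self (by simp [hw]),
    spine_apply_of_dot_eq_zero (by rw [dot_comm, dot_nullPlus hw]),
    spine_apply_of_dot_eq_zero (by rw [dot_comm, dot_nullMinus hw])⟩

/-- The point symmetry in the origin preserves the crooked planes whose direction is orthogonal to
the origin. -/
lemma iota₀_linear_part (θ : ℝ) :
    iota₀.1 (w₀ θ) = -w₀ θ ∧ iota₀.1 (nullPlus (w₀ θ)) = nullMinus (w₀ θ) ∧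
      iota₀.1 (nullMinus (w₀ θ)) = nullPlus (w₀ θ) := by
  refine ⟨iota₀_w₀ θ, ?_, ?_⟩ <;> rw [nullPlus_w₀, nullMinus_w₀]
  · rw [map_sub, iota₀_p₀, iota₀_j₀]; abel
  · rw [map_add, iota₀_p₀, iota₀_j₀]; abel

lemma spine_mul_self (w : Mink) : spine w * spine w = 1 :=
  Subtype.ext (LinearEquiv.ext (spine_spine w))

lemma spine_iota₀ (w : Mink) : spine (iota₀.1 w) = iota₀ * spine w * iota₀ := by
  refine Subtype.ext (LinearEquiv.ext fun v => ?_)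
  change (spine (iota₀.1 w)).1 v = iota₀.1 ((spine w).1 (iota₀.1 v))
  have e : dot v (iota₀.1 w) = dot (iota₀.1 v) w := by
    rw [← dot_iota₀ v, iota₀_iota₀]
  rw [spine_apply, spine_apply, map_add, map_neg, map_smul, iota₀_iota₀, dot_iota₀, e]

lemma closure_range_generators (w₁ w₂ : Mink) :
    Subgroup.closure (Set.range ![spine w₁, spine w₂, iota₀]) = coxeterGroup w₁ w₂ := by
  rw [coxeterGroup]
  congr 1
  ext x
  simp
  tauto

lemma spine_mem_left (w₁ w₂ : Mink) : spine w₁ ∈ coxeterGroup w₁ w₂ :=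
  Subgroup.subset_closure (by simp)

lemma spine_mem_right (w₁ w₂ : Mink) : spine w₂ ∈ coxeterGroup w₁ w₂ :=
  Subgroup.subset_closure (by simp)

lemma iota₀_mem (w₁ w₂ : Mink) : iota₀ ∈ coxeterGroup w₁ w₂ :=
  Subgroup.subset_closure (by simp)

lemma closure_range_generators_flip (w₁ w₂ : Mink) :
    Subgroup.closure (Set.range ![spine w₁, iota₀ * spine w₂ * iota₀, iota₀])
      = coxeterGroup w₁ w₂ := by
  have hι : iota₀ * iota₀ = 1 := spine_mul_self _
  apply le_antisymm
  · rw [Subgroup.closure_le]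
    rintro _ ⟨i, rfl⟩
    fin_cases i
    · exact spine_mem_left w₁ w₂
    · exact mul_mem (mul_mem (iota₀_mem w₁ w₂) (spine_mem_right w₁ w₂)) (iota₀_mem w₁ w₂)
    · exact iota₀_mem w₁ w₂
  · set K := Subgroup.closure (Set.range ![spine w₁, iota₀ * spine w₂ * iota₀, iota₀])
    have m0 : spine w₁ ∈ K := Subgroup.subset_closure ⟨0, rfl⟩
    have m1 : iota₀ * spine w₂ * iota₀ ∈ K := Subgroup.subset_closure ⟨1, rfl⟩
    have m2 : iota₀ ∈ K := Subgroup.subset_closure ⟨2, rfl⟩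
    have m3 : spine w₂ ∈ K := by
      have := mul_mem (mul_mem m2 m1) m2
      rwa [show iota₀ * (iota₀ * spine w₂ * iota₀) * iota₀
        = (iota₀ * iota₀) * spine w₂ * (iota₀ * iota₀) by group, hι, one_mul, mul_one] at this
    rw [coxeterGroup, Subgroup.closure_le]
    rintro _ (rfl | rfl | rfl)
    exacts [m0, m3, m2]

lemma surfaceGroup_le (w₁ w₂ : Mink) : surfaceGroup w₁ w₂ ≤ coxeterGroup w₁ w₂ := by
  rw [surfaceGroup, Subgroup.closure_le]
  rintro _ (rfl | rfl)
  · exact mul_mem (spine_mem_left w₁ w₂) (iota₀_mem w₁ w₂)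
  · exact mul_mem (iota₀_mem w₁ w₂) (spine_mem_right w₁ w₂)

lemma ultra_of_dirI (h : IsHyperidealTriangle (dirI w₁ w₂ θ)) :
    Ultra w₁ w₂ ∧ Ultra w₁ (w₀ θ) ∧ Ultra w₂ (w₀ θ) := by
  rw [isHyperidealTriangle_iff] at h
  exact ⟨h 0 1 (by decide), h 0 2 (by decide), h 1 2 (by decide)⟩

lemma pairwise_ultra {u v w : Mink} (h₁ : Ultra u v) (h₂ : Ultra u w) (h₃ : Ultra v w) :
    ∀ i j, i ≠ j → Ultra (![u, v, w] i) (![u, v, w] j) := by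
  intro i j hij
  fin_cases i <;> fin_cases j
  all_goals first | exact absurd rfl hij | assumption | exact Ultra.symm ‹_›

/-- The spine reflection in a unit spacelike vector `w` interchanges the sides of `w^⊥`: it fixes
the product with `w` and reverses time. -/
lemma spine_ping {w v : Mink} (hw : dot w w = 1) (hv : dot v v < 0) (h : dot v w * v 2 < 0) :
    0 < dot ((spine w).1 v) w * (spine w).1 v 2 := by
  have e1 : dot ((spine w).1 v) w = dot v w := by
    rw [spine_apply, dot_add_left, dot_neg_left, dot_smul_left, hw]; ring
  have e2 : dot ((spine w).1 v) v = -dot v v + 2 * dot v w ^ 2 := by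
    rw [spine_apply, dot_add_left, dot_neg_left, dot_smul_left, hw, dot_comm w v]; ring
  have e3 : dot ((spine w).1 v) ((spine w).1 v) = dot v v := (spine w).2 v v
  have hv0 := timelike_time_ne_zero hv
  set v' := (spine w).1 v
  have hv0' : v' 2 ≠ 0 := timelike_time_ne_zero (e3.trans_lt hv)
  have hneg : v' 2 * v 2 < 0 := by
    by_contra hc
    have hc' : 0 < v' 2 * v 2 := lt_of_le_of_ne (not_lt.1 hc) (mul_ne_zero hv0' hv0).symm
    have hpos : 0 < dot v' v := by rw [e2]; nlinarith [sq_nonneg (dot v w)]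
    rcases lt_or_gt_of_ne hv0 with h1 | h1
    · have := dot_future_neg (t := -v') (n := -v)
        (by rw [dot_neg_left, dot_neg_right, e3]; linarith)
        (by simp only [Pi.neg_apply]; nlinarith)
        (by rw [dot_neg_left, dot_neg_right]; linarith) (by simpa using h1)
      rw [dot_neg_left, dot_neg_right] at this
      linarith
    · have := dot_future_neg (t := v') (n := v) (e3.trans_lt hv) (by nlinarith) hv.le h1
      linarith
  rw [e1]
  have h1 : 0 < (dot v w * v' 2) * v 2 ^ 2 := by nlinarith [mul_pos_of_neg_of_neg h hneg]
  exact (pos_iff_pos_of_mul_pos h1).2 (by positivity)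

lemma exists_vertexCocycle (h : IsHyperidealTriangle (dirI w₁ w₂ θ)) (q : Fin 3 → Mink) :
    ∃ u : cocycles₁ (minkRep (coxeterGroup w₁ w₂)), ∀ i (g : coxeterGroup w₁ w₂),
      g.1 = ![spine w₁, spine w₂, iota₀] i →
      transl u g = q i - (![spine w₁, spine w₂, iota₀] i).1 (q i) := by
  obtain ⟨h12, h1, h2⟩ := ultra_of_dirI h
  have hr : ∀ i, ![spine w₁, spine w₂, iota₀] i * ![spine w₁, spine w₂, iota₀] i = 1 := by
    intro i; fin_cases i <;> exact spine_mul_self _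
  have := exists_cocycle hr (pairwise_ultra h12 h1 h2) ?_
    (t := fun i => q i - (![spine w₁, spine w₂, iota₀] i).1 (q i)) ?_
  · rwa [closure_range_generators] at this
  · intro i v hv hvi
    fin_cases i
    · exact spine_ping h12.unit_left hv hvi
    · exact spine_ping h12.unit_right hv hvi
    · change 0 < dot (iota₀.1 v) (w₀ θ) * iota₀.1 v 2
      have hvi' : dot v (w₀ θ) * v 2 < 0 := hvi
      have e : dot (iota₀.1 v) (w₀ θ) = -dot v (w₀ θ) := by
        rw [iota₀_apply]; simp [dot, w₀]; ring
      rw [e, iota₀_apply]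
      simp; linarith
  · intro i
    have e : ∀ x,
        (![spine w₁, spine w₂, iota₀] i).1 ((![spine w₁, spine w₂, iota₀] i).1 x) = x := by
      intro x; fin_cases i <;> exact spine_spine _ _
    rw [map_sub, e]; abel

/-- The affine deformation of the Coxeter group in which the generating involutions have the fixed
points `q i`. -/
def vertexCocycle (h : IsHyperidealTriangle (dirI w₁ w₂ θ)) :
    (Fin 3 → Mink) →ₗ[ℝ] cocycles₁ (minkRep (coxeterGroup w₁ w₂)) where
  toFun q := (exists_vertexCocycle h q).choose
  map_add' q q' := by
    refine cocycle_ext (closure_range_generators w₁ w₂) ?_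
    rintro g ⟨i, hi⟩
    rw [(exists_vertexCocycle h (q + q')).choose_spec i g hi.symm, transl_add,
      (exists_vertexCocycle h q).choose_spec i g hi.symm,
      (exists_vertexCocycle h q').choose_spec i g hi.symm, Pi.add_apply, map_add]
    abel
  map_smul' a q := by
    refine cocycle_ext (closure_range_generators w₁ w₂) ?_
    rintro g ⟨i, hi⟩
    rw [(exists_vertexCocycle h (a • q)).choose_spec i g hi.symm, RingHom.id_apply, transl_smul,
      (exists_vertexCocycle h q).choose_spec i g hi.symm, Pi.smul_apply, map_smul, smul_sub]

lemma transl_vertexCocycle (h : IsHyperidealTriangle (dirI w₁ w₂ θ)) (q : Fin 3 → Mink) (i : Fin 3)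
    (g : coxeterGroup w₁ w₂) (hg : g.1 = ![spine w₁, spine w₂, iota₀] i) :
    transl (vertexCocycle h q) g = q i - g.1.1 (q i) := by
  rw [hg]
  exact (exists_vertexCocycle h q).choose_spec i g hg

lemma eq_vertexCocycle (h : IsHyperidealTriangle (dirI w₁ w₂ θ)) {q : Fin 3 → Mink}
    {u : cocycles₁ (minkRep (coxeterGroup w₁ w₂))}
    (hu : ∀ i (g : coxeterGroup w₁ w₂), g.1 = ![spine w₁, spine w₂, iota₀] i →
      transl u g = q i - g.1.1 (q i)) : u = vertexCocycle h q := by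
  refine cocycle_ext (closure_range_generators w₁ w₂) ?_
  rintro g ⟨i, hi⟩
  rw [hu i g hi.symm, transl_vertexCocycle h q i g hi.symm]

/-- The class on the surface group of the deformation with fixed points `q i`. -/
def vertexClass (h : IsHyperidealTriangle (dirI w₁ w₂ θ)) :
    (Fin 3 → Mink) →ₗ[ℝ] H1 (minkRep (surfaceGroup w₁ w₂)) :=
  (H1π (minkRep (surfaceGroup w₁ w₂))).hom ∘ₗ resCocycle (surfaceGroup_le w₁ w₂) ∘ₗ vertexCocycle h

lemma vertexClass_apply (h : IsHyperidealTriangle (dirI w₁ w₂ θ)) (q : Fin 3 → Mink) :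
    vertexClass h q = (H1π (minkRep (surfaceGroup w₁ w₂))).hom
      (resCocycle (surfaceGroup_le w₁ w₂) (vertexCocycle h q)) := rfl

lemma vertexClass_const (h : IsHyperidealTriangle (dirI w₁ w₂ θ)) (x : Mink) :
    vertexClass h (fun _ => x) = 0 := by
  obtain ⟨u, hu⟩ := exists_fixing_cocycle (coxeterGroup w₁ w₂) x
  have e : u = vertexCocycle h (fun _ => x) := eq_vertexCocycle h fun i g _ => hu g
  rw [vertexClass_apply]
  refine H1π_eq_zero_of_transl (x := x) fun g => ?_
  rw [transl_resCocycle, ← e, hu]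

lemma vertexClass_eq_zero (h : IsHyperidealTriangle (dirI w₁ w₂ θ)) {q : Fin 3 → Mink}
    (hq : ∀ i, (![spine w₁, spine w₂, iota₀] i).1 (q i) = q i) : vertexClass h q = 0 := by
  have e : (0 : cocycles₁ (minkRep (coxeterGroup w₁ w₂))) = vertexCocycle h q := by
    refine eq_vertexCocycle h fun i g hg => ?_
    rw [hg, hq, sub_self]; rfl
  rw [vertexClass_apply, ← e, map_zero, map_zero]

/-! ### Margulis invariants -/

lemma dot_sub_spine {a n : Mink} (h : dot n a = 0) (x : Mink) :
    dot (x - (spine a).1 x) n = 2 * dot x n := by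
  rw [spine_apply, dot_sub_left, dot_add_left, dot_neg_left, dot_smul_left, dot_comm a n, h]; ring

/-- The Margulis invariant of a product of two involutions is, up to a positive factor, the triple
product of their axes and the displacement between their fixed points. -/
lemma dot_transl_spine_mul {Γ : Subgroup O21} (u : cocycles₁ (minkRep Γ)) {g k : Γ}
    {a b x y : Mink} (hg : g.1 = spine a) (hk : k.1 = spine b)
    (hx : transl u g = x - g.1.1 x) (hy : transl u k = y - k.1.1 y)
    (ha : dot a a ≠ 0) (hb : dot b b ≠ 0) (hab : dot a b < 0)
    (hD : 0 < dot a b ^ 2 - dot a a * dot b b) :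
    dot (transl u (g * k)) (neutral (g * k).1) =
      2 * (√(dot a b ^ 2 - dot a a * dot b b))⁻¹ * dot (y - x) (lcross a b) := by
  have hn : neutral (g * k).1
      = (-(√(dot a b ^ 2 - dot a a * dot b b))⁻¹) • lcross a b := by
    have : (g * k).1 = spine a * spine b := by rw [← hg, ← hk]; rfl
    rw [this]
    exact neutral_eq (isNeutral_spine_mul ha hb hab hD)
  rw [hn, transl_mul, hx, hy, dot_smul_right, dot_add_left, hg, hk,
    dot_sub_spine (dot_lcross_left a b)]
  have e : dot ((spine a).1 (y - (spine b).1 y)) (lcross a b)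
      = -dot (y - (spine b).1 y) (lcross a b) := by
    rw [spine_apply, dot_add_left, dot_neg_left, dot_smul_left,
      dot_comm a (lcross a b), dot_lcross_left]; ring
  rw [e, dot_sub_spine (dot_lcross_right a b), dot_sub_left]
  ring

/-- The fixed point of a conjugate of an affine involution. -/
lemma transl_conj {Γ : Subgroup O21} (u : cocycles₁ (minkRep Γ)) {g k : Γ} {x y : Mink}
    (hg : ∀ v, g.1.1 (g.1.1 v) = v) (hx : transl u g = x - g.1.1 x)
    (hy : transl u k = y - k.1.1 y) :
    transl u (g * k * g) = (g.1.1 y + x - g.1.1 x)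
      - (g * k * g).1.1 (g.1.1 y + x - g.1.1 x) := by
  have e : ∀ v, (g * k * g).1.1 v = g.1.1 (k.1.1 (g.1.1 v)) := fun _ => rfl
  rw [e, mul_assoc, transl_mul, transl_mul, hx, hy]
  simp only [map_add, map_sub, hg]
  abel

lemma margulis_vertexClass (h : IsHyperidealTriangle (dirI w₁ w₂ θ)) (g : surfaceGroup w₁ w₂)
    (q : Fin 3 → Mink) : margulis g (vertexClass h q)
      = dot (transl (vertexCocycle h q) ⟨g.1, surfaceGroup_le w₁ w₂ g.2⟩) (neutral g.1) := by
  rw [vertexClass_apply, margulis_H1π, transl_resCocycle]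

end Vertex

section Classes

variable {w₁ w₂ : Mink} {θ : ℝ}

/-- The condition of `dot_transl_spine_mul` holds for an ultraparallel pair. -/
lemma Ultra.discr_pos {v w : Mink} (h : Ultra v w) : 0 < dot v w ^ 2 - dot v v * dot w w := by
  rw [h.unit_left, h.unit_right]; nlinarith [h.dot_lt]

lemma Ultra.time_pos {v : Mink} (h : Ultra v (w₀ θ)) : 0 < v 2 := by
  simpa [w₀] using h.future

lemma margulis_gX (h : IsHyperidealTriangle (dirI w₁ w₂ θ)) : ∃ c > 0, ∀ q,
    margulis (gX w₁ w₂) (vertexClass h q) = c * dot (q 2 - q 0) (lcross w₁ p₀) := by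
  obtain ⟨-, h1, -⟩ := ultra_of_dirI h
  have hD : 0 < dot w₁ p₀ ^ 2 - dot w₁ w₁ * dot p₀ p₀ := by
    rw [h1.unit_left, p₀_self]; nlinarith [sq_nonneg (dot w₁ p₀)]
  refine ⟨2 * (√(dot w₁ p₀ ^ 2 - dot w₁ w₁ * dot p₀ p₀))⁻¹,
    mul_pos two_pos (inv_pos.2 (Real.sqrt_pos.2 hD)), fun q => ?_⟩
  rw [margulis_vertexClass]
  exact dot_transl_spine_mul (vertexCocycle h q) (g := ⟨spine w₁, spine_mem_left w₁ w₂⟩)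
    (k := ⟨iota₀, iota₀_mem w₁ w₂⟩) rfl rfl (transl_vertexCocycle h q 0 _ rfl)
    (transl_vertexCocycle h q 2 _ rfl) (by simp [h1.unit_left]) (by simp [p₀_self])
    (by rw [dot_p₀]; linarith [h1.time_pos]) hD

lemma margulis_gY (h : IsHyperidealTriangle (dirI w₁ w₂ θ)) : ∃ c > 0, ∀ q,
    margulis (gY w₁ w₂) (vertexClass h q) = c * dot (q 1 - q 2) (lcross p₀ w₂) := by
  obtain ⟨-, -, h2⟩ := ultra_of_dirI h
  have hD : 0 < dot p₀ w₂ ^ 2 - dot p₀ p₀ * dot w₂ w₂ := by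
    rw [h2.unit_left, p₀_self]; nlinarith [sq_nonneg (dot p₀ w₂)]
  refine ⟨2 * (√(dot p₀ w₂ ^ 2 - dot p₀ p₀ * dot w₂ w₂))⁻¹,
    mul_pos two_pos (inv_pos.2 (Real.sqrt_pos.2 hD)), fun q => ?_⟩
  rw [margulis_vertexClass]
  exact dot_transl_spine_mul (vertexCocycle h q) (g := ⟨iota₀, iota₀_mem w₁ w₂⟩)
    (k := ⟨spine w₂, spine_mem_right w₁ w₂⟩) rfl rfl (transl_vertexCocycle h q 2 _ rfl)
    (transl_vertexCocycle h q 1 _ rfl) (by simp [p₀_self]) (by simp [h2.unit_left])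
    (by rw [dot_comm, dot_p₀]; linarith [h2.time_pos]) hD

lemma margulis_gA (h : IsHyperidealTriangle (dirI w₁ w₂ θ)) : ∃ c > 0, ∀ q,
    margulis (gA w₁ w₂) (vertexClass h q) = c * dot (q 1 - q 0) (lcross w₁ w₂) := by
  obtain ⟨h12, -, -⟩ := ultra_of_dirI h
  refine ⟨2 * (√(dot w₁ w₂ ^ 2 - dot w₁ w₁ * dot w₂ w₂))⁻¹,
    mul_pos two_pos (inv_pos.2 (Real.sqrt_pos.2 h12.discr_pos)), fun q => ?_⟩
  rw [margulis_vertexClass]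
  have e : (⟨(gA w₁ w₂).1, surfaceGroup_le w₁ w₂ (gA w₁ w₂).2⟩ : coxeterGroup w₁ w₂)
      = ⟨spine w₁, spine_mem_left w₁ w₂⟩ * ⟨spine w₂, spine_mem_right w₁ w₂⟩ := by
    apply Subtype.ext
    change (spine w₁ * iota₀) * (iota₀ * spine w₂) = spine w₁ * spine w₂
    rw [mul_assoc, ← mul_assoc iota₀, show iota₀ * iota₀ = 1 from spine_mul_self _, one_mul]
  have e' : (gA w₁ w₂).1 = (⟨spine w₁, spine_mem_left w₁ w₂⟩
      * ⟨spine w₂, spine_mem_right w₁ w₂⟩ : coxeterGroup w₁ w₂).1 := congrArg Subtype.val e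
  rw [e, e']
  exact dot_transl_spine_mul (vertexCocycle h q) rfl rfl (transl_vertexCocycle h q 0 _ rfl)
    (transl_vertexCocycle h q 1 _ rfl) (by simp [h12.unit_left]) (by simp [h12.unit_right])
    (by linarith [h12.dot_lt]) h12.discr_pos

lemma margulis_gB (h : IsHyperidealTriangle (dirI w₁ w₂ θ)) : ∃ c > 0, ∀ q,
    margulis (gB w₁ w₂) (vertexClass h q)
      = c * dot (iota₀.1 (q 0) + q 2 - iota₀.1 (q 2) - q 1) (lcross w₂ (iota₀.1 w₁)) := by
  obtain ⟨-, h1, h2⟩ := ultra_of_dirI h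
  have h21 := h2.flip h1
  refine ⟨2 * (√(dot w₂ (iota₀.1 w₁) ^ 2 - dot w₂ w₂ * dot (iota₀.1 w₁) (iota₀.1 w₁)))⁻¹,
    mul_pos two_pos (inv_pos.2 (Real.sqrt_pos.2 h21.discr_pos)), fun q => ?_⟩
  rw [margulis_vertexClass]
  have e : (⟨(gB w₁ w₂).1, surfaceGroup_le w₁ w₂ (gB w₁ w₂).2⟩ : coxeterGroup w₁ w₂)
      = ⟨spine w₂, spine_mem_right w₁ w₂⟩ * (⟨iota₀, iota₀_mem w₁ w₂⟩
        * ⟨spine w₁, spine_mem_left w₁ w₂⟩ * ⟨iota₀, iota₀_mem w₁ w₂⟩) := by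
    apply Subtype.ext
    change (iota₀ * spine w₂)⁻¹ * (spine w₁ * iota₀) = spine w₂ * (iota₀ * spine w₁ * iota₀)
    rw [mul_inv_rev, inv_eq_of_mul_eq_one_left (spine_mul_self w₂),
      inv_eq_of_mul_eq_one_left (show iota₀ * iota₀ = 1 from spine_mul_self _)]
    group
  have e' : (gB w₁ w₂).1 = (⟨spine w₂, spine_mem_right w₁ w₂⟩ * (⟨iota₀, iota₀_mem w₁ w₂⟩
        * ⟨spine w₁, spine_mem_left w₁ w₂⟩ * ⟨iota₀, iota₀_mem w₁ w₂⟩) : coxeterGroup w₁ w₂).1 :=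
    congrArg Subtype.val e
  rw [e, e']
  refine dot_transl_spine_mul (vertexCocycle h q) rfl (spine_iota₀ w₁).symm
    (transl_vertexCocycle h q 1 _ rfl) ?_ (by simp [h21.unit_left]) (by simp [h21.unit_right])
    (by linarith [h21.dot_lt]) h21.discr_pos
  exact transl_conj (vertexCocycle h q) (g := ⟨iota₀, iota₀_mem w₁ w₂⟩)
    (k := ⟨spine w₁, spine_mem_left w₁ w₂⟩) iota₀_iota₀ (transl_vertexCocycle h q 2 _ rfl)
    (transl_vertexCocycle h q 0 _ rfl)

/-! ### All classes come from vertices -/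

/-- A horizontal vector with prescribed products with two vectors. -/
lemma exists_horizontal (hcr : cross w₁ w₂ ≠ 0) (α β : ℝ) :
    ∃ s : Mink, s 2 = 0 ∧ dot s w₁ = α ∧ dot s w₂ = β := by
  refine ⟨![(α * w₂ 1 - β * w₁ 1) / cross w₁ w₂, (β * w₁ 0 - α * w₂ 0) / cross w₁ w₂, 0],
    by simp, ?_, ?_⟩
  · simp [dot]; field_simp; simp only [cross]; ring
  · simp [dot]; field_simp; simp only [cross]; ring

lemma transl_vertexCocycle_elX (h : IsHyperidealTriangle (dirI w₁ w₂ θ)) (q : Fin 3 → Mink) :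
    transl (resCocycle (surfaceGroup_le w₁ w₂) (vertexCocycle h q)) (gX w₁ w₂)
      = (spine w₁).1 (q 2 - iota₀.1 (q 2)) + (q 0 - (spine w₁).1 (q 0)) := by
  have v0 := transl_vertexCocycle h q 0 ⟨spine w₁, spine_mem_left w₁ w₂⟩ rfl
  have v2 := transl_vertexCocycle h q 2 ⟨iota₀, iota₀_mem w₁ w₂⟩ rfl
  have e := transl_mul (vertexCocycle h q) ⟨spine w₁, spine_mem_left w₁ w₂⟩
    ⟨iota₀, iota₀_mem w₁ w₂⟩
  rw [v0, v2] at e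
  rw [transl_resCocycle]
  exact e

lemma transl_vertexCocycle_elY (h : IsHyperidealTriangle (dirI w₁ w₂ θ)) (q : Fin 3 → Mink) :
    transl (resCocycle (surfaceGroup_le w₁ w₂) (vertexCocycle h q)) (gY w₁ w₂)
      = iota₀.1 (q 1 - (spine w₂).1 (q 1)) + (q 2 - iota₀.1 (q 2)) := by
  have v1 := transl_vertexCocycle h q 1 ⟨spine w₂, spine_mem_right w₁ w₂⟩ rfl
  have v2 := transl_vertexCocycle h q 2 ⟨iota₀, iota₀_mem w₁ w₂⟩ rfl
  have e := transl_mul (vertexCocycle h q) ⟨iota₀, iota₀_mem w₁ w₂⟩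
    ⟨spine w₂, spine_mem_right w₁ w₂⟩
  rw [v1, v2] at e
  rw [transl_resCocycle]
  exact e

/-- The translational parts of `X` and `Y` may be prescribed by a choice of vertices: that of `ι₀`
solves two linear equations in the plane, and the others are then determined. -/
lemma exists_vertices (h : IsHyperidealTriangle (dirI w₁ w₂ θ)) (x y : Mink) :
    ∃ q : Fin 3 → Mink, (spine w₁).1 (q 2 - iota₀.1 (q 2)) + (q 0 - (spine w₁).1 (q 0)) = x ∧
      iota₀.1 (q 1 - (spine w₂).1 (q 1)) + (q 2 - iota₀.1 (q 2)) = y := by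
  obtain ⟨h12, h1, h2⟩ := ultra_of_dirI h
  have hcr : cross w₁ w₂ ≠ 0 := by
    rcases order_dichotomy h12 h1 h2 with h | h
    exacts [h.1.ne', h.1.ne]
  obtain ⟨s, s2, s1w, s2w⟩ := exists_horizontal hcr (dot x w₁) (-dot (iota₀.1 y) w₂)
  have hs : iota₀.1 s = -s := spine_apply_of_dot_eq_zero (by rw [dot_p₀, s2, neg_zero])
  have hX : (spine w₁).1 (x - (spine w₁).1 s) = -(x - (spine w₁).1 s) := by
    apply spine_apply_of_dot_eq_zero
    rw [dot_sub_left, spine_apply, dot_add_left, dot_neg_left, dot_smul_left, h1.unit_left, s1w]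
    ring
  have hY : (spine w₂).1 (iota₀.1 (y - s)) = -iota₀.1 (y - s) := by
    apply spine_apply_of_dot_eq_zero
    rw [map_sub, hs, dot_sub_left, dot_neg_left, s2w]; ring
  refine ⟨![(2⁻¹ : ℝ) • (x - (spine w₁).1 s), (2⁻¹ : ℝ) • iota₀.1 (y - s), (2⁻¹ : ℝ) • s],
    ?_, ?_⟩
  · simp only [Matrix.cons_val_zero, Matrix.cons_val, map_smul, hX, hs, map_sub, map_neg]
    module
  · simp only [Matrix.cons_val_one, Matrix.cons_val_zero, Matrix.cons_val, map_smul, hY, hs]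
    simp only [map_sub, map_neg, map_smul, iota₀_iota₀, hs]
    module

/-- Every deformation of the surface group extends to the Coxeter group. -/
lemma vertexClass_surjective (h : IsHyperidealTriangle (dirI w₁ w₂ θ)) :
    Function.Surjective (vertexClass h) := by
  intro c
  obtain ⟨u, rfl⟩ := H1π_surjective _ c
  obtain ⟨q, hX, hY⟩ := exists_vertices h (transl u (gX w₁ w₂)) (transl u (gY w₁ w₂))
  refine ⟨q, ?_⟩
  have e : resCocycle (surfaceGroup_le w₁ w₂) (vertexCocycle h q) = u := by
    refine cocycle_ext (S := {elX w₁, elY w₂}) rfl ?_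
    rintro ⟨g, hg'⟩ (rfl | rfl)
    · exact (transl_vertexCocycle_elX h q).trans hX
    · exact (transl_vertexCocycle_elY h q).trans hY
  exact (vertexClass_apply h q).trans (congrArg _ e)

/-! ### Classes of crooked fundamental domains -/

lemma mem_domainClasses_iff {r : Fin 3 → O21} {d : Fin 3 → Mink}
    (hgen : Subgroup.closure (Set.range r) = coxeterGroup w₁ w₂)
    (hinv : ∀ i x, (r i).1 ((r i).1 x) = x) (hd : ∀ i j, i ≠ j → Ultra (d i) (d j))
    (hlin : ∀ i, ((r i).1 (d i) = d i ∧ (r i).1 (nullPlus (d i)) = -nullPlus (d i) ∧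
        (r i).1 (nullMinus (d i)) = -nullMinus (d i)) ∨
      ((r i).1 (d i) = -d i ∧ (r i).1 (nullPlus (d i)) = nullMinus (d i) ∧
        (r i).1 (nullMinus (d i)) = nullPlus (d i)))
    {c : H1 (minkRep (surfaceGroup w₁ w₂))} :
    c ∈ domainClasses w₁ w₂ r d ↔
      ∃ (u : cocycles₁ (minkRep (coxeterGroup w₁ w₂))) (q : Fin 3 → Mink),
        (H1π (minkRep (surfaceGroup w₁ w₂))).hom (resCocycle (surfaceGroup_le w₁ w₂) u) = c ∧
        (∃ o, ∀ i, q i - o ∈ stemQuadrant (d i)) ∧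
        ∀ i (g : coxeterGroup w₁ w₂), g.1 = r i → transl u g = q i - g.1.1 (q i) := by
  have hunit : ∀ i, dot (d i) (d i) = 1 := fun i =>
    (hd i (i + 1) (by fin_cases i <;> decide)).unit_left
  have hfix : ∀ (u : cocycles₁ (minkRep (coxeterGroup w₁ w₂))) (q : Fin 3 → Mink) (i : Fin 3)
      (g : coxeterGroup w₁ w₂), g.1 = r i →
      (affAct u g '' crookedPlane (d i) (q i) = crookedPlane (d i) (q i) ↔
        transl u g = q i - g.1.1 (q i)) := by
    intro u q i g hg
    have := image_crookedPlane_eq_iff (g := g.1) (t := transl u g) (p := q i) (hunit i)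
      (by rw [hg]; exact hinv i) (by rw [hg]; exact hlin i)
    rw [eq_sub_iff_add_eq, add_comm, ← this]
    rfl
  constructor
  · rintro ⟨u, u', rfl, hu, q, hq⟩
    have e : resCocycle (surfaceGroup_le w₁ w₂) u' = u := transl_ext fun g =>
      (transl_resCocycle _ u' g).trans (hu g ⟨g.1, surfaceGroup_le w₁ w₂ g.2⟩ rfl).symm
    exact ⟨u', q, by rw [e], hq.stem, fun i g hg => (hfix u' q i g hg).1 (hq.preserved i g hg)⟩
  · rintro ⟨u, q, hc, ⟨o, ho⟩, hu⟩
    refine ⟨resCocycle (surfaceGroup_le w₁ w₂) u, u, hc, ?_, q, hgen, ⟨o, ho⟩,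
      fun i j hij => (hd i j hij).disjoint_crookedPlane (ho i) (ho j),
      fun i g hg => (hfix u q i g hg).2 (hu i g hg)⟩
    intro g g' hg
    have e : (⟨g.1, surfaceGroup_le w₁ w₂ g.2⟩ : coxeterGroup w₁ w₂) = g' := Subtype.ext hg
    rw [transl_resCocycle, e]

lemma vertexClass_sub_const (h : IsHyperidealTriangle (dirI w₁ w₂ θ)) (q : Fin 3 → Mink)
    (o : Mink) : vertexClass h (fun i => q i - o) = vertexClass h q := by
  have e : (fun i => q i - o) = q - fun _ => o := rfl
  rw [e, map_sub, vertexClass_const, sub_zero]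

/-- The domains linearizing to the given triangle: the vertices range over the stem quadrants. -/
lemma mem_domainClasses_dirI (h : IsHyperidealTriangle (dirI w₁ w₂ θ))
    {c : H1 (minkRep (surfaceGroup w₁ w₂))} :
    c ∈ domainClasses w₁ w₂ ![spine w₁, spine w₂, iota₀] (dirI w₁ w₂ θ) ↔
      ∃ q : Fin 3 → Mink, (∀ i, q i ∈ stemQuadrant (dirI w₁ w₂ θ i)) ∧ vertexClass h q = c := by
  have hd := (isHyperidealTriangle_iff _).1 h
  obtain ⟨-, h1, h2⟩ := ultra_of_dirI h
  rw [mem_domainClasses_iff (closure_range_generators w₁ w₂)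
    (by intro i x; fin_cases i <;> exact spine_spine _ _) hd
    (by
      intro i; fin_cases i
      exacts [Or.inl (spine_linear_part h1.unit_left), Or.inl (spine_linear_part h2.unit_left),
        Or.inr (iota₀_linear_part θ)])]
  constructor
  · rintro ⟨u, q, rfl, ⟨o, ho⟩, hu⟩
    refine ⟨fun i => q i - o, ho, ?_⟩
    obtain rfl := eq_vertexCocycle h hu
    exact (vertexClass_sub_const h q o).trans (vertexClass_apply h q)
  · rintro ⟨q, hq, rfl⟩
    exact ⟨vertexCocycle h q, q, (vertexClass_apply h q).symm, ⟨0, by simpa using hq⟩,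
      transl_vertexCocycle h q⟩

lemma transl_of_conj {Γ : Subgroup O21} {u : cocycles₁ (minkRep Γ)} {ι k : Γ} {x y z : Mink}
    (hx : transl u ι = x - ι.1.1 x) (hy : transl u k = y - k.1.1 y)
    (hz : ι.1.1 y + x - ι.1.1 x = z) {s : O21} (hι : ι.1 = iota₀) (hk : k.1 = s)
    (g : Γ) (hg : g.1 = iota₀ * s * iota₀) : transl u g = z - g.1.1 z := by
  have e : g = ι * k * ι := Subtype.ext (by rw [hg, ← hι, ← hk]; rfl)
  subst hz
  rw [e]
  exact transl_conj u (by rw [hι]; exact iota₀_iota₀) hx hy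

/-- The domains linearizing to the flipped triangle. The involution `ι₀ R_Y ι₀` fixes `q 1` exactly
when `R_Y` fixes the image of `q 1` under the affine involution over `ι₀`. -/
lemma mem_domainClasses_dirII (h : IsHyperidealTriangle (dirI w₁ w₂ θ)) {θ' : ℝ}
    (h' : IsHyperidealTriangle (dirII w₁ w₂ θ')) {c : H1 (minkRep (surfaceGroup w₁ w₂))} :
    c ∈ domainClasses w₁ w₂ ![spine w₁, iota₀ * spine w₂ * iota₀, iota₀] (dirII w₁ w₂ θ') ↔
      ∃ q : Fin 3 → Mink, (∀ i, q i ∈ stemQuadrant (dirII w₁ w₂ θ' i)) ∧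
        vertexClass h ![q 0, iota₀.1 (q 1) + q 2 - iota₀.1 (q 2), q 2] = c := by
  have hd := (isHyperidealTriangle_iff _).1 h'
  have u1 : dot w₁ w₁ = 1 := h'.unit 0
  have u2 : dot (iota₀.1 w₂) (iota₀.1 w₂) = 1 := h'.unit 1
  rw [mem_domainClasses_iff (closure_range_generators_flip w₁ w₂)
    (by
      intro i x; fin_cases i
      · exact spine_spine _ _
      · change (iota₀ * spine w₂ * iota₀).1 ((iota₀ * spine w₂ * iota₀).1 x) = x
        rw [← spine_iota₀]; exact spine_spine _ _
      · exact spine_spine _ _) hd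
    (by
      intro i; fin_cases i
      · exact Or.inl (spine_linear_part u1)
      · change ((iota₀ * spine w₂ * iota₀).1 (iota₀.1 w₂) = iota₀.1 w₂ ∧
          (iota₀ * spine w₂ * iota₀).1 (nullPlus (iota₀.1 w₂)) = -nullPlus (iota₀.1 w₂) ∧
          (iota₀ * spine w₂ * iota₀).1 (nullMinus (iota₀.1 w₂)) = -nullMinus (iota₀.1 w₂)) ∨ _
        rw [← spine_iota₀]
        exact Or.inl (spine_linear_part u2)
      · exact Or.inr (iota₀_linear_part θ'))]
  set ι : coxeterGroup w₁ w₂ := ⟨iota₀, iota₀_mem w₁ w₂⟩ with hι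
  constructor
  · rintro ⟨u, q, rfl, ⟨o, ho⟩, hu⟩
    refine ⟨fun i => q i - o, ho, ?_⟩
    have e : ![q 0 - o, iota₀.1 (q 1 - o) + (q 2 - o) - iota₀.1 (q 2 - o), q 2 - o]
        = fun i => ![q 0, iota₀.1 (q 1) + q 2 - iota₀.1 (q 2), q 2] i - o := by
      ext1 i
      fin_cases i
      · rfl
      · simp only [map_sub, Fin.mk_one, Matrix.cons_val_one, Matrix.cons_val_zero]; abel
      · rfl
    have eu : u = vertexCocycle h ![q 0, iota₀.1 (q 1) + q 2 - iota₀.1 (q 2), q 2] := by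
      refine eq_vertexCocycle h fun i g hg => ?_
      fin_cases i
      · exact hu 0 g hg
      · -- `R_Y` is the conjugate by `ι₀` of `ι₀ R_Y ι₀`
        have e2 : g = ι * (ι * ⟨spine w₂, spine_mem_right w₁ w₂⟩ * ι) * ι := by
          have hιι : ι * ι = 1 := Subtype.ext (spine_mul_self _)
          have : g = ⟨spine w₂, spine_mem_right w₁ w₂⟩ := Subtype.ext hg
          rw [this, show ∀ k, ι * (ι * k * ι) * ι = (ι * ι) * k * (ι * ι) from fun k => by group,
            hιι, one_mul, mul_one]
        rw [e2]
        exact transl_conj u iota₀_iota₀ (hu 2 ι rfl) (hu 1 _ rfl)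
      · exact hu 2 g hg
    subst eu
    exact (congrArg (vertexClass h) e).trans
      ((vertexClass_sub_const h _ o).trans (vertexClass_apply h _))
  · rintro ⟨q, hq, rfl⟩
    refine ⟨vertexCocycle h ![q 0, iota₀.1 (q 1) + q 2 - iota₀.1 (q 2), q 2], q,
      (vertexClass_apply h _).symm, ⟨0, by simpa using hq⟩, fun i g hg => ?_⟩
    have t0 := transl_vertexCocycle h ![q 0, iota₀.1 (q 1) + q 2 - iota₀.1 (q 2), q 2]
    fin_cases i
    · exact t0 0 g hg
    · exact transl_of_conj (t0 2 ι rfl) (t0 1 ⟨spine w₂, spine_mem_right w₁ w₂⟩ rfl) (by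
        simp only [Matrix.cons_val_one, Matrix.cons_val_zero, Matrix.cons_val, map_add, map_sub,
          hι, iota₀_iota₀]; abel) rfl rfl g hg
    · exact t0 2 g hg

end Classes

/-! ### Convex polygons in a projective plane -/

section Polygon

variable {W : Type*} [AddCommGroup W] [Module ℝ W]

lemma projImage_union (S T : Set W) : projImage S ∪ projImage T = projImage (S ∪ T) := by
  ext p
  constructor
  · rintro (⟨c, hc, h, e⟩ | ⟨c, hc, h, e⟩)
    · exact ⟨c, hc, Or.inl h, e⟩
    · exact ⟨c, hc, Or.inr h, e⟩
  · rintro ⟨c, hc, h | h, e⟩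
    · exact Or.inl ⟨c, hc, h, e⟩
    · exact Or.inr ⟨c, hc, h, e⟩

/-- A set of vectors and its negative have the same projective classes. -/
lemma projImage_or_neg (S : Set W) : projImage {c | c ∈ S ∨ -c ∈ S} = projImage S := by
  ext p
  constructor
  · rintro ⟨c, hc, h | h, e⟩
    · exact ⟨c, hc, h, e⟩
    · refine ⟨-c, neg_ne_zero.2 hc, h, ?_⟩
      rw [← e, Projectivization.mk_eq_mk_iff']
      exact ⟨-1, by simp⟩
  · rintro ⟨c, hc, h, e⟩
    exact ⟨c, hc, Or.inl h, e⟩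

/-- The open convex cone spanned by finitely many vectors. -/
def openCone {n : ℕ} (v : Fin n → W) : Set W :=
  {c | ∃ a : Fin n → ℝ, (∀ i, 0 < a i) ∧ c = ∑ i, a i • v i}

lemma mem_openCone_four {a b c d x : W} : x ∈ openCone ![a, b, c, d] ↔
    ∃ t₁ t₂ t₃ t₄ : ℝ, 0 < t₁ ∧ 0 < t₂ ∧ 0 < t₃ ∧ 0 < t₄ ∧
      x = t₁ • a + t₂ • b + t₃ • c + t₄ • d := by
  constructor
  · rintro ⟨t, ht, rfl⟩
    exact ⟨t 0, t 1, t 2, t 3, ht _, ht _, ht _, ht _, by simp [Fin.sum_univ_four]⟩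
  · rintro ⟨t₁, t₂, t₃, t₄, h₁, h₂, h₃, h₄, rfl⟩
    exact ⟨![t₁, t₂, t₃, t₄], by simp [Fin.forall_fin_succ, h₁, h₂, h₃, h₄],
      by simp [Fin.sum_univ_four]⟩

lemma mem_openCone_five {a b c d e x : W} : x ∈ openCone ![a, b, c, d, e] ↔
    ∃ t₁ t₂ t₃ t₄ t₅ : ℝ, 0 < t₁ ∧ 0 < t₂ ∧ 0 < t₃ ∧ 0 < t₄ ∧ 0 < t₅ ∧
      x = t₁ • a + t₂ • b + t₃ • c + t₄ • d + t₅ • e := by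
  constructor
  · rintro ⟨t, ht, rfl⟩
    exact ⟨t 0, t 1, t 2, t 3, t 4, ht _, ht _, ht _, ht _, ht _, by simp [Fin.sum_univ_five]⟩
  · rintro ⟨t₁, t₂, t₃, t₄, t₅, h₁, h₂, h₃, h₄, h₅, rfl⟩
    exact ⟨![t₁, t₂, t₃, t₄, t₅], by simp [Fin.forall_fin_succ, h₁, h₂, h₃, h₄, h₅],
      by simp [Fin.sum_univ_five]⟩

lemma mem_openCone_six {a b c d e f x : W} : x ∈ openCone ![a, b, c, d, e, f] ↔
    ∃ t₁ t₂ t₃ t₄ t₅ t₆ : ℝ, 0 < t₁ ∧ 0 < t₂ ∧ 0 < t₃ ∧ 0 < t₄ ∧ 0 < t₅ ∧ 0 < t₆ ∧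
      x = t₁ • a + t₂ • b + t₃ • c + t₄ • d + t₅ • e + t₆ • f := by
  constructor
  · rintro ⟨t, ht, rfl⟩
    exact ⟨t 0, t 1, t 2, t 3, t 4, t 5, ht _, ht _, ht _, ht _, ht _, ht _,
      by simp [Fin.sum_univ_six]⟩
  · rintro ⟨t₁, t₂, t₃, t₄, t₅, t₆, h₁, h₂, h₃, h₄, h₅, h₆, rfl⟩
    exact ⟨![t₁, t₂, t₃, t₄, t₅, t₆], by simp [Fin.forall_fin_succ, h₁, h₂, h₃, h₄, h₅, h₆],
      by simp [Fin.sum_univ_six]⟩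

/-- Six vectors of a three-dimensional space in hexagonal position, in the cyclic order
`h₀, a, b, h₃, c, d`: the points `a, b, c, d` form a quadrilateral with diagonals `ac` and `bd`
(the vectors being scaled so that `a + c = b + d`), `h₀` lies beyond its side `da` and `h₃` beyond
its side `bc`. The inequalities on the coefficients say that `h₀` and `h₃` stay inside the other
sides. -/
structure HexagonData (a b c d h₀ h₃ : W) (A B C A' B' C' : ℝ) : Prop where
  finrank : Module.finrank ℝ W = 3
  indep : LinearIndependent ℝ ![a, b, d]
  rel : c = b + d - a
  eq₀ : h₀ = A • d + B • a - C • b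
  eq₃ : h₃ = A' • b + B' • c - C' • d
  A_pos : 0 < A
  C_pos : 0 < C
  C_lt_B : C < B
  A'_pos : 0 < A'
  C'_pos : 0 < C'
  C'_lt_B' : C' < B'

namespace HexagonData

variable {a b c d h₀ h₃ : W} {A B C A' B' C' : ℝ}

/-- The configuration is symmetric under the rotation of the hexagon by three steps. -/
lemma rotate (H : HexagonData a b c d h₀ h₃ A B C A' B' C') :
    HexagonData c d a b h₃ h₀ A' B' C' A B C where
  finrank := H.finrank
  indep := by
    rw [Fintype.linearIndependent_iff]
    intro g hg
    have h := Fintype.linearIndependent_iff.1 H.indep ![-g 0, g 0 + g 2, g 0 + g 1] (by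
      simp only [Fin.sum_univ_three, Matrix.cons_val_zero, Matrix.cons_val_one,
        Matrix.cons_val, H.rel] at hg ⊢
      rw [← hg]; module)
    have h0 := h 0
    have h1 := h 1
    have h2 := h 2
    simp at h0 h1 h2
    intro i
    fin_cases i
    · simpa using h0
    · simp; linarith
    · simp; linarith
  rel := by rw [H.rel]; abel
  eq₀ := H.eq₃
  eq₃ := H.eq₀
  A_pos := H.A'_pos
  C_pos := H.C'_pos
  C_lt_B := H.C'_lt_B'
  A'_pos := H.A_pos
  C'_pos := H.C_pos
  C'_lt_B' := H.C_lt_B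

/-- Functionals with prescribed values on the basis `a, b, d`. -/
lemma exists_functional (H : HexagonData a b c d h₀ h₃ A B C A' B' C') (x y z : ℝ) :
    ∃ f : W →ₗ[ℝ] ℝ, f a = x ∧ f b = y ∧ f d = z ∧ f c = y + z - x ∧
      f h₀ = A * z + B * x - C * y ∧ f h₃ = A' * y + B' * (y + z - x) - C' * z := by
  let β := basisOfLinearIndependentOfCardEqFinrank H.indep (by simp [H.finrank])
  let f := β.constr ℝ ![x, y, z]
  have hβ : ⇑β = ![a, b, d] := coe_basisOfLinearIndependentOfCardEqFinrank _ _
  have ha : f a = x := by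
    have := β.constr_basis ℝ ![x, y, z] 0
    rwa [hβ] at this
  have hb : f b = y := by
    have := β.constr_basis ℝ ![x, y, z] 1
    rwa [hβ] at this
  have hd : f d = z := by
    have := β.constr_basis ℝ ![x, y, z] 2
    rwa [hβ] at this
  have hc : f c = y + z - x := by rw [H.rel, map_sub, map_add, ha, hb, hd]
  refine ⟨f, ha, hb, hd, hc, ?_, ?_⟩
  · rw [H.eq₀]; simp [ha, hb, hd]
  · rw [H.eq₃]; simp [hb, hc, hd]

lemma isConvexPolygon_hexagon (H : HexagonData a b c d h₀ h₃ A B C A' B' C') :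
    IsConvexPolygon ![h₀, a, b, h₃, c, d] (projImage (openCone ![h₀, a, b, h₃, c, d])) := by
  have hA := H.A_pos
  have hC := H.C_pos
  have hB := H.C_lt_B
  have hA' := H.A'_pos
  have hC' := H.C'_pos
  have hB' := H.C'_lt_B'
  refine ⟨by norm_num, H.finrank, fun i => ?_, rfl⟩
  have p1 := mul_pos hA' hA
  have p2 := mul_pos hA (hC'.trans hB')
  have p3 := mul_pos hC (sub_pos.2 hB')
  have p4 := mul_pos hC' (sub_pos.2 hB)
  have p5 := mul_pos hA' (hC.trans hB)
  have p6 := mul_pos (hC.trans hB) (sub_pos.2 hB')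
  have p7 := mul_pos (hC'.trans hB') (sub_pos.2 hB)
  fin_cases i
  · obtain ⟨f, e⟩ := H.exists_functional 0 A C
    refine ⟨f, ?_, ?_, fun j => ?_⟩
    rotate_left 2
    · fin_cases j <;> simp [e] <;> nlinarith
    all_goals simp [e] <;> ring
  · obtain ⟨f, e⟩ := H.exists_functional 0 0 1
    refine ⟨f, ?_, ?_, fun j => ?_⟩
    rotate_left 2
    · fin_cases j <;> simp [e] <;> nlinarith
    all_goals simp [e]
  · obtain ⟨f, e⟩ := H.exists_functional (B' - C') 0 B'
    refine ⟨f, ?_, ?_, fun j => ?_⟩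
    rotate_left 2
    · fin_cases j <;> simp [e] <;> nlinarith
    all_goals simp [e] <;> ring
  · obtain ⟨f, e⟩ := H.exists_functional (A' + C') C' A'
    refine ⟨f, ?_, ?_, fun j => ?_⟩
    rotate_left 2
    · fin_cases j <;> simp [e] <;> nlinarith
    all_goals (simp [e]; ring)
  · obtain ⟨f, e⟩ := H.exists_functional 1 1 0
    refine ⟨f, ?_, ?_, fun j => ?_⟩
    rotate_left 2
    · fin_cases j <;> simp [e] <;> nlinarith
    all_goals simp [e]
  · obtain ⟨f, e⟩ := H.exists_functional C B 0
    refine ⟨f, ?_, ?_, fun j => ?_⟩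
    rotate_left 2
    · fin_cases j <;> simp [e] <;> nlinarith
    all_goals simp [e] <;> ring

lemma isConvexPolygon_pentagon₁ (H : HexagonData a b c d h₀ h₃ A B C A' B' C') :
    IsConvexPolygon ![h₀, a, b, c, d] (projImage (openCone ![h₀, a, b, c, d])) := by
  have hA := H.A_pos
  have hC := H.C_pos
  have hB := H.C_lt_B
  refine ⟨by norm_num, H.finrank, fun i => ?_, rfl⟩
  fin_cases i
  · obtain ⟨f, e⟩ := H.exists_functional 0 A C
    refine ⟨f, ?_, ?_, fun j => ?_⟩
    rotate_left 2
    · fin_cases j <;> simp [e] <;> nlinarith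
    all_goals simp [e] <;> ring
  · obtain ⟨f, e⟩ := H.exists_functional 0 0 1
    refine ⟨f, ?_, ?_, fun j => ?_⟩
    rotate_left 2
    · fin_cases j <;> (simp [e]; try nlinarith)
    all_goals simp [e]
  · obtain ⟨f, e⟩ := H.exists_functional 1 0 1
    refine ⟨f, ?_, ?_, fun j => ?_⟩
    rotate_left 2
    · fin_cases j <;> (simp [e]; try nlinarith)
    all_goals simp [e]
  · obtain ⟨f, e⟩ := H.exists_functional 1 1 0
    refine ⟨f, ?_, ?_, fun j => ?_⟩
    rotate_left 2
    · fin_cases j <;> (simp [e]; try nlinarith)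
    all_goals simp [e]
  · obtain ⟨f, e⟩ := H.exists_functional C B 0
    refine ⟨f, ?_, ?_, fun j => ?_⟩
    rotate_left 2
    · fin_cases j <;> simp [e] <;> nlinarith
    all_goals simp [e] <;> ring

lemma isConvexPolygon_pentagon₂ (H : HexagonData a b c d h₀ h₃ A B C A' B' C') :
    IsConvexPolygon ![a, b, h₃, c, d] (projImage (openCone ![a, b, h₃, c, d])) := by
  have hA' := H.A'_pos
  have hC' := H.C'_pos
  have hB' := H.C'_lt_B'
  refine ⟨by norm_num, H.finrank, fun i => ?_, rfl⟩
  fin_cases i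
  · obtain ⟨f, e⟩ := H.exists_functional 0 0 1
    refine ⟨f, ?_, ?_, fun j => ?_⟩
    rotate_left 2
    · fin_cases j <;> (simp [e]; try nlinarith)
    all_goals simp [e]
  · obtain ⟨f, e⟩ := H.exists_functional (B' - C') 0 B'
    refine ⟨f, ?_, ?_, fun j => ?_⟩
    rotate_left 2
    · fin_cases j <;> simp [e] <;> nlinarith
    all_goals simp [e] <;> ring
  · obtain ⟨f, e⟩ := H.exists_functional (A' + C') C' A'
    refine ⟨f, ?_, ?_, fun j => ?_⟩
    rotate_left 2
    · fin_cases j <;> simp [e] <;> nlinarith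
    all_goals (simp [e]; ring)
  · obtain ⟨f, e⟩ := H.exists_functional 1 1 0
    refine ⟨f, ?_, ?_, fun j => ?_⟩
    rotate_left 2
    · fin_cases j <;> (simp [e]; try nlinarith)
    all_goals simp [e]
  · obtain ⟨f, e⟩ := H.exists_functional 0 1 0
    refine ⟨f, ?_, ?_, fun j => ?_⟩
    rotate_left 2
    · fin_cases j <;> (simp [e]; try nlinarith)
    all_goals simp [e]

/-- A pentagon is contained in the hexagon: a small multiple of `h₃` is traded for `b, c, d`. -/
lemma pentagon₁_subset (H : HexagonData a b c d h₀ h₃ A B C A' B' C') :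
    openCone ![h₀, a, b, c, d] ⊆ openCone ![h₀, a, b, h₃, c, d] := by
  intro x hx
  obtain ⟨t₀, t₁, t₂, t₄, t₅, p₀, p₁, p₂, p₄, p₅, rfl⟩ := mem_openCone_five.1 hx
  have hA' := H.A'_pos
  have hB' := H.C'_pos.trans H.C'_lt_B'
  have hC' := H.C'_pos
  obtain ⟨ε, ε0, hε⟩ := exists_between (lt_min (div_pos p₂ hA') (div_pos p₄ hB'))
  have e1 := (lt_div_iff₀ hA').1 (hε.trans_le (min_le_left _ _))
  have e2 := (lt_div_iff₀ hB').1 (hε.trans_le (min_le_right _ _))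
  refine mem_openCone_six.2 ⟨t₀, t₁, t₂ - ε * A', ε, t₄ - ε * B', t₅ + ε * C', p₀, p₁,
    by linarith, ε0, by linarith, by positivity, ?_⟩
  rw [H.eq₃]; module

lemma pentagon₂_subset (H : HexagonData a b c d h₀ h₃ A B C A' B' C') :
    openCone ![a, b, h₃, c, d] ⊆ openCone ![h₀, a, b, h₃, c, d] := by
  intro x hx
  obtain ⟨t₁, t₂, t₃, t₄, t₅, p₁, p₂, p₃, p₄, p₅, rfl⟩ := mem_openCone_five.1 hx
  have : t₃ • h₃ + t₄ • c + t₅ • d + t₁ • a + t₂ • b ∈ openCone ![h₃, c, d, h₀, a, b] :=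
    H.rotate.pentagon₁_subset (mem_openCone_five.2 ⟨t₃, t₄, t₅, t₁, t₂, p₃, p₄, p₅, p₁, p₂, rfl⟩)
  obtain ⟨s₃, s₄, s₅, s₀, s₁, s₂, q₃, q₄, q₅, q₀, q₁, q₂, e⟩ := mem_openCone_six.1 this
  refine mem_openCone_six.2 ⟨s₀, s₁, s₂, s₃, s₄, s₅, q₀, q₁, q₂, q₃, q₄, q₅, ?_⟩
  rw [show t₁ • a + t₂ • b + t₃ • h₃ + t₄ • c + t₅ • d
    = t₃ • h₃ + t₄ • c + t₅ • d + t₁ • a + t₂ • b by abel, e]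
  abel

/-- A point of the hexagon whose `h₀`-coefficient suffices to absorb the defect caused by
eliminating `h₃` lies in the first pentagon. -/
lemma mem_pentagon₁ (H : HexagonData a b c d h₀ h₃ A B C A' B' C')
    {t₀ t₁ t₂ t₃ t₄ t₅ : ℝ} (p₀ : 0 < t₀) (p₁ : 0 < t₁) (p₂ : 0 < t₂) (p₃ : 0 < t₃) (p₄ : 0 < t₄)
    (p₅ : 0 < t₅) (h : t₃ * C' - t₅ - t₁ < t₀ * (A + B)) :
    t₀ • h₀ + t₁ • a + t₂ • b + t₃ • h₃ + t₄ • c + t₅ • d ∈ openCone ![h₀, a, b, c, d] := by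
  have hA := H.A_pos
  have hC := H.C_pos
  have hB := hC.trans H.C_lt_B
  have hA' := H.A'_pos
  have hC' := H.C'_pos
  have hB' := hC'.trans H.C'_lt_B'
  have hAB : 0 < A + B := by linarith
  -- `s` is the part of the coefficient of `h₀` that is expanded, `l` the multiple of the relation
  -- `b + d - a - c = 0` that is added
  obtain ⟨s, hs1, hs2⟩ : ∃ s, max 0 ((t₃ * C' - t₅ - t₁) / (A + B)) < s ∧
      s < min t₀ ((t₂ + t₄ + t₃ * (A' + B')) / C) := by
    refine exists_between (max_lt (lt_min p₀ (by positivity)) (lt_min ?_ ?_))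
    · rwa [div_lt_iff₀ hAB]
    · rw [div_lt_div_iff₀ hAB hC]
      have : t₃ * C' * C < t₃ * B' * (A + B) := by
        have h1 : C' * C < B' * (A + B) :=
          mul_lt_mul'' H.C'_lt_B' (by linarith [H.C_lt_B]) hC'.le hC.le
        nlinarith
      have h2 : 0 < (t₂ + t₄ + t₃ * A') * (A + B) := by positivity
      have h3 : 0 < (t₅ + t₁) * C := by positivity
      nlinarith
  have s0 : 0 < s := (le_max_left _ _).trans_lt hs1
  have s1 := (div_lt_iff₀ hAB).1 ((le_max_right _ _).trans_lt hs1)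
  have s2 : s < t₀ := hs2.trans_le (min_le_left _ _)
  have s3 := (lt_div_iff₀ hC).1 (hs2.trans_le (min_le_right _ _))
  have q1 := mul_pos s0 hA
  have q2 := mul_pos s0 (sub_pos.2 H.C_lt_B)
  have q3 := mul_pos p₃ hA'
  have q4 := mul_pos p₃ (sub_pos.2 H.C'_lt_B')
  obtain ⟨l, l1, l2⟩ : ∃ l, max (s * C - t₂ - t₃ * A') (t₃ * C' - t₅ - s * A) < l ∧
      l < min (t₁ + s * B) (t₄ + t₃ * B') := by
    refine exists_between (max_lt (lt_min ?_ ?_) (lt_min ?_ ?_)) <;> nlinarith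
  have l3 := (le_max_left _ _).trans_lt l1
  have l4 := (le_max_right _ _).trans_lt l1
  have l5 := l2.trans_le (min_le_left _ _)
  have l6 := l2.trans_le (min_le_right _ _)
  refine mem_openCone_five.2 ⟨t₀ - s, t₁ + s * B - l, t₂ - s * C + t₃ * A' + l, t₄ + t₃ * B' - l,
    t₅ + s * A - t₃ * C' + l, by linarith, by linarith, by linarith, by linarith, by linarith, ?_⟩
  rw [H.eq₃, H.eq₀, H.rel]; module

/-- The two pentagons cover the hexagon, because the triangles they omit are disjoint. -/
lemma union_eq (H : HexagonData a b c d h₀ h₃ A B C A' B' C') :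
    openCone ![h₀, a, b, c, d] ∪ openCone ![a, b, h₃, c, d]
      = openCone ![h₀, a, b, h₃, c, d] := by
  refine Set.Subset.antisymm (Set.union_subset H.pentagon₁_subset H.pentagon₂_subset) ?_
  intro x hx
  obtain ⟨t₀, t₁, t₂, t₃, t₄, t₅, p₀, p₁, p₂, p₃, p₄, p₅, rfl⟩ := mem_openCone_six.1 hx
  by_cases h : t₃ * C' - t₅ - t₁ < t₀ * (A + B)
  · exact Or.inl (H.mem_pentagon₁ p₀ p₁ p₂ p₃ p₄ p₅ h)
  · right
    push Not at h
    have key : t₀ * C - t₂ - t₄ < t₃ * (A' + B') := by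
      have h1 := mul_pos p₀ H.A_pos
      have h2 := mul_pos p₀ (sub_pos.2 H.C_lt_B)
      have h3 := mul_pos p₃ H.A'_pos
      have h4 := mul_pos p₃ (sub_pos.2 H.C'_lt_B')
      nlinarith
    have := H.rotate.mem_pentagon₁ p₃ p₄ p₅ p₀ p₁ p₂ key
    obtain ⟨s₃, s₄, s₅, s₁, s₂, q₃, q₄, q₅, q₁, q₂, e⟩ := mem_openCone_five.1 this
    refine mem_openCone_five.2 ⟨s₁, s₂, s₃, s₄, s₅, q₁, q₂, q₃, q₄, q₅, ?_⟩
    rw [show t₀ • h₀ + t₁ • a + t₂ • b + t₃ • h₃ + t₄ • c + t₅ • d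
      = t₃ • h₃ + t₄ • c + t₅ • d + t₀ • h₀ + t₁ • a + t₂ • b by abel, e]
    abel

end HexagonData

/-- If four functionals on a three-dimensional space vanish on consecutive sides of `q₀q₁q₂q₃` and
are positive at the other vertices, their common positivity region is the open cone over the
quadrilateral. -/
lemma openCone_eq_of_functionals {q₀ q₁ q₂ q₃ : W} {fA fX fB fY : W →ₗ[ℝ] ℝ}
    (hW : Module.finrank ℝ W = 3)
    (A₀ : fA q₀ = 0) (A₁ : fA q₁ = 0) (A₂ : 0 < fA q₂) (A₃ : 0 < fA q₃)
    (X₁ : fX q₁ = 0) (X₂ : fX q₂ = 0) (X₃ : 0 < fX q₃) (X₀ : 0 < fX q₀)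
    (B₂ : fB q₂ = 0) (B₃ : fB q₃ = 0) (B₀ : 0 < fB q₀) (B₁ : 0 < fB q₁)
    (Y₃ : fY q₃ = 0) (Y₀ : fY q₀ = 0) (Y₁ : 0 < fY q₁) (Y₂ : 0 < fY q₂) :
    {x | 0 < fX x ∧ 0 < fY x ∧ 0 < fA x ∧ 0 < fB x} = openCone ![q₀, q₁, q₂, q₃] := by
  -- a triangle of the quadrilateral is a basis, for triangular evaluation matrices
  have span : ∀ (u v w : W) (f g : W →ₗ[ℝ] ℝ), f v = 0 → f w = 0 → 0 < f u →
      g u = 0 → g v = 0 → 0 < g w → v ≠ 0 →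
      ∀ x, ∃ r : ℝ, x = (f x / f u) • u + r • v + (g x / g w) • w := by
    intro u v w f g f1 f2 f3 g1 g2 g3 hv x
    have li : LinearIndependent ℝ ![u, v, w] := by
      rw [Fintype.linearIndependent_iff]
      intro t ht
      simp only [Fin.sum_univ_three, Matrix.cons_val_zero, Matrix.cons_val_one,
        Matrix.cons_val] at ht
      have t0 : t 0 = 0 := by
        have := congrArg f ht
        simpa [f1, f2, f3.ne'] using this
      have t2 : t 2 = 0 := by
        have := congrArg g ht
        simpa [g1, g2, g3.ne'] using this
      have t1 : t 1 = 0 := by simpa [t0, t2, hv] using ht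
      intro i; fin_cases i <;> assumption
    let β := basisOfLinearIndependentOfCardEqFinrank li (by simp [hW])
    have hβ : ⇑β = ![u, v, w] := coe_basisOfLinearIndependentOfCardEqFinrank _ _
    have hx := (β.sum_repr x).symm
    rw [hβ, Fin.sum_univ_three] at hx
    simp only [Matrix.cons_val_zero, Matrix.cons_val_one, Matrix.cons_val] at hx
    have e0 : f x = β.repr x 0 * f u := by
      conv_lhs => rw [hx]
      simp [f1, f2]
    have e2 : g x = β.repr x 2 * g w := by
      conv_lhs => rw [hx]
      simp [g1, g2]
    refine ⟨β.repr x 1, ?_⟩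
    rw [e0, e2, mul_div_cancel_right₀ _ f3.ne', mul_div_cancel_right₀ _ g3.ne']
    exact hx
  have q1 : q₁ ≠ 0 := by rintro rfl; simp at Y₁
  have q3 : q₃ ≠ 0 := by rintro rfl; simp at A₃
  -- on the closed region, expand in the triangle `q₀q₁q₂` or in the triangle `q₀q₃q₂`
  have closed : ∀ x, 0 ≤ fX x → 0 ≤ fY x → 0 ≤ fA x → 0 ≤ fB x →
      ∃ t₀ t₁ t₂ t₃ : ℝ, 0 ≤ t₀ ∧ 0 ≤ t₁ ∧ 0 ≤ t₂ ∧ 0 ≤ t₃ ∧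
        x = t₀ • q₀ + t₁ • q₁ + t₂ • q₂ + t₃ • q₃ := by
    intro x hX hY hA hB
    obtain ⟨r, hr⟩ := span q₀ q₁ q₂ fX fA X₁ X₂ X₀ A₀ A₁ A₂ q1 x
    obtain ⟨r', hr'⟩ := span q₀ q₃ q₂ fB fY B₃ B₂ B₀ Y₀ Y₃ Y₂ q3 x
    by_cases h : 0 ≤ r
    · exact ⟨_, r, _, 0, div_nonneg hX X₀.le, h, div_nonneg hA A₂.le, le_rfl, by
        rw [zero_smul, add_zero]; exact hr⟩
    · refine ⟨_, 0, _, r', div_nonneg hB B₀.le, le_rfl, div_nonneg hY Y₂.le, ?_, by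
        conv_lhs => rw [hr']
        rw [zero_smul]; abel⟩
      -- comparing the two expansions in a third functional shows that `r` and `r'` are opposite
      have e1 := congrArg fX hr'
      have e2 := congrArg fA hr'
      have e3 := congrArg fB hr
      have e4 := congrArg fY hr
      simp only [map_add, map_smul, smul_eq_mul, X₂, A₀, B₂, Y₀, mul_zero, add_zero, zero_add]
        at e1 e2 e3 e4
      by_contra h'
      push Not at h h'
      have n1 : r * fB q₁ < 0 := mul_neg_of_neg_of_pos h B₁
      have n2 : r' * fX q₃ < 0 := mul_neg_of_neg_of_pos h' X₃
      have e5 : fX x / fX q₀ < fB x / fB q₀ := by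
        have : fX x < fB x / fB q₀ * fX q₀ := by linarith
        exact (div_lt_iff₀ X₀).2 this
      have e6 : fB x / fB q₀ < fX x / fX q₀ := by
        have : fB x < fX x / fX q₀ * fB q₀ := by linarith
        exact (div_lt_iff₀ B₀).2 this
      exact lt_asymm e5 e6
  ext x
  constructor
  · rintro ⟨hX, hY, hA, hB⟩
    -- subtracting a small multiple of the sum of the vertices stays inside the region
    set S := q₀ + q₁ + q₂ + q₃
    have small : ∀ f : W →ₗ[ℝ] ℝ, 0 < f S → 0 < f x →
        ∃ δ > (0 : ℝ), ∀ ε, ε ≤ δ → 0 ≤ f (x - ε • S) := by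
      intro f hS hf
      refine ⟨f x / f S, by positivity, fun ε h => ?_⟩
      rw [map_sub, map_smul, smul_eq_mul, sub_nonneg]
      exact (le_div_iff₀ hS).1 h
    obtain ⟨δ₁, d1, h1⟩ := small fX (by simp only [S, map_add]; linarith) hX
    obtain ⟨δ₂, d2, h2⟩ := small fY (by simp only [S, map_add]; linarith) hY
    obtain ⟨δ₃, d3, h3⟩ := small fA (by simp only [S, map_add]; linarith) hA
    obtain ⟨δ₄, d4, h4⟩ := small fB (by simp only [S, map_add]; linarith) hB
    set ε := min (min δ₁ δ₂) (min δ₃ δ₄)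
    have ε0 : 0 < ε := by positivity
    obtain ⟨t₀, t₁, t₂, t₃, p₀, p₁, p₂, p₃, e⟩ := closed (x - ε • S)
      (h1 _ ((min_le_left _ _).trans (min_le_left _ _)))
      (h2 _ ((min_le_left _ _).trans (min_le_right _ _)))
      (h3 _ ((min_le_right _ _).trans (min_le_left _ _)))
      (h4 _ ((min_le_right _ _).trans (min_le_right _ _)))
    refine mem_openCone_four.2 ⟨t₀ + ε, t₁ + ε, t₂ + ε, t₃ + ε, by positivity, by positivity,
      by positivity, by positivity, ?_⟩
    rw [sub_eq_iff_eq_add.1 e]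
    simp only [S]; module
  · intro hx
    obtain ⟨t₀, t₁, t₂, t₃, p₀, p₁, p₂, p₃, rfl⟩ := mem_openCone_four.1 hx
    simp only [Set.mem_ofPred_eq, map_add, map_smul, smul_eq_mul, A₀, A₁, X₁, X₂, B₂, B₃, Y₃, Y₀,
      mul_zero, add_zero, zero_add]
    exact ⟨by positivity, by positivity, by positivity, by positivity⟩

section OpenSide

variable {a b c d h : W} {x y x' y' : ℝ}

lemma left_mem_openSide (hx : 0 < x) (hx' : 0 < x')
    (D : 0 < x' * y - y' * x) : a ∈ openSide (y • a - x • b) (x' • b - y' • a) := by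
  refine ⟨x' / (x' * y - y' * x), x / (x' * y - y' * x), by positivity, by positivity, ?_⟩
  match_scalars <;> field_simp <;> ring

lemma right_mem_openSide (hy : 0 < y) (hy' : 0 < y')
    (D : 0 < x' * y - y' * x) : b ∈ openSide (y • a - x • b) (x' • b - y' • a) := by
  refine ⟨y' / (x' * y - y' * x), y / (x' * y - y' * x), by positivity, by positivity, ?_⟩
  match_scalars <;> field_simp <;> ring

/-- If a functional with values `x, y, δ, γ` at `a, b, d, c` vanishes at `h`, then `h` lies between
the zeros of the functional on the lines `cd` and `ab`. -/
lemma tilted_mem_openSide {A B C γ δ : ℝ} (hA : 0 < A) (hB : C < B) (hxy : x < y)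
    (e : A * δ + B * x - C * y = 0) (hγ : γ = y + δ - x) (hh : h = A • d + B • a - C • b)
    (hc : c = b + d - a) : h ∈ openSide (γ • d - δ • c) (y • a - x • b) := by
  have hδ : 0 < y - x := sub_pos.2 hxy
  refine ⟨A / (y - x), (B - C) / (y - x), by positivity, div_pos (sub_pos.2 hB) hδ, ?_⟩
  rw [hh, hc, hγ]
  match_scalars <;> field_simp
  · ring
  · linear_combination (-1 : ℝ) * e
  · linear_combination e

end OpenSide

namespace HexagonData

variable {a b c d h₀ h₃ : W} {A B C A' B' C' : ℝ}

/-- The quadrilateral cut out by two lines `fX = 0`, `fY = 0` along the sides `ab`, `cd` of a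
hexagon and two supporting lines `fA = 0`, `fB = 0` through `h₀`, `h₃`. -/
lemma circumscribed (H : HexagonData a b c d h₀ h₃ A B C A' B' C') {fA fX fB fY : W →ₗ[ℝ] ℝ}
    (Aa : 0 < fA a) (Ad : 0 < fA d) (A₀ : fA h₀ = 0)
    (Bb : 0 < fB b) (Bc : 0 < fB c) (B₃ : fB h₃ = 0)
    (Xa : fX a = 0) (Xb : fX b = 0) (Xc : 0 < fX c)
    (Yc : fY c = 0) (Yd : fY d = 0) (Ya : 0 < fY a) :
    ∃ q : Fin 4 → W,
      IsConvexPolygon q (projImage {x | 0 < fX x ∧ 0 < fY x ∧ 0 < fA x ∧ 0 < fB x}) ∧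
      (fA (q 0) = 0 ∧ fA (q 1) = 0) ∧ (fX (q 1) = 0 ∧ fX (q 2) = 0) ∧
      (fB (q 2) = 0 ∧ fB (q 3) = 0) ∧ (fY (q 3) = 0 ∧ fY (q 0) = 0) ∧
      h₀ ∈ openSide (q 0) (q 1) ∧
      a ∈ openSide (q 1) (q 2) ∧ b ∈ openSide (q 1) (q 2) ∧
      h₃ ∈ openSide (q 2) (q 3) ∧
      c ∈ openSide (q 3) (q 0) ∧ d ∈ openSide (q 3) (q 0) := by
  have hA := H.A_pos
  have hC := H.C_pos
  have hB := H.C_lt_B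
  have hA' := H.A'_pos
  have hC' := H.C'_pos
  have hB' := H.C'_lt_B'
  have rel : ∀ f : W →ₗ[ℝ] ℝ, f c = f b + f d - f a := fun f => by rw [H.rel]; simp
  have eA : A * fA d + B * fA a - C * fA b = 0 := by rw [← A₀, H.eq₀]; simp
  have eB : A' * fB b + B' * fB c - C' * fB d = 0 := by rw [← B₃, H.eq₃]; simp
  -- the supporting lines through `h₀` and `h₃` are tilted in opposite directions
  have dA : fA a < fA b := by nlinarith [mul_pos hA Ad, mul_pos Aa (sub_pos.2 hB)]
  have dB : fB c < fB d := by nlinarith [mul_pos hA' Bb, mul_pos Bc (sub_pos.2 hB')]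
  have dA' : fA d < fA c := by linarith [rel fA]
  have dB' : fB b < fB a := by linarith [rel fB]
  have D : 0 < fB a * fA b - fB b * fA a := by
    nlinarith [mul_lt_mul'' dB' dA Bb.le Aa.le]
  have D' : 0 < fB d * fA c - fB c * fA d := by
    nlinarith [mul_lt_mul'' dB dA' Bc.le Ad.le]
  have Xd : fX d = fX c := by linarith [rel fX]
  have Yb : fY b = fY a := by linarith [rel fY]
  have hδ : 0 < fA b - fA a := by linarith
  have hδ' : 0 < fB d - fB c := by linarith
  obtain ⟨q₀, hq₀⟩ : ∃ q, q = fA c • d - fA d • c := ⟨_, rfl⟩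
  obtain ⟨q₁, hq₁⟩ : ∃ q, q = fA b • a - fA a • b := ⟨_, rfl⟩
  obtain ⟨q₂, hq₂⟩ : ∃ q, q = fB a • b - fB b • a := ⟨_, rfl⟩
  obtain ⟨q₃, hq₃⟩ : ∃ q, q = fB d • c - fB c • d := ⟨_, rfl⟩
  have s₀ : h₀ ∈ openSide q₀ q₁ := by
    rw [hq₀, hq₁]; exact tilted_mem_openSide hA hB dA eA (rel fA) H.eq₀ H.rel
  have sa : a ∈ openSide q₁ q₂ := by
    rw [hq₁, hq₂]; exact left_mem_openSide Aa (Bb.trans dB') D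
  have sb : b ∈ openSide q₁ q₂ := by
    rw [hq₁, hq₂]; exact right_mem_openSide (Aa.trans dA) Bb D
  have s₃ : h₃ ∈ openSide q₂ q₃ := by
    rw [hq₂, hq₃]
    exact tilted_mem_openSide hA' hB' dB eB (by linarith [rel fB]) H.eq₃ (by rw [H.rel]; abel)
  have sc : c ∈ openSide q₃ q₀ := by
    rw [hq₃, hq₀]; exact left_mem_openSide Bc (Ad.trans dA') (by linarith)
  have sd : d ∈ openSide q₃ q₀ := by
    rw [hq₃, hq₀]; exact right_mem_openSide (Bc.trans dB) Ad (by linarith)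
  have vA₀ : fA q₀ = 0 := by simp [hq₀]; ring
  have vA₁ : fA q₁ = 0 := by simp [hq₁]; ring
  have vA₂ : 0 < fA q₂ := by simp [hq₂]; linarith
  have vA₃ : 0 < fA q₃ := by simp [hq₃]; linarith
  have vX₁ : fX q₁ = 0 := by simp [hq₁, Xa, Xb]
  have vX₂ : fX q₂ = 0 := by simp [hq₂, Xa, Xb]
  have vX₃ : 0 < fX q₃ := by
    simp only [hq₃, map_sub, map_smul, smul_eq_mul, Xd, ← sub_mul]
    exact mul_pos (sub_pos.2 dB) Xc
  have vX₀ : 0 < fX q₀ := by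
    simp only [hq₀, map_sub, map_smul, smul_eq_mul, Xd, ← sub_mul]
    exact mul_pos (sub_pos.2 dA') Xc
  have vB₂ : fB q₂ = 0 := by simp [hq₂]; ring
  have vB₃ : fB q₃ = 0 := by simp [hq₃]; ring
  have vB₀ : 0 < fB q₀ := by simp [hq₀]; linarith
  have vB₁ : 0 < fB q₁ := by simp [hq₁]; linarith
  have vY₃ : fY q₃ = 0 := by simp [hq₃, Yc, Yd]
  have vY₀ : fY q₀ = 0 := by simp [hq₀, Yc, Yd]
  have vY₁ : 0 < fY q₁ := by
    simp only [hq₁, map_sub, map_smul, smul_eq_mul, Yb, ← sub_mul]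
    exact mul_pos (sub_pos.2 dA) Ya
  have vY₂ : 0 < fY q₂ := by
    simp only [hq₂, map_sub, map_smul, smul_eq_mul, Yb, ← sub_mul]
    exact mul_pos (sub_pos.2 dB') Ya
  refine ⟨![q₀, q₁, q₂, q₃], ⟨by norm_num, H.finrank, fun i => ?_, ?_⟩, ⟨vA₀, vA₁⟩, ⟨vX₁, vX₂⟩,
    ⟨vB₂, vB₃⟩, ⟨vY₃, vY₀⟩, s₀, sa, sb, s₃, sc, sd⟩
  · fin_cases i
    · exact ⟨fA, vA₀, vA₁, fun j => by fin_cases j <;> simp [vA₂, vA₃]⟩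
    · exact ⟨fX, vX₁, vX₂, fun j => by fin_cases j <;> simp [vX₃, vX₀]⟩
    · exact ⟨fB, vB₂, vB₃, fun j => by fin_cases j <;> simp [vB₀, vB₁]⟩
    · exact ⟨fY, vY₃, vY₀, fun j => by fin_cases j <;> simp [vY₁, vY₂]⟩
  · rw [openCone_eq_of_functionals H.finrank vA₀ vA₁ vA₂ vA₃ vX₁ vX₂ vX₃ vX₀ vB₂ vB₃ vB₀ vB₁ vY₃
      vY₀ vY₁ vY₂]
    rfl

end HexagonData

end Polygon

/-! ### Generators of the space of classes -/

section Generators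

variable {w₁ w₂ : Mink} {θ : ℝ}

lemma dot_nullMinus_lcross {w : Mink} (hw : dot w w = 1) (u : Mink) :
    dot (nullMinus w) (lcross w u) = dot (nullMinus w) u := by
  rw [dot_comm, dot_lcross_swap, lcross_nullMinus hw, dot_neg_left, neg_neg]

lemma dot_nullPlus_lcross {w : Mink} (hw : dot w w = 1) (u : Mink) :
    dot (nullPlus w) (lcross w u) = -dot (nullPlus w) u := by
  rw [dot_comm, dot_lcross_swap, lcross_nullPlus hw]

lemma lcross_comm (u v : Mink) : lcross u v = -lcross v u := by
  apply mink_ext <;> simp [lcross] <;> ring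

lemma dot_nullMinus_lcross' {w : Mink} (hw : dot w w = 1) (u : Mink) :
    dot (nullMinus w) (lcross u w) = -dot (nullMinus w) u := by
  rw [lcross_comm, dot_neg_right, dot_nullMinus_lcross hw]

lemma dot_nullPlus_lcross' {w : Mink} (hw : dot w w = 1) (u : Mink) :
    dot (nullPlus w) (lcross u w) = dot (nullPlus w) u := by
  rw [lcross_comm, dot_neg_right, dot_nullPlus_lcross hw, neg_neg]

/-- The class of the deformation that moves only the `i`-th vertex. -/
def side (h : IsHyperidealTriangle (dirI w₁ w₂ θ)) (i : Fin 3) :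
    Mink →ₗ[ℝ] H1 (minkRep (surfaceGroup w₁ w₂)) :=
  vertexClass h ∘ₗ LinearMap.single ℝ (fun _ => Mink) i

lemma vertexClass_eq_sum (h : IsHyperidealTriangle (dirI w₁ w₂ θ)) (q : Fin 3 → Mink) :
    vertexClass h q = side h 0 (q 0) + side h 1 (q 1) + side h 2 (q 2) := by
  have e : q = Pi.single 0 (q 0) + Pi.single 1 (q 1) + Pi.single 2 (q 2) := by
    ext1 i; fin_cases i <;> simp
  exact (congrArg (vertexClass h) e).trans (by rw [map_add, map_add]; rfl)

lemma side_sum (h : IsHyperidealTriangle (dirI w₁ w₂ θ)) (x : Mink) :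
    side h 0 x + side h 1 x + side h 2 x = 0 :=
  (vertexClass_eq_sum h fun _ => x).symm.trans (vertexClass_const h x)

/-- Moving the vertex along the fixed line of its involution does not change the deformation. -/
lemma side_eq_zero (h : IsHyperidealTriangle (dirI w₁ w₂ θ)) {i : Fin 3} {x : Mink}
    (hx : (![spine w₁, spine w₂, iota₀] i).1 x = x) : side h i x = 0 := by
  refine vertexClass_eq_zero h fun k => ?_
  change (![spine w₁, spine w₂, iota₀] k).1 (Pi.single (M := fun _ => Mink) i x k)
    = Pi.single (M := fun _ => Mink) i x k
  by_cases hk : k = i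
  · subst hk; rw [Pi.single_eq_same]; exact hx
  · rw [Pi.single_eq_of_ne hk, map_zero]

/-- The normalisation with which the two null vectors of a unit spacelike vector `w` sum to the
component of `p₀` orthogonal to `w`. -/
def nullScale (w : Mink) : ℝ := (1 + w 2 ^ 2) / 2

lemma nullScale_pos (w : Mink) : 0 < nullScale w := by unfold nullScale; positivity

/-- The image of `w^-`, scaled by `nullScale`, under a linear map. -/
def rayMinus {W : Type*} [AddCommGroup W] [Module ℝ W] (S : Mink →ₗ[ℝ] W) (w : Mink) : W :=
  S (nullScale w • nullMinus w)

/-- The image of `-w^+`, scaled by `nullScale`, under a linear map. The two rays are the images of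
the edges of the stem quadrant. -/
def rayPlus {W : Type*} [AddCommGroup W] [Module ℝ W] (S : Mink →ₗ[ℝ] W) (w : Mink) : W :=
  -S (nullScale w • nullPlus w)

section Rays

variable {W : Type*} [AddCommGroup W] [Module ℝ W] {S : Mink →ₗ[ℝ] W} {w : Mink}

lemma eq_rays (hw : dot w w = 1) (hS : S w = 0) (x : Mink) :
    S x = -dot (nullPlus w) x • rayMinus S w + dot (nullMinus w) x • rayPlus S w := by
  conv_lhs => rw [null_expansion hw x]
  simp only [rayMinus, rayPlus, nullScale, map_add, map_smul, hS, dot_comm x]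
  module

/-- A linear map killing `w` maps the stem quadrant of `w` onto the open cone of its rays. -/
lemma image_stemQuadrant {y : W} : (∃ x ∈ stemQuadrant w, S x = y) ↔
    ∃ s t : ℝ, 0 < s ∧ 0 < t ∧ y = s • rayMinus S w + t • rayPlus S w := by
  have hρ := nullScale_pos w
  constructor
  · rintro ⟨_, ⟨a, b, ha, hb, rfl⟩, rfl⟩
    refine ⟨a / nullScale w, b / nullScale w, by positivity, by positivity, ?_⟩
    simp only [rayMinus, rayPlus, map_sub, map_smul, smul_neg, smul_smul,
      div_mul_cancel₀ _ hρ.ne', ← sub_eq_add_neg]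
  · rintro ⟨s, t, hs, ht, rfl⟩
    refine ⟨_, ⟨s * nullScale w, t * nullScale w, by positivity, by positivity, rfl⟩, ?_⟩
    simp only [rayMinus, rayPlus, map_sub, map_smul, smul_neg, smul_smul, ← sub_eq_add_neg]

end Rays

variable (h : IsHyperidealTriangle (dirI w₁ w₂ θ))

lemma side_zero_self : side h 0 w₁ = 0 :=
  side_eq_zero h (spine_linear_part (ultra_of_dirI h).1.unit_left).1

lemma side_one_self : side h 1 w₂ = 0 :=
  side_eq_zero h (spine_linear_part (ultra_of_dirI h).1.unit_right).1

lemma side_two_p₀ : side h 2 p₀ = 0 := side_eq_zero h iota₀_p₀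

lemma side_zero_eq (x : Mink) : side h 0 x = -dot (nullPlus w₁) x • rayMinus (side h 0) w₁
    + dot (nullMinus w₁) x • rayPlus (side h 0) w₁ :=
  eq_rays (ultra_of_dirI h).1.unit_left (side_zero_self h) x

lemma side_one_eq (x : Mink) : side h 1 x = -dot (nullPlus w₂) x • rayMinus (side h 1) w₂
    + dot (nullMinus w₂) x • rayPlus (side h 1) w₂ :=
  eq_rays (ultra_of_dirI h).1.unit_right (side_one_self h) x

/-- The relation between the four rays, obtained by translating in the direction `p₀`. -/
lemma rays_relation : rayPlus (side h 0) w₁ + rayPlus (side h 1) w₂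
    = rayMinus (side h 0) w₁ + rayMinus (side h 1) w₂ := by
  have e := side_sum h p₀
  rw [side_two_p₀, side_zero_eq, side_one_eq] at e
  simp only [dot_p₀, nullMinus_two, nullPlus_two] at e
  rw [← sub_eq_zero, ← neg_eq_zero, ← e]; module

/-- The four rays span the space of classes. -/
lemma exists_rays (c : H1 (minkRep (surfaceGroup w₁ w₂))) : ∃ s t s' t' : ℝ,
    c = s • rayMinus (side h 0) w₁ + t • rayPlus (side h 0) w₁
      + s' • rayMinus (side h 1) w₂ + t' • rayPlus (side h 1) w₂ := by
  obtain ⟨q, rfl⟩ := vertexClass_surjective h c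
  have e := (vertexClass_sub_const h q (q 2)).symm.trans (vertexClass_eq_sum h _)
  rw [sub_self, map_zero, add_zero, side_zero_eq, side_one_eq, ← add_assoc] at e
  exact ⟨_, _, _, _, e⟩

/-- The extremal class on the first pentagon: the vertex of the plane through the origin moves along
its stem, the other planes stay. -/
def apexI : H1 (minkRep (surfaceGroup w₁ w₂)) := side h 2 (j₀ θ)

/-- The extremal class on the second pentagon, for the direction vector `w₀ θ'`. -/
def apexII (θ' : ℝ) : H1 (minkRep (surfaceGroup w₁ w₂)) := side h 1 (j₀ θ') - side h 0 (j₀ θ')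

lemma apexI_eq : apexI h =
    dot (nullPlus w₁) (j₀ θ) • rayMinus (side h 0) w₁
    - dot (nullMinus w₁) (j₀ θ) • rayPlus (side h 0) w₁
    + dot (nullPlus w₂) (j₀ θ) • rayMinus (side h 1) w₂
    - dot (nullMinus w₂) (j₀ θ) • rayPlus (side h 1) w₂ := by
  have e := side_sum h (j₀ θ)
  rw [side_zero_eq, side_one_eq] at e
  rw [apexI, eq_neg_of_add_eq_zero_right e]; module

lemma apexII_eq (θ' : ℝ) : apexII h θ' =
    dot (nullPlus w₁) (j₀ θ') • rayMinus (side h 0) w₁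
    - dot (nullMinus w₁) (j₀ θ') • rayPlus (side h 0) w₁
    - dot (nullPlus w₂) (j₀ θ') • rayMinus (side h 1) w₂
    + dot (nullMinus w₂) (j₀ θ') • rayPlus (side h 1) w₂ := by
  rw [apexII, side_zero_eq, side_one_eq]; module

lemma apexII_eq_vertexClass (θ' : ℝ) :
    apexII h θ' = vertexClass h ![0, (2 : ℝ) • j₀ θ', j₀ θ'] := by
  rw [vertexClass_eq_sum]
  simp only [Matrix.cons_val_zero, Matrix.cons_val_one, Matrix.cons_val, map_zero, map_smul]
  rw [apexII, eq_neg_of_add_eq_zero_right (side_sum h (j₀ θ'))]; module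

lemma stemQuadrant_w₀ (θ : ℝ) (x : Mink) : x ∈ stemQuadrant (w₀ θ) ↔
    ∃ a b : ℝ, 0 < a ∧ 0 < b ∧ x = (a + b) • j₀ θ + (a - b) • p₀ := by
  have e : ∀ a b : ℝ, a • nullMinus (w₀ θ) - b • nullPlus (w₀ θ)
      = (a + b) • j₀ θ + (a - b) • p₀ := fun a b => by
    rw [nullMinus_w₀, nullPlus_w₀]; module
  simp only [stemQuadrant, e]; rfl

lemma iota₀_mem_of_mem_stemQuadrant {w x : Mink} (hx : x ∈ stemQuadrant w) :
    iota₀.1 x ∈ stemQuadrant (iota₀.1 w) := by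
  obtain ⟨a, b, ha, hb, rfl⟩ := hx
  exact ⟨a, b, ha, hb, by rw [nullMinus_iota₀, nullPlus_iota₀, map_sub, map_smul, map_smul]⟩

/-- The first pentagon. The three stem quadrants have six edges in all; the two edges of the third
one have the same class. -/
lemma domainClasses_dirI :
    domainClasses w₁ w₂ ![spine w₁, spine w₂, iota₀] (dirI w₁ w₂ θ)
      = openCone ![apexI h, rayMinus (side h 0) w₁, rayPlus (side h 0) w₁,
        rayMinus (side h 1) w₂, rayPlus (side h 1) w₂] := by
  ext c
  rw [mem_domainClasses_dirI h, mem_openCone_five]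
  constructor
  · rintro ⟨q, hq, rfl⟩
    obtain ⟨s, t, hs, ht, e⟩ := (image_stemQuadrant (S := side h 0) (w := w₁)).1 ⟨_, hq 0, rfl⟩
    obtain ⟨s', t', hs', ht', e'⟩ := (image_stemQuadrant (S := side h 1) (w := w₂)).1 ⟨_, hq 1, rfl⟩
    obtain ⟨a, b, ha, hb, e''⟩ := (stemQuadrant_w₀ _ _).1 (hq 2)
    refine ⟨a + b, s, t, s', t', by positivity, hs, ht, hs', ht',
      (vertexClass_eq_sum h q).trans ?_⟩
    rw [e'', map_add, map_smul, map_smul, side_two_p₀, smul_zero, add_zero]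
    refine (congrArg₂ (· + ·) (congrArg₂ (· + ·) e e') rfl).trans ?_
    rw [apexI]
    abel
  · rintro ⟨t₀, s, t, s', t', h₀, hs, ht, hs', ht', rfl⟩
    obtain ⟨x, hx, e⟩ := (image_stemQuadrant (S := side h 0) (w := w₁)).2 ⟨s, t, hs, ht, rfl⟩
    obtain ⟨y, hy, e'⟩ := (image_stemQuadrant (S := side h 1) (w := w₂)).2
      ⟨s', t', hs', ht', rfl⟩
    refine ⟨![x, y, t₀ • j₀ θ], ?_, (vertexClass_eq_sum h _).trans ?_⟩
    · intro i; fin_cases i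
      · exact hx
      · exact hy
      · exact (stemQuadrant_w₀ _ _).2 ⟨t₀ / 2, t₀ / 2, by positivity, by positivity, by
          rw [sub_self, zero_smul, add_zero, add_halves]; rfl⟩
    · refine (congrArg₂ (· + ·) (congrArg₂ (· + ·) e e') (map_smul (side h 2) t₀ _)).trans ?_
      rw [apexI]; abel

/-- The second pentagon. The vertex on the flipped side is moved back by `ι₀` to the stem quadrant
of `w₂`, so the first two planes contribute the same four rays. -/
lemma domainClasses_dirII {θ' : ℝ} (h' : IsHyperidealTriangle (dirII w₁ w₂ θ')) :
    domainClasses w₁ w₂ ![spine w₁, iota₀ * spine w₂ * iota₀, iota₀] (dirII w₁ w₂ θ')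
      = openCone ![apexII h θ', rayMinus (side h 0) w₁, rayPlus (side h 0) w₁,
        rayMinus (side h 1) w₂, rayPlus (side h 1) w₂] := by
  -- the plane through the origin contributes a multiple of the extremal class
  have key : ∀ (x y : Mink) (a b : ℝ), vertexClass h
      ![x, y + (a • j₀ θ' + b • p₀) - iota₀.1 (a • j₀ θ' + b • p₀), a • j₀ θ' + b • p₀]
      = side h 0 x + side h 1 y + a • apexII h θ' := fun x y a b => by
    refine (vertexClass_eq_sum h _).trans ?_
    simp only [Matrix.cons_val_zero, Matrix.cons_val_one, Matrix.cons_val, map_add, map_sub,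
      map_smul, iota₀_j₀, iota₀_p₀, map_neg, side_two_p₀]
    rw [apexII, eq_neg_of_add_eq_zero_right (side_sum h (j₀ θ'))]
    module
  ext c
  rw [mem_domainClasses_dirII h h', mem_openCone_five]
  constructor
  · rintro ⟨q, hq, rfl⟩
    obtain ⟨s, t, hs, ht, e⟩ := (image_stemQuadrant (S := side h 0) (w := w₁)).1 ⟨_, hq 0, rfl⟩
    obtain ⟨s', t', hs', ht', e'⟩ := (image_stemQuadrant (S := side h 1) (w := w₂)).1
      ⟨_, by simpa only [iota₀_iota₀] using iota₀_mem_of_mem_stemQuadrant (w := iota₀.1 w₂) (hq 1),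
        rfl⟩
    obtain ⟨a, b, ha, hb, e''⟩ := (stemQuadrant_w₀ _ _).1 (hq 2)
    refine ⟨a + b, s, t, s', t', by positivity, hs, ht, hs', ht', ?_⟩
    rw [e'']
    refine (key _ _ _ _).trans ((congrArg₂ (· + ·) (congrArg₂ (· + ·) e e') rfl).trans ?_)
    abel
  · rintro ⟨t₀, s, t, s', t', h₀, hs, ht, hs', ht', rfl⟩
    obtain ⟨x, hx, e⟩ := (image_stemQuadrant (S := side h 0) (w := w₁)).2 ⟨s, t, hs, ht, rfl⟩
    obtain ⟨y, hy, e'⟩ := (image_stemQuadrant (S := side h 1) (w := w₂)).2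
      ⟨s', t', hs', ht', rfl⟩
    refine ⟨![x, iota₀.1 y, t₀ • j₀ θ' + (0 : ℝ) • p₀], ?_, ?_⟩
    · intro i; fin_cases i
      · exact hx
      · exact iota₀_mem_of_mem_stemQuadrant hy
      · exact (stemQuadrant_w₀ _ _).2 ⟨t₀ / 2, t₀ / 2, by positivity, by positivity, by
          rw [sub_self, add_halves]; rfl⟩
    · simp only [Matrix.cons_val_zero, Matrix.cons_val_one, Matrix.cons_val, iota₀_iota₀]
      refine (key _ _ _ _).trans ((congrArg₂ (· + ·) (congrArg₂ (· + ·) e e') rfl).trans ?_)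
      abel

end Generators

/-! ### Inscribed hexagons -/

section Inscribed

variable {W : Type*} [AddCommGroup W] [Module ℝ W] {a b c d h₀ h₃ : W}
  {A B C A' B' C' : ℝ} {fA fX fB fY : W →ₗ[ℝ] ℝ}

/-- The functional `fA`, being positive on the edge `da` and vanishing at `h₀` beyond it, separates
`a` from `b`; with `fX` and `fY` this makes `a, b, d` independent. -/
lemma linearIndependent_of_functionals (rel : c = b + d - a) (eq₀ : h₀ = A • d + B • a - C • b)
    (A_pos : 0 < A) (C_pos : 0 < C) (C_lt_B : C < B)
    (Aa : 0 < fA a) (Ad : 0 < fA d) (A₀ : fA h₀ = 0)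
    (Xa : fX a = 0) (Xb : fX b = 0) (Xc : 0 < fX c)
    (Yc : fY c = 0) (Yd : fY d = 0) (Ya : 0 < fY a) : LinearIndependent ℝ ![a, b, d] := by
  have rel' : ∀ f : W →ₗ[ℝ] ℝ, f c = f b + f d - f a := fun f => by rw [rel]; simp
  have eA : A * fA d + B * fA a - C * fA b = 0 := by rw [← A₀, eq₀]; simp
  have dA : fA a < fA b := by
    nlinarith [mul_pos A_pos Ad, mul_pos Aa (sub_pos.2 C_lt_B)]
  have Xd : 0 < fX d := by have := rel' fX; linarith
  have Yb : fY b = fY a := by have := rel' fY; linarith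
  rw [Fintype.linearIndependent_iff]
  intro g hg
  simp only [Fin.sum_univ_three, Matrix.cons_val_zero, Matrix.cons_val_one, Matrix.cons_val] at hg
  have ev : ∀ f : W →ₗ[ℝ] ℝ, g 0 * f a + g 1 * f b + g 2 * f d = 0 := fun f => by
    have := congrArg f hg
    simpa using this
  have g2 : g 2 = 0 := by
    have := ev fX
    rw [Xa, Xb, mul_zero, mul_zero, zero_add, zero_add] at this
    exact (mul_eq_zero.1 this).resolve_right Xd.ne'
  have g01 : g 0 + g 1 = 0 := by
    have := ev fY
    rw [Yb, Yd, mul_zero, add_zero, ← add_mul] at this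
    exact (mul_eq_zero.1 this).resolve_right Ya.ne'
  have g1 : g 1 = 0 := by
    have := ev fA
    rw [g2, eq_neg_of_add_eq_zero_left g01] at this
    have : g 1 * (fA b - fA a) = 0 := by linarith
    exact (mul_eq_zero.1 this).resolve_right (sub_pos.2 dA).ne'
  intro i
  fin_cases i
  · simpa [g1] using g01
  · exact g1
  · exact g2

lemma finrank_eq_three (rel : c = b + d - a) (hli : LinearIndependent ℝ ![a, b, d])
    (span : ∀ x : W, ∃ r s t u : ℝ, x = r • a + s • b + t • c + u • d) :
    Module.finrank ℝ W = 3 := by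
  have hspan : ⊤ ≤ Submodule.span ℝ (Set.range ![a, b, d]) := by
    rintro x -
    obtain ⟨r, s, t, u, rfl⟩ := span x
    have ha : a ∈ Submodule.span ℝ (Set.range ![a, b, d]) := Submodule.subset_span ⟨0, rfl⟩
    have hb : b ∈ Submodule.span ℝ (Set.range ![a, b, d]) := Submodule.subset_span ⟨1, rfl⟩
    have hd : d ∈ Submodule.span ℝ (Set.range ![a, b, d]) := Submodule.subset_span ⟨2, rfl⟩
    rw [rel]
    exact add_mem (add_mem (add_mem (Submodule.smul_mem _ _ ha) (Submodule.smul_mem _ _ hb))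
      (Submodule.smul_mem _ _ (sub_mem (add_mem hb hd) ha))) (Submodule.smul_mem _ _ hd)
  simpa using Module.finrank_eq_card_basis (Module.Basis.mk hli hspan)

/-- The open cone does not depend on the order in which its generators are listed. -/
lemma openCone_eq_of_perm {n : ℕ} {v v' : Fin n → W} (f : Fin n → Fin n)
    (hf : Function.Bijective f) (e : v' ∘ f = v) : openCone v = openCone v' := by
  subst e
  let σ := Equiv.ofBijective f hf
  ext x
  constructor
  · rintro ⟨t, ht, rfl⟩
    refine ⟨t ∘ σ.symm, fun i => ht _, ?_⟩
    rw [← Equiv.sum_comp σ fun i => (t ∘ σ.symm) i • v' i]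
    simp [σ]
  · rintro ⟨t, ht, rfl⟩
    exact ⟨t ∘ σ, fun i => ht _, (Equiv.sum_comp σ fun i => t i • v' i).symm⟩

/-- The set where four functionals have the same sign has the same projective image as the set where
they are positive. -/
lemma projImage_same_sign (fX fY fA fB : W →ₗ[ℝ] ℝ) :
    projImage {c | (0 < fX c ∧ 0 < fY c ∧ 0 < fA c ∧ 0 < fB c) ∨
      (fX c < 0 ∧ fY c < 0 ∧ fA c < 0 ∧ fB c < 0)}
      = projImage {c | 0 < fX c ∧ 0 < fY c ∧ 0 < fA c ∧ 0 < fB c} := by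
  rw [← projImage_or_neg {c | 0 < fX c ∧ 0 < fY c ∧ 0 < fA c ∧ 0 < fB c}]
  simp only [Set.mem_ofPred_eq, map_neg, neg_pos]

/-- The assembled polygons of the two pentagonal cones and the quadrilateral of functionals. -/
lemma HexagonData.exists_polygons (H : HexagonData a b c d h₀ h₃ A B C A' B' C')
    (Aa : 0 < fA a) (Ad : 0 < fA d) (A₀ : fA h₀ = 0)
    (Bb : 0 < fB b) (Bc : 0 < fB c) (B₃ : fB h₃ = 0)
    (Xa : fX a = 0) (Xb : fX b = 0) (Xc : 0 < fX c)
    (Yc : fY c = 0) (Yd : fY d = 0) (Ya : 0 < fY a)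
    {D₁ D₂ : Set W} (e₁ : D₁ = openCone ![h₀, a, b, c, d]) (e₂ : D₂ = openCone ![a, b, h₃, c, d]) :
    ∃ (h : Fin 6 → W) (q : Fin 4 → W),
      IsConvexPolygon h (projImage D₁ ∪ projImage D₂) ∧
      IsConvexPolygon ![h 0, h 1, h 2, h 4, h 5] (projImage D₁) ∧
      IsConvexPolygon ![h 1, h 2, h 3, h 4, h 5] (projImage D₂) ∧
      IsConvexPolygon q (projImage {c | (0 < fX c ∧ 0 < fY c ∧ 0 < fA c ∧ 0 < fB c) ∨
        (fX c < 0 ∧ fY c < 0 ∧ fA c < 0 ∧ fB c < 0)}) ∧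
      (fA (q 0) = 0 ∧ fA (q 1) = 0) ∧ (fX (q 1) = 0 ∧ fX (q 2) = 0) ∧
      (fB (q 2) = 0 ∧ fB (q 3) = 0) ∧ (fY (q 3) = 0 ∧ fY (q 0) = 0) ∧
      h 0 ∈ openSide (q 0) (q 1) ∧
      h 1 ∈ openSide (q 1) (q 2) ∧ h 2 ∈ openSide (q 1) (q 2) ∧
      h 3 ∈ openSide (q 2) (q 3) ∧
      h 4 ∈ openSide (q 3) (q 0) ∧ h 5 ∈ openSide (q 3) (q 0) := by
  obtain ⟨q, hq, hrest⟩ := H.circumscribed Aa Ad A₀ Bb Bc B₃ Xa Xb Xc Yc Yd Ya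
  refine ⟨![h₀, a, b, h₃, c, d], q, ?_, ?_, ?_, ?_, hrest⟩
  · rw [projImage_union, e₁, e₂, H.union_eq]
    exact H.isConvexPolygon_hexagon
  · rw [e₁]; exact H.isConvexPolygon_pentagon₁
  · rw [e₂]; exact H.isConvexPolygon_pentagon₂
  · rw [projImage_same_sign]; exact hq

end Inscribed

/-! ### Margulis invariants of the generators -/

section Assembly

variable {w₁ w₂ : Mink} {θ : ℝ} (h : IsHyperidealTriangle (dirI w₁ w₂ θ))

/-- The invariant of `X` does not involve the vertex of the second plane. -/
lemma margulis_gX_values :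
    0 < margulis (gX w₁ w₂) (rayMinus (side h 0) w₁) ∧
    0 < margulis (gX w₁ w₂) (rayPlus (side h 0) w₁) ∧
    margulis (gX w₁ w₂) (rayMinus (side h 1) w₂) = 0 ∧
    margulis (gX w₁ w₂) (rayPlus (side h 1) w₂) = 0 := by
  obtain ⟨c, hc, hm⟩ := margulis_gX h
  have hw := (ultra_of_dirI h).1.unit_left
  have hρ := mul_pos hc (nullScale_pos w₁)
  have m0 : ∀ x, margulis (gX w₁ w₂) (side h 0 x) = -(c * dot x (lcross w₁ p₀)) := fun x =>
    (hm _).trans (by simp [dot_neg_left])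
  have m1 : ∀ x, margulis (gX w₁ w₂) (side h 1 x) = 0 := fun x =>
    (hm _).trans (by simp [dot])
  refine ⟨?_, ?_, m1 _, (map_neg _ _).trans (by rw [m1, neg_zero])⟩
  · rw [rayMinus, m0, dot_smul_left, dot_nullMinus_lcross hw, dot_p₀, nullMinus_two]; linarith
  · rw [rayPlus, map_neg, m0, dot_smul_left, dot_nullPlus_lcross hw, dot_p₀, nullPlus_two]
    linarith

/-- The invariant of `Y` does not involve the vertex of the first plane. -/
lemma margulis_gY_values :
    margulis (gY w₁ w₂) (rayMinus (side h 0) w₁) = 0 ∧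
    margulis (gY w₁ w₂) (rayPlus (side h 0) w₁) = 0 ∧
    0 < margulis (gY w₁ w₂) (rayMinus (side h 1) w₂) ∧
    0 < margulis (gY w₁ w₂) (rayPlus (side h 1) w₂) := by
  obtain ⟨c, hc, hm⟩ := margulis_gY h
  have hw := (ultra_of_dirI h).1.unit_right
  have hρ := mul_pos hc (nullScale_pos w₂)
  have m0 : ∀ x, margulis (gY w₁ w₂) (side h 0 x) = 0 := fun x =>
    (hm _).trans (by simp [dot])
  have m1 : ∀ x, margulis (gY w₁ w₂) (side h 1 x) = c * dot x (lcross p₀ w₂) := fun x =>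
    (hm _).trans (by simp)
  refine ⟨m0 _, (map_neg _ _).trans (by rw [m0, neg_zero]), ?_, ?_⟩
  · rw [rayMinus, m1, dot_smul_left, dot_nullMinus_lcross' hw, dot_p₀, nullMinus_two]; linarith
  · rw [rayPlus, map_neg, m1, dot_smul_left, dot_nullPlus_lcross' hw, dot_p₀, nullPlus_two]
    linarith

/-- The invariant of `A` does not involve the vertex of the third plane, hence it vanishes on
`apexI`. -/
lemma margulis_gA_values :
    (0 < margulis (gA w₁ w₂) (rayMinus (side h 0) w₁) ∧
    0 < margulis (gA w₁ w₂) (rayPlus (side h 0) w₁) ∧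
    0 < margulis (gA w₁ w₂) (rayMinus (side h 1) w₂) ∧
    0 < margulis (gA w₁ w₂) (rayPlus (side h 1) w₂)) ∧
    margulis (gA w₁ w₂) (apexI h) = 0 := by
  obtain ⟨c, hc, hm⟩ := margulis_gA h
  have h12 := (ultra_of_dirI h).1
  have hρ := mul_pos hc (nullScale_pos w₁)
  have hρ' := mul_pos hc (nullScale_pos w₂)
  have m0 : ∀ x, margulis (gA w₁ w₂) (side h 0 x) = -(c * dot x (lcross w₁ w₂)) := fun x =>
    (hm _).trans (by simp [dot_neg_left])
  have m1 : ∀ x, margulis (gA w₁ w₂) (side h 1 x) = c * dot x (lcross w₁ w₂) := fun x =>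
    (hm _).trans (by simp)
  have n1 := h12.symm.dot_nullMinus_neg
  have n2 := h12.symm.dot_nullPlus_neg
  have n3 := h12.dot_nullMinus_neg
  have n4 := h12.dot_nullPlus_neg
  rw [dot_comm] at n1 n2 n3 n4
  refine ⟨⟨?_, ?_, ?_, ?_⟩, (hm _).trans (by simp [dot])⟩
  · rw [rayMinus, m0, dot_smul_left, dot_nullMinus_lcross h12.unit_left]
    nlinarith [mul_pos_of_neg_of_neg n1 (neg_neg_of_pos hρ)]
  · rw [rayPlus, map_neg, m0, dot_smul_left, dot_nullPlus_lcross h12.unit_left]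
    nlinarith [mul_pos_of_neg_of_neg n2 (neg_neg_of_pos hρ)]
  · rw [rayMinus, m1, dot_smul_left, dot_nullMinus_lcross' h12.unit_right]
    nlinarith [mul_pos_of_neg_of_neg n3 (neg_neg_of_pos hρ')]
  · rw [rayPlus, map_neg, m1, dot_smul_left, dot_nullPlus_lcross' h12.unit_right]
    nlinarith [mul_pos_of_neg_of_neg n4 (neg_neg_of_pos hρ')]

/-- The invariant of `B` compares the vertex of the second plane with the image of that of the first
under the affine involution over `ι₀`. For the deformation `apexII` both are `2 • j₀ θ'`. -/
lemma margulis_gB_values :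
    (0 < margulis (gB w₁ w₂) (rayMinus (side h 0) w₁) ∧
    0 < margulis (gB w₁ w₂) (rayPlus (side h 0) w₁) ∧
    0 < margulis (gB w₁ w₂) (rayMinus (side h 1) w₂) ∧
    0 < margulis (gB w₁ w₂) (rayPlus (side h 1) w₂)) ∧
    ∀ θ', margulis (gB w₁ w₂) (apexII h θ') = 0 := by
  obtain ⟨c, hc, hm⟩ := margulis_gB h
  obtain ⟨-, h1, h2⟩ := ultra_of_dirI h
  have h21 := h2.flip h1
  have hρ := mul_pos hc (nullScale_pos w₁)
  have hρ' := mul_pos hc (nullScale_pos w₂)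
  have m0 : ∀ x, margulis (gB w₁ w₂) (side h 0 x)
      = c * dot (iota₀.1 x) (lcross w₂ (iota₀.1 w₁)) := fun x => (hm _).trans (by simp)
  have m1 : ∀ x, margulis (gB w₁ w₂) (side h 1 x)
      = -(c * dot x (lcross w₂ (iota₀.1 w₁))) := fun x =>
    (hm _).trans (by simp [dot_neg_left])
  have n1 := h21.dot_nullMinus_neg
  have n2 := h21.dot_nullPlus_neg
  have n3 := h21.symm.dot_nullMinus_neg
  have n4 := h21.symm.dot_nullPlus_neg
  rw [dot_comm] at n1 n2 n3 n4
  refine ⟨⟨?_, ?_, ?_, ?_⟩, fun θ' => ?_⟩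
  · rw [rayMinus, m0, map_smul, dot_smul_left, ← nullMinus_iota₀,
      dot_nullMinus_lcross' h21.unit_right]
    nlinarith [mul_pos_of_neg_of_neg n1 (neg_neg_of_pos hρ)]
  · rw [rayPlus, map_neg, m0, map_smul, dot_smul_left, ← nullPlus_iota₀,
      dot_nullPlus_lcross' h21.unit_right]
    nlinarith [mul_pos_of_neg_of_neg n2 (neg_neg_of_pos hρ)]
  · rw [rayMinus, m1, dot_smul_left, dot_nullMinus_lcross h21.unit_left]
    nlinarith [mul_pos_of_neg_of_neg n3 (neg_neg_of_pos hρ')]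
  · rw [rayPlus, map_neg, m1, dot_smul_left, dot_nullPlus_lcross h21.unit_left]
    nlinarith [mul_pos_of_neg_of_neg n4 (neg_neg_of_pos hρ')]
  · have e : iota₀.1 0 + j₀ θ' - iota₀.1 (j₀ θ') - (2 : ℝ) • j₀ θ' = 0 := by
      rw [map_zero, iota₀_j₀]; module
    refine (congrArg _ (apexII_eq_vertexClass h θ')).trans ((hm _).trans ?_)
    simp only [Matrix.cons_val_zero, Matrix.cons_val_one, Matrix.cons_val]
    rw [e]; simp [dot]

/-! ### The two cyclic orders

The names in `ccw` refer to the case `0 < cross w₁ w₂`, in which the ends of `w₂^⊥` come before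
those of `w₁^⊥` along the geodesic of `w₀ θ` and the four rays have the cyclic order
`y⁺, y⁻, x⁺, x⁻`.
The names in `cw` refer to the opposite case and the order `y⁻, y⁺, x⁻, x⁺`.
-/

lemma rays_relation_ccw : rayPlus (side h 0) w₁ = rayMinus (side h 1) w₂ + rayMinus (side h 0) w₁
    - rayPlus (side h 1) w₂ := by
  rw [eq_sub_iff_add_eq, rays_relation]; abel

lemma rays_relation_cw : rayMinus (side h 0) w₁ = rayPlus (side h 1) w₂ + rayPlus (side h 0) w₁
    - rayMinus (side h 1) w₂ := by
  rw [eq_sub_iff_add_eq, ← rays_relation]; abel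

lemma apexI_eq_ccw : apexI h =
    (dot (nullPlus w₁) (j₀ θ) - dot (nullMinus w₁) (j₀ θ)) • rayMinus (side h 0) w₁
    + (dot (nullMinus w₁) (j₀ θ) - dot (nullMinus w₂) (j₀ θ)) • rayPlus (side h 1) w₂
    - (dot (nullMinus w₁) (j₀ θ) - dot (nullPlus w₂) (j₀ θ)) • rayMinus (side h 1) w₂ := by
  rw [apexI_eq, rays_relation_ccw]; module

lemma apexI_eq_cw : apexI h =
    (dot (nullPlus w₁) (j₀ θ) - dot (nullMinus w₁) (j₀ θ)) • rayPlus (side h 0) w₁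
    + (dot (nullPlus w₂) (j₀ θ) - dot (nullPlus w₁) (j₀ θ)) • rayMinus (side h 1) w₂
    - (dot (nullMinus w₂) (j₀ θ) - dot (nullPlus w₁) (j₀ θ)) • rayPlus (side h 1) w₂ := by
  rw [apexI_eq, rays_relation_cw]; module

lemma apexII_eq_ccw (θ' : ℝ) : apexII h θ' =
    (dot (nullMinus w₂) (j₀ θ') - dot (nullPlus w₂) (j₀ θ')) • rayMinus (side h 1) w₂
    + (-dot (nullMinus w₁) (j₀ θ') - dot (nullMinus w₂) (j₀ θ')) • rayPlus (side h 0) w₁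
    - (-dot (nullPlus w₁) (j₀ θ') - dot (nullMinus w₂) (j₀ θ')) • rayMinus (side h 0) w₁ := by
  have e : rayPlus (side h 1) w₂ = rayMinus (side h 1) w₂ + rayMinus (side h 0) w₁
      - rayPlus (side h 0) w₁ := by rw [rays_relation_ccw]; abel
  rw [apexII_eq, e]; module

lemma apexII_eq_cw (θ' : ℝ) : apexII h θ' =
    (dot (nullMinus w₂) (j₀ θ') - dot (nullPlus w₂) (j₀ θ')) • rayPlus (side h 1) w₂
    + (dot (nullPlus w₁) (j₀ θ') + dot (nullPlus w₂) (j₀ θ')) • rayMinus (side h 0) w₁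
    - (dot (nullMinus w₁) (j₀ θ') + dot (nullPlus w₂) (j₀ θ')) • rayPlus (side h 0) w₁ := by
  have e : rayMinus (side h 1) w₂ = rayPlus (side h 1) w₂ + rayPlus (side h 0) w₁
      - rayMinus (side h 0) w₁ := by rw [rays_relation_cw]; abel
  rw [apexII_eq, e]; module

lemma rays_independent_ccw (ho : dot (nullPlus w₂) (j₀ θ) < dot (nullMinus w₁) (j₀ θ)) :
    LinearIndependent ℝ ![rayPlus (side h 1) w₂, rayMinus (side h 1) w₂,
      rayMinus (side h 0) w₁] := by
  obtain ⟨-, h1, h2⟩ := ultra_of_dirI h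
  have l1 := dot_j₀_lt h1
  have l2 := dot_j₀_lt h2
  obtain ⟨X1, X2, X3, X4⟩ := margulis_gX_values h
  obtain ⟨Y1, Y2, Y3, Y4⟩ := margulis_gY_values h
  obtain ⟨⟨A1, A2, A3, A4⟩, A0⟩ := margulis_gA_values h
  exact linearIndependent_of_functionals (rays_relation_ccw h) (apexI_eq_ccw h) (by linarith)
    (by linarith) (by linarith) A4 A1 A0 X4 X3 X2 Y2 Y1 Y4

lemma rays_independent_cw (ho : dot (nullPlus w₁) (j₀ θ) < dot (nullMinus w₂) (j₀ θ)) :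
    LinearIndependent ℝ ![rayMinus (side h 1) w₂, rayPlus (side h 1) w₂,
      rayPlus (side h 0) w₁] := by
  obtain ⟨-, h1, h2⟩ := ultra_of_dirI h
  have l1 := dot_j₀_lt h1
  have l2 := dot_j₀_lt h2
  obtain ⟨X1, X2, X3, X4⟩ := margulis_gX_values h
  obtain ⟨Y1, Y2, Y3, Y4⟩ := margulis_gY_values h
  obtain ⟨⟨A1, A2, A3, A4⟩, A0⟩ := margulis_gA_values h
  exact linearIndependent_of_functionals (rays_relation_cw h) (apexI_eq_cw h) (by linarith)
    (by linarith) (by linarith) A3 A2 A0 X3 X4 X1 Y1 Y2 Y3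

lemma finrank_H1 (h : IsHyperidealTriangle (dirI w₁ w₂ θ)) :
    Module.finrank ℝ (H1 (minkRep (surfaceGroup w₁ w₂))) = 3 := by
  obtain ⟨h12, h1, h2⟩ := ultra_of_dirI h
  rcases order_dichotomy h12 h1 h2 with ⟨-, ho⟩ | ⟨-, ho⟩
  · refine finrank_eq_three (rays_relation_ccw h) (rays_independent_ccw h ho) fun x => ?_
    obtain ⟨s, t, s', t', rfl⟩ := exists_rays h x
    exact ⟨t', s', t, s, by abel⟩
  · refine finrank_eq_three (rays_relation_cw h) (rays_independent_cw h ho) fun x => ?_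
    obtain ⟨s, t, s', t', rfl⟩ := exists_rays h x
    exact ⟨s', t', s, t, by abel⟩

lemma exists_flip (h : IsHyperidealTriangle (dirI w₁ w₂ θ)) :
    ∃ θ' : ℝ, IsHyperidealTriangle (dirII w₁ w₂ θ') := by
  obtain ⟨h12, h1, h2⟩ := ultra_of_dirI h
  obtain ⟨θ', u1, u2⟩ := exists_flip_side h12 h1.time_pos h2.time_pos
  exact ⟨θ', (isHyperidealTriangle_iff _).2 (pairwise_ultra (h1.flip h2) u1 u2)⟩

lemma cross_iota₀ (v w : Mink) : cross v (iota₀.1 w) = -cross v w := by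
  rw [iota₀_apply]; simp [cross]; ring

lemma dot_nullPlus_iota₀_j₀ (w : Mink) (θ : ℝ) :
    dot (nullPlus (iota₀.1 w)) (j₀ θ) = -dot (nullPlus w) (j₀ θ) := by
  rw [nullPlus_iota₀, ← dot_iota₀, iota₀_iota₀, iota₀_j₀, dot_neg_right]

lemma dot_nullMinus_iota₀_j₀ (w : Mink) (θ : ℝ) :
    dot (nullMinus (iota₀.1 w)) (j₀ θ) = -dot (nullMinus w) (j₀ θ) := by
  rw [nullMinus_iota₀, ← dot_iota₀, iota₀_iota₀, iota₀_j₀, dot_neg_right]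

end Assembly

end CrookedHexagon

end

open CrookedHexagon

theorem mainTheorem2 (w₁ w₂ : Mink) (θ : ℝ) (hκ : IsHyperidealTriangle (dirI w₁ w₂ θ)) :
    Module.finrank ℝ (groupCohomology.H1 (minkRep (surfaceGroup w₁ w₂))) = 3 ∧
    (∃ θ' : ℝ, IsHyperidealTriangle (dirII w₁ w₂ θ')) ∧
    ∀ θ' : ℝ, IsHyperidealTriangle (dirII w₁ w₂ θ') →
      ∃ (h : Fin 6 → groupCohomology.H1 (minkRep (surfaceGroup w₁ w₂)))
        (q : Fin 4 → groupCohomology.H1 (minkRep (surfaceGroup w₁ w₂))),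
        -- the hexagon `H`, the two pentagons, and the quadrilateral `Q`
        IsConvexPolygon h (P₁ w₁ w₂ θ ∪ P₂ w₁ w₂ θ') ∧
        IsConvexPolygon ![h 0, h 1, h 2, h 4, h 5] (P₁ w₁ w₂ θ) ∧
        IsConvexPolygon ![h 1, h 2, h 3, h 4, h 5] (P₂ w₁ w₂ θ') ∧
        IsConvexPolygon q (Q w₁ w₂) ∧
        -- the sides of `Q` lie on the lines where the invariants of `A`, `X`, `B`, `Y` vanish
        (margulis (gA w₁ w₂) (q 0) = 0 ∧ margulis (gA w₁ w₂) (q 1) = 0) ∧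
        (margulis (gX w₁ w₂) (q 1) = 0 ∧ margulis (gX w₁ w₂) (q 2) = 0) ∧
        (margulis (gB w₁ w₂) (q 2) = 0 ∧ margulis (gB w₁ w₂) (q 3) = 0) ∧
        (margulis (gY w₁ w₂) (q 3) = 0 ∧ margulis (gY w₁ w₂) (q 0) = 0) ∧
        -- `H` is inscribed in `Q`
        h 0 ∈ openSide (q 0) (q 1) ∧
        h 1 ∈ openSide (q 1) (q 2) ∧ h 2 ∈ openSide (q 1) (q 2) ∧
        h 3 ∈ openSide (q 2) (q 3) ∧
        h 4 ∈ openSide (q 3) (q 0) ∧ h 5 ∈ openSide (q 3) (q 0) := by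
  obtain ⟨h12, h1, h2⟩ := ultra_of_dirI hκ
  refine ⟨finrank_H1 hκ, exists_flip hκ, fun θ' hκ' => ?_⟩
  obtain ⟨h12', h1', h2'⟩ : Ultra w₁ (iota₀.1 w₂) ∧ Ultra w₁ (w₀ θ') ∧
      Ultra (iota₀.1 w₂) (w₀ θ') := ultra_of_dirI hκ'
  have l1 := dot_j₀_lt h1
  have l2 := dot_j₀_lt h2
  have l1' := dot_j₀_lt h1'
  have l2' := dot_j₀_lt h2'
  obtain ⟨X1, X2, X3, X4⟩ := margulis_gX_values hκ
  obtain ⟨Y1, Y2, Y3, Y4⟩ := margulis_gY_values hκ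
  obtain ⟨⟨A1, A2, A3, A4⟩, A0⟩ := margulis_gA_values hκ
  obtain ⟨⟨B1, B2, B3, B4⟩, B0⟩ := margulis_gB_values hκ
  have o' := order_dichotomy h12' h1' h2'
  rw [cross_iota₀] at o'
  rw [dot_nullMinus_iota₀_j₀, dot_nullPlus_iota₀_j₀] at l2' o'
  rcases order_dichotomy h12 h1 h2 with ⟨hc, ho⟩ | ⟨hc, ho⟩
  · have ho' := (o'.resolve_left fun h => by linarith [h.1]).2
    exact HexagonData.exists_polygons
      { finrank := finrank_H1 hκ
        indep := rays_independent_ccw hκ ho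
        rel := rays_relation_ccw hκ
        eq₀ := apexI_eq_ccw hκ
        eq₃ := apexII_eq_ccw hκ θ'
        A_pos := by linarith
        C_pos := by linarith
        C_lt_B := by linarith
        A'_pos := by linarith
        C'_pos := by linarith
        C'_lt_B' := by linarith }
      A4 A1 A0 B3 B2 (B0 θ') X4 X3 X2 Y2 Y1 Y4
      ((domainClasses_dirI hκ).trans (openCone_eq_of_perm ![0, 4, 3, 2, 1] (by decide) (by
        ext1 i; fin_cases i <;> rfl)))
      ((domainClasses_dirII hκ hκ').trans (openCone_eq_of_perm ![2, 4, 3, 1, 0] (by decide) (by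
        ext1 i; fin_cases i <;> rfl)))
  · have ho' := (o'.resolve_right fun h => by linarith [h.1]).2
    exact HexagonData.exists_polygons
      { finrank := finrank_H1 hκ
        indep := rays_independent_cw hκ ho
        rel := rays_relation_cw hκ
        eq₀ := apexI_eq_cw hκ
        eq₃ := apexII_eq_cw hκ θ'
        A_pos := by linarith
        C_pos := by linarith
        C_lt_B := by linarith
        A'_pos := by linarith
        C'_pos := by linarith
        C'_lt_B' := by linarith }
      A3 A2 A0 B4 B1 (B0 θ') X3 X4 X1 Y1 Y2 Y3
      ((domainClasses_dirI hκ).trans (openCone_eq_of_perm ![0, 3, 4, 1, 2] (by decide) (by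
        ext1 i; fin_cases i <;> rfl)))
      ((domainClasses_dirII hκ hκ').trans (openCone_eq_of_perm ![2, 3, 4, 0, 1] (by decide) (by
        ext1 i; fin_cases i <;> rfl)))
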